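/- **Theorem 2.3 (Caccioppoli).** Let $(M,g)$ be a compact smooth four-dimensional Riemannian manifold without boundary, with volume measure $dv$, Laplace-Beltrami operator $\Delta=\mathrm{div}\,\nabla$, Ricci tensor $Ric$, scalar curvature $R$ and injectivity radius $i_0$, and let $\gamma_2,\gamma_3\in\mathbb R$ with $\gamma_3\neq 0$ and $\gamma_2/\gamma_3>3/2$. For smooth $w:M\to\mathbb R$ put $$\mathcal N(w)=\frac{\gamma_2}{2}P w+6\gamma_3\Delta(\Delta w+|\nabla w|^2)-12\gamma_3\,\mathrm{div}\big[(\Delta w+|\nabla w|^2)\nabla w\big]+2\gamma_3\,\mathrm{div}(R\nabla w),$$ where $P w=\Delta^2 w-\mathrm{div}\big(\tfrac23 R\nabla w-2Ric(\cdot,\nabla w)\big)$ is the Paneitz operator. Then there are $C>0$ and $k_0>0$, depending only on $(M,g),\gamma_2,\gamma_3$, such that $$\int_{\{|w-c|<k\}\cap B_\rho}\big[(\Delta w)^2+|\nabla w|^4\big]\,dv\le \frac{C}{(r-\rho)^4}\int_{B_r\setminus B_\rho}\big(1+(w-c)^4\big)\,dv+Ck\int_{B_r}|f|\,dv$$ for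 all $0<\rho<r<i_0$, all geodesic balls $B_\rho\subset B_r$ of radii $\rho,r$ with the same center, all $c\in\mathbb R$, all $k\ge k_0$, and all smooth solutions $w$ of $\mathcal N(w)=f$ in $M$, where $f:M\to\mathbb R$ has mean value $\overline f=\frac{1}{|M|}\int_M f\,dv=0$. -/

import Mathlib

open MeasureTheory Set Bundle
open scoped Manifold ContDiff ENNReal

noncomputable section

namespace LogDet

/-- The model space `ℝ⁴` with its Euclidean structure. -/
abbrev E4 : Type := EuclideanSpace ℝ (Fin 4)

/-! ### Riemannian geometry in a coordinate patch

`G y` is the matrix `(g_ij(y))` of the metric at the coordinate point `y`. Indices are written as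
function arguments, and the components of a vector field are `X : E4 → Fin 4 → ℝ`. -/

/-- The partial derivative `∂_i u` at `y`. -/
def pd (i : Fin 4) (u : E4 → ℝ) (y : E4) : ℝ :=
  fderiv ℝ u y (EuclideanSpace.single i 1)

/-- The Christoffel symbols
`Γ^k_ij = ½ g^{kl} (∂_i g_jl + ∂_j g_il - ∂_l g_ij)`. -/
def christoffel (G : E4 → Matrix (Fin 4) (Fin 4) ℝ) (k i j : Fin 4) (y : E4) : ℝ :=
  (1 / 2) * ∑ l, (G y)⁻¹ k l *
    (pd i (fun z => G z j l) y + pd j (fun z => G z i l) y - pd l (fun z => G z i j) y)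

/-- The Ricci tensor
`Ric_ij = ∂_k Γ^k_ij - ∂_j Γ^k_ik + Γ^k_kl Γ^l_ij - Γ^k_jl Γ^l_ik`
(it equals `(n - 1) g` on the unit sphere of dimension `n`). -/
def ricci (G : E4 → Matrix (Fin 4) (Fin 4) ℝ) (i j : Fin 4) (y : E4) : ℝ :=
  ∑ k, (pd k (christoffel G k i j) y - pd j (christoffel G k i k) y) +
    ∑ k, ∑ l, (christoffel G k k l y * christoffel G l i j y
      - christoffel G k j l y * christoffel G l i k y)

/-- The scalar curvature `R = g^{ij} Ric_ij`. -/
def scalar (G : E4 → Matrix (Fin 4) (Fin 4) ℝ) (y : E4) : ℝ :=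
  ∑ i, ∑ j, (G y)⁻¹ i j * ricci G i j y

/-- The components `g^{ij} ∂_j u` of the gradient. -/
def gradC (G : E4 → Matrix (Fin 4) (Fin 4) ℝ) (u : E4 → ℝ) (y : E4) (i : Fin 4) : ℝ :=
  ∑ j, (G y)⁻¹ i j * pd j u y

/-- `|∇u|² = g^{ij} ∂_i u ∂_j u`. -/
def gradSqC (G : E4 → Matrix (Fin 4) (Fin 4) ℝ) (u : E4 → ℝ) (y : E4) : ℝ :=
  ∑ i, ∑ j, (G y)⁻¹ i j * pd i u y * pd j u y

/-- The divergence `(det g)^{-1/2} ∂_i ((det g)^{1/2} X^i)` of a vector field. -/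
def divC (G : E4 → Matrix (Fin 4) (Fin 4) ℝ) (X : E4 → Fin 4 → ℝ) (y : E4) : ℝ :=
  (Real.sqrt (G y).det)⁻¹ * ∑ i, pd i (fun z => Real.sqrt (G z).det * X z i) y

/-- The Laplace-Beltrami operator `Δu = div ∇u` (nonpositive spectrum). -/
def lapC (G : E4 → Matrix (Fin 4) (Fin 4) ℝ) (u : E4 → ℝ) (y : E4) : ℝ :=
  divC G (gradC G u) y

/-- The components `g^{ij} Ric_jk X^k` of the vector field dual to `Ric(·, X)`. -/
def ricSharp (G : E4 → Matrix (Fin 4) (Fin 4) ℝ) (X : E4 → Fin 4 → ℝ) (y : E4) (i : Fin 4) : ℝ :=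
  ∑ j, ∑ k, (G y)⁻¹ i j * ricci G j k y * X y k

/-- The Paneitz operator `P u = Δ²u - div(⅔ R ∇u - 2 Ric(·, ∇u))`. -/
def paneitzC (G : E4 → Matrix (Fin 4) (Fin 4) ℝ) (u : E4 → ℝ) (y : E4) : ℝ :=
  lapC G (lapC G u) y -
    divC G (fun z i => 2 / 3 * scalar G z * gradC G u z i - 2 * ricSharp G (gradC G u) z i) y

/-- The quasilinear operator
`N(u) = (γ₂/2) P u + 6 γ₃ Δ(Δu + |∇u|²) - 12 γ₃ div((Δu + |∇u|²) ∇u) + 2 γ₃ div(R ∇u)`. -/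
def opNC (γ₂ γ₃ : ℝ) (G : E4 → Matrix (Fin 4) (Fin 4) ℝ) (u : E4 → ℝ) (y : E4) : ℝ :=
  γ₂ / 2 * paneitzC G u y
    + 6 * γ₃ * lapC G (fun z => lapC G u z + gradSqC G u z) y
    - 12 * γ₃ * divC G (fun z i => (lapC G u z + gradSqC G u z) * gradC G u z i) y
    + 2 * γ₃ * divC G (fun z i => scalar G z * gradC G u z i) y

/-! ### Passage to a four-dimensional Riemannian manifold

Every operator is computed at `x` in the preferred chart at `x`; all the expressions above are
invariant under changes of coordinates, so that the choice of the chart is immaterial. -/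

section Manifold

variable {M : Type*} [EMetricSpace M] [ChartedSpace E4 M] [IsManifold (𝓡 4) ∞ M]
  [RiemannianBundle (fun x : M => TangentSpace (𝓡 4) x)]

/-- The matrix `g_ij = ⟨∂_i, ∂_j⟩` of the metric in the preferred chart at `x₀`, at the point of the
manifold with coordinates `y` (meaningful for `y` in the range of the chart). -/
def metricMatrix (x₀ : M) (y : E4) : Matrix (Fin 4) (Fin 4) ℝ :=
  Matrix.of fun i j =>
    inner ℝ
      (mfderiv (𝓡 4) (𝓡 4) (extChartAt (𝓡 4) x₀).symm y (EuclideanSpace.single i (1 : ℝ)) :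
        TangentSpace (𝓡 4) ((extChartAt (𝓡 4) x₀).symm y))
      (mfderiv (𝓡 4) (𝓡 4) (extChartAt (𝓡 4) x₀).symm y (EuclideanSpace.single j (1 : ℝ)))

/-- The coordinate expression of a function in the preferred chart at `x₀`. -/
def inChart (x₀ : M) (w : M → ℝ) (y : E4) : ℝ := w ((extChartAt (𝓡 4) x₀).symm y)

/-- The Laplace-Beltrami operator of `M`. -/
def laplacian (w : M → ℝ) (x : M) : ℝ :=
  lapC (metricMatrix x) (inChart x w) (extChartAt (𝓡 4) x x)

/-- The function `|∇w|²` on `M`. -/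
def gradSq (w : M → ℝ) (x : M) : ℝ :=
  gradSqC (metricMatrix x) (inChart x w) (extChartAt (𝓡 4) x x)

/-- The operator `N` of `M`. -/
def opN (γ₂ γ₃ : ℝ) (w : M → ℝ) (x : M) : ℝ :=
  opNC γ₂ γ₃ (metricMatrix x) (inChart x w) (extChartAt (𝓡 4) x x)

/-- The measure `(det g)^{1/2} dy` of the domain of the preferred chart at `x₀`, extended by zero
outside this domain. -/
def chartVolume [MeasurableSpace M] (x₀ : M) : Measure M :=
  (((volume : Measure E4).restrict (extChartAt (𝓡 4) x₀).target).withDensity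
    (fun y => ENNReal.ofReal (Real.sqrt (metricMatrix x₀ y).det))).map (extChartAt (𝓡 4) x₀).symm

variable (M) in
/-- The Riemannian volume measure `dv`: the least measure that dominates
`(det g)^{1/2} dy` in each chart. Since the chart measures agree on overlaps, it coincides with
`(det g)^{1/2} dy` in each chart. -/
def riemVolume [MeasurableSpace M] : Measure M := ⨆ x₀ : M, chartVolume x₀

/-- Smooth curves `γ : ℝ → M` that solve the geodesic equation
`u_k'' + Γ^k_ij u_i' u_j' = 0`, where `u` is `γ` read in the preferred chart at `γ t`. -/
def IsGeodesic (γ : ℝ → M) : Prop :=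
  ContMDiff 𝓘(ℝ, ℝ) (𝓡 4) ∞ γ ∧
    ∀ (t : ℝ) (k : Fin 4),
      deriv (deriv fun s => extChartAt (𝓡 4) (γ t) (γ s) k) t +
        ∑ i, ∑ j, christoffel (metricMatrix (γ t)) k i j (extChartAt (𝓡 4) (γ t) (γ t)) *
          deriv (fun s => extChartAt (𝓡 4) (γ t) (γ s) i) t *
          deriv (fun s => extChartAt (𝓡 4) (γ t) (γ s) j) t = 0

open Classical in
/-- The exponential map at `p`: `exp_p v = γ 1` for the geodesic `γ` with `γ 0 = p`, `γ' 0 = v`.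
This geodesic is unique, and it exists for all `v` if `M` is compact. -/
def expMap (p : M) (v : TangentSpace (𝓡 4) p) : M :=
  if h : ∃ γ : ℝ → M, IsGeodesic γ ∧ γ 0 = p ∧
      HasMFDerivAt 𝓘(ℝ, ℝ) (𝓡 4) γ 0 ((1 : ℝ →L[ℝ] ℝ).smulRight v)
  then h.choose 1 else p

/-- The injectivity radius at `p`: the supremum of the `a` such that the exponential map at `p` is
a diffeomorphism (a smooth bijection with invertible differential) of the ball `B(0, a)` of the
tangent space onto the geodesic ball `B(p, a)`. -/
def injRadiusAt (p : M) : ℝ≥0∞ :=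
  ⨆ (a : ℝ) (_ : BijOn (expMap p) (Metric.ball (0 : TangentSpace (𝓡 4) p) a)
        (Metric.eball p (ENNReal.ofReal a)) ∧
      ContMDiffOn 𝓘(ℝ, TangentSpace (𝓡 4) p) (𝓡 4) ∞ (expMap p)
        (Metric.ball (0 : TangentSpace (𝓡 4) p) a) ∧
      ∀ v ∈ Metric.ball (0 : TangentSpace (𝓡 4) p) a,
        Function.Bijective (mfderiv 𝓘(ℝ, TangentSpace (𝓡 4) p) (𝓡 4) (expMap p) v)),
    ENNReal.ofReal a

variable (M) in
/-- The injectivity radius of `M`. -/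
def injRadius : ℝ≥0∞ := ⨅ p : M, injRadiusAt p

end Manifold

end LogDet

end

/-!
The equation is tested with `φ = χ ^ 4 ψ(w)`, where `χ` is a cutoff function between the two balls
and `ψ(s) = k Ψ((s - c) / k)` truncates `s - c` at the level `k`. Write `A = Δw` and `B = |∇w|²`.
After division by `γ₃` the fourth order part of `N(w)` contributes
`χ ^ 4 ψ'(w) (a A² + 18 A B + 12 B²)` with `a = γ₂ / (2 γ₃) + 6`, plus terms containing `ψ''(w)` or
derivatives of `χ`. This quadratic form is positive definite exactly when `a > 27 / 4`, that is
`γ₂ / γ₃ > 3 / 2` (`exists_coercive_quadratic`), so it controls `A² + B²` with the weight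
`χ ^ 4 ψ'(w)`, and everything else is to be absorbed or moved to the right-hand side.

The choice of `Ψ` makes this work with no information on `w` beyond the equation. A sharp truncation
is not available, because `Δφ` contains `ψ''(w) |∇w|²`. Instead `Ψ' = (1 + σ²) ^ (-2 / 3) = m ^ 4`
is integrable, so `Ψ` is bounded, which gives the term `C k ∫ |f|`; `|Ψ''| ≤ Ψ'` makes the
`ψ''`-terms of relative size `1 / k`, absorbed for `k ≥ k₀`; and `|Ψ| ≤ C |σ| m ³`
(`exists_truncation`) matches the weights in the terms with derivatives of `χ`: Young's inequality
trades each of them for a small multiple of `χ ^ 4 m ^ 4 (A² + B²)` and a multiple of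
`(|∇χ| ^ 4 + (Δχ)²) (1 + (w - c) ^ 4)`. The curvature terms leave only an additive constant. The
outcome is the pointwise inequality `exists_weakForm_coercivity`.

Three facts from geometry turn it into the estimate.

* The weak form `∫ N(w) φ = ∫ weakForm w φ` (`integral_opN_mul`). In one chart it is integration by
  parts against `√det G`; a partition of unity for `φ` reduces to that case, once `N` is known to
  have the same coordinate expression in all charts (`IsCoordChange.opNC_eq`, which rests on the
  transformation laws of the Christoffel symbols and of the curvature).
* Cutoff functions with `|∇χ| ≤ C / h` and `|Δχ| ≤ C / h²` at every scale `h ≤ 1`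
  (`exists_cutoff`). The distance function need not be smooth, so they are obtained by mollifying the
  indicator function of a ball in finitely many charts, in which the Riemannian and the Euclidean
  distance are comparable.
* The constant left by the curvature terms, integrated over `M`, is absorbed by the annulus
  integral, because `|B_r \ B_ρ| ≥ v (r - ρ) ^ 4` (`exists_volume_annulus_lower_bound`). This is
  where the injectivity radius enters: below it every sphere is nonempty
  (`exists_edist_eq_of_lt_injRadius`), for otherwise the exponential map would send an open ball of
  the tangent space homeomorphically onto a compact set. A ball centred on the middle sphere then
  lies in the annulus, and volumes of small balls are bounded below in charts.
-/

open scoped Topology Matrix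

noncomputable section

namespace LogDet

set_option linter.unusedSectionVars false

/-! ### Partial derivatives -/

section PartialDerivatives

variable {U : Set E4} {u v : E4 → ℝ} {y : E4}

theorem differentiableAt_of_contDiffOn {F : Type*} [NormedAddCommGroup F] [NormedSpace ℝ F]
    {u : E4 → F} (hU : IsOpen U) (hu : ContDiffOn ℝ ∞ u U) (hy : y ∈ U) :
    DifferentiableAt ℝ u y :=
  (hu.differentiableOn (by simp)).differentiableAt (hU.mem_nhds hy)

theorem pd_congr {i : Fin 4} (h : u =ᶠ[𝓝 y] v) : pd i u y = pd i v y := by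
  unfold pd
  rw [h.fderiv_eq]

theorem pd_eqOn (hU : IsOpen U) (h : EqOn u v U) (i : Fin 4) : EqOn (pd i u) (pd i v) U :=
  fun _ hy => pd_congr (h.eventuallyEq_of_mem (hU.mem_nhds hy))

theorem contDiffOn_pd (hU : IsOpen U) (hu : ContDiffOn ℝ ∞ u U) (i : Fin 4) :
    ContDiffOn ℝ ∞ (pd i u) U :=
  (hu.fderiv_of_isOpen hU (by simp)).clm_apply contDiffOn_const

theorem pd_const (i : Fin 4) (c : ℝ) (y : E4) : pd i (fun _ => c) y = 0 := by
  simp [pd]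

theorem pd_add (hu : DifferentiableAt ℝ u y) (hv : DifferentiableAt ℝ v y) (i : Fin 4) :
    pd i (fun z => u z + v z) y = pd i u y + pd i v y := by
  unfold pd
  rw [fderiv_fun_add hu hv]; rfl

theorem pd_mul (hu : DifferentiableAt ℝ u y) (hv : DifferentiableAt ℝ v y) (i : Fin 4) :
    pd i (fun z => u z * v z) y = u y * pd i v y + pd i u y * v y := by
  unfold pd
  rw [fderiv_fun_mul hu hv]; simp; ring

theorem pd_sum {ι : Type*} {s : Finset ι} {F : ι → E4 → ℝ}
    (h : ∀ a ∈ s, DifferentiableAt ℝ (F a) y) (i : Fin 4) :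
    pd i (fun z => ∑ a ∈ s, F a z) y = ∑ a ∈ s, pd i (F a) y := by
  unfold pd
  rw [fderiv_fun_sum h]; simp

theorem pd_comp_real {g : ℝ → ℝ} (hg : DifferentiableAt ℝ g (u y)) (hu : DifferentiableAt ℝ u y)
    (i : Fin 4) : pd i (fun z => g (u z)) y = deriv g (u y) * pd i u y := by
  unfold pd
  have h := fderiv_comp y hg hu
  have h2 : (fun z => g (u z)) = g ∘ u := rfl
  rw [h2, h]
  simp [mul_comm]

theorem pd_comm (hU : IsOpen U) (hu : ContDiffOn ℝ ∞ u U) (hy : y ∈ U) (i j : Fin 4) :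
    pd i (pd j u) y = pd j (pd i u) y := by
  have hs : IsSymmSndFDerivAt ℝ u y :=
    (hu.contDiffAt (hU.mem_nhds hy)).isSymmSndFDerivAt
      (by simp only [minSmoothness_of_isRCLikeNormedField]; exact ENat.LEInfty.out)
  have hd : DifferentiableAt ℝ (fderiv ℝ u) y :=
    ((hu.fderiv_of_isOpen hU (m := ∞) (by simp)).differentiableOn (by simp)).differentiableAt
      (hU.mem_nhds hy)
  have key : ∀ a b : Fin 4, pd a (pd b u) y =
      fderiv ℝ (fderiv ℝ u) y (EuclideanSpace.single a 1) (EuclideanSpace.single b 1) := by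
    intro a b
    have : pd b u = fun z => fderiv ℝ u z (EuclideanSpace.single b 1) := rfl
    unfold pd at this ⊢
    rw [this, fderiv_clm_apply hd (differentiableAt_const _)]
    simp
  rw [key, key, hs.eq]

theorem fderiv_apply_eq_sum (u : E4 → ℝ) (y v : E4) : fderiv ℝ u y v = ∑ a, v a * pd a u y := by
  have hv : v = ∑ a, v a • (EuclideanSpace.single a (1 : ℝ) : E4) := by
    ext k
    simp [Pi.single_apply]
  conv_lhs => rw [hv]
  simp [map_sum, pd]

theorem pd_comp {T : E4 → E4} (hT : DifferentiableAt ℝ T y) (hu : DifferentiableAt ℝ u (T y))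
    (i : Fin 4) : pd i (fun z => u (T z)) y = ∑ a, pd i (fun z => T z a) y * pd a u (T y) := by
  have h : pd i (fun z => u (T z)) y
      = fderiv ℝ u (T y) (fderiv ℝ T y (EuclideanSpace.single i 1)) := by
    have h := fderiv_comp y hu hT
    have h2 : (fun z => u (T z)) = u ∘ T := rfl
    unfold pd
    rw [h2, h]
    rfl
  rw [h, fderiv_apply_eq_sum]
  refine Finset.sum_congr rfl fun a _ => ?_
  congr 1
  unfold pd
  have h3 : HasFDerivAt (fun z => T z a) ((EuclideanSpace.proj a : E4 →L[ℝ] ℝ).comp (fderiv ℝ T y)) y :=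
    (EuclideanSpace.proj a : E4 →L[ℝ] ℝ).hasFDerivAt.comp y hT.hasFDerivAt
  rw [h3.fderiv]
  rfl

end PartialDerivatives

/-! ### Matrix-valued functions -/

section MatrixFunctions

variable {U : Set E4} {A B : E4 → Matrix (Fin 4) (Fin 4) ℝ} {y : E4}

/-- The entrywise partial derivative `∂_i A` of a matrix-valued function. -/
def mpd (i : Fin 4) (A : E4 → Matrix (Fin 4) (Fin 4) ℝ) (y : E4) : Matrix (Fin 4) (Fin 4) ℝ :=
  Matrix.of fun k l => pd i (fun z => A z k l) y

/-- Smoothness of all entries of a matrix-valued function. No norm on matrices is involved. -/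
def MSmoothOn (A : E4 → Matrix (Fin 4) (Fin 4) ℝ) (U : Set E4) : Prop :=
  ∀ k l, ContDiffOn ℝ ∞ (fun z => A z k l) U

theorem mpd_eqOn (hU : IsOpen U) (h : EqOn A B U) (i : Fin 4) : EqOn (mpd i A) (mpd i B) U := by
  intro y hy
  ext k l
  exact pd_eqOn hU (fun z hz => by rw [h hz]) i hy

theorem MSmoothOn.mpd (hU : IsOpen U) (hA : MSmoothOn A U) (i : Fin 4) :
    MSmoothOn (mpd i A) U :=
  fun k l => contDiffOn_pd hU (hA k l) i

theorem MSmoothOn.mul (hA : MSmoothOn A U) (hB : MSmoothOn B U) :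
    MSmoothOn (fun z => A z * B z) U := by
  intro k l
  simp only [Matrix.mul_apply]
  exact ContDiffOn.sum fun a _ => (hA k a).mul (hB a l)

theorem MSmoothOn.add (hA : MSmoothOn A U) (hB : MSmoothOn B U) :
    MSmoothOn (fun z => A z + B z) U :=
  fun k l => (hA k l).add (hB k l)

theorem MSmoothOn.transpose (hA : MSmoothOn A U) : MSmoothOn (fun z => (A z)ᵀ) U :=
  fun k l => hA l k

theorem MSmoothOn.det (hA : MSmoothOn A U) : ContDiffOn ℝ ∞ (fun z => (A z).det) U := by
  simp only [Matrix.det_apply]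
  refine ContDiffOn.sum fun σ _ => ContDiffOn.const_smul _ ?_
  exact contDiffOn_prod fun a _ => hA _ _

theorem MSmoothOn.adjugate (hA : MSmoothOn A U) : MSmoothOn (fun z => (A z).adjugate) U := by
  intro k l
  simp only [Matrix.adjugate_apply]
  refine MSmoothOn.det fun a b => ?_
  by_cases h : a = l
  · subst h; simpa using contDiffOn_const
  · simpa [Matrix.updateRow_apply, h] using hA a b

theorem MSmoothOn.inv (hA : MSmoothOn A U) (h : ∀ y ∈ U, (A y).det ≠ 0) :
    MSmoothOn (fun z => (A z)⁻¹) U := by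
  intro k l
  have : (fun z => (A z)⁻¹ k l) = fun z => ((A z).det)⁻¹ * (A z).adjugate k l := by
    funext z
    simp [Matrix.inv_def]
  rw [this]
  exact (hA.det.inv h).mul (hA.adjugate k l)

theorem mpd_mul (hU : IsOpen U) (hA : MSmoothOn A U) (hB : MSmoothOn B U) (hy : y ∈ U)
    (i : Fin 4) : mpd i (fun z => A z * B z) y = A y * mpd i B y + mpd i A y * B y := by
  ext k l
  simp only [mpd, Matrix.mul_apply, Matrix.of_apply, Matrix.add_apply]
  rw [pd_sum, ← Finset.sum_add_distrib]
  · refine Finset.sum_congr rfl fun a _ => ?_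
    exact pd_mul (differentiableAt_of_contDiffOn hU (hA k a) hy)
      (differentiableAt_of_contDiffOn hU (hB a l) hy) i
  · exact fun a _ => (differentiableAt_of_contDiffOn hU (hA k a) hy).mul
      (differentiableAt_of_contDiffOn hU (hB a l) hy)

theorem mpd_add (hU : IsOpen U) (hA : MSmoothOn A U) (hB : MSmoothOn B U) (hy : y ∈ U)
    (i : Fin 4) : mpd i (fun z => A z + B z) y = mpd i A y + mpd i B y := by
  ext k l
  exact pd_add (differentiableAt_of_contDiffOn hU (hA k l) hy)
      (differentiableAt_of_contDiffOn hU (hB k l) hy) i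

theorem mpd_transpose (i : Fin 4) : mpd i (fun z => (A z)ᵀ) y = (mpd i A y)ᵀ := rfl

theorem mpd_const (i : Fin 4) (C : Matrix (Fin 4) (Fin 4) ℝ) : mpd i (fun _ => C) y = 0 := by
  ext k l
  simp [mpd, pd_const]

theorem mpd_inv (hU : IsOpen U) (hA : MSmoothOn A U) (h : ∀ y ∈ U, (A y).det ≠ 0) (hy : y ∈ U)
    (i : Fin 4) : mpd i (fun z => (A z)⁻¹) y = - ((A y)⁻¹ * mpd i A y * (A y)⁻¹) := by
  have h1 : mpd i (fun z => A z * (A z)⁻¹) y = 0 := by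
    rw [mpd_eqOn (B := fun _ => 1) hU (fun z hz => ?_) i hy, mpd_const]
    exact Matrix.mul_nonsing_inv _ (h z hz).isUnit
  rw [mpd_mul hU hA (hA.inv h) hy] at h1
  have h2 := Matrix.nonsing_inv_mul (A y) (h y hy).isUnit
  have h3 : (A y)⁻¹ * (A y * mpd i (fun z => (A z)⁻¹) y + mpd i A y * (A y)⁻¹) = 0 := by
    rw [h1, mul_zero]
  rw [mul_add, ← mul_assoc, ← mul_assoc, h2, one_mul] at h3
  exact eq_neg_of_add_eq_zero_left h3

/-- Jacobi's formula for the derivative of a determinant. -/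
theorem pd_det (hU : IsOpen U) (hA : MSmoothOn A U) (h : ∀ y ∈ U, (A y).det ≠ 0) (hy : y ∈ U)
    (i : Fin 4) :
    pd i (fun z => (A z).det) y = (A y).det * ((A y)⁻¹ * mpd i A y).trace := by
  have hd : ∀ k l, DifferentiableAt ℝ (fun z => A z k l) y :=
    fun k l => differentiableAt_of_contDiffOn hU (hA k l) hy
  -- The determinant is multilinear in the rows.
  obtain ⟨D, hD⟩ : ∃ D : ContinuousMultilinearMap ℝ (fun _ : Fin 4 => (Fin 4 → ℝ)) ℝ,
      ∀ m, D m = (Matrix.of m).det :=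
    ⟨⟨(Matrix.detRowAlternating : (Fin 4 → ℝ) [⋀^Fin 4]→ₗ[ℝ] ℝ).toMultilinearMap,
      Continuous.matrix_det (A := fun m : Fin 4 → Fin 4 → ℝ => Matrix.of m) continuous_id⟩,
      fun _ => rfl⟩
  have hrow : HasFDerivAt (fun z k l => A z k l)
      (ContinuousLinearMap.pi fun k => ContinuousLinearMap.pi fun l =>
        fderiv ℝ (fun z => A z k l) y) y :=
    hasFDerivAt_pi.2 fun k => hasFDerivAt_pi.2 fun l => (hd k l).hasFDerivAt
  have hDA := (D.hasFDerivAt (fun k l => A y k l)).comp y hrow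
  have e1 : pd i (fun z => (A z).det) y = ∑ k, ((A y).updateRow k (mpd i A y k)).det := by
    have e2 : (fun z => (A z).det) = (⇑D ∘ fun z k l => A z k l) := by
      funext z
      simp only [Function.comp_apply, hD]
      rfl
    unfold pd
    rw [e2, hDA.fderiv, ContinuousLinearMap.comp_apply, ContinuousMultilinearMap.linearDeriv_apply]
    refine Finset.sum_congr rfl fun k _ => ?_
    rw [hD]
    rfl
  have e3 : ∀ k, ((A y).updateRow k (mpd i A y k)).det
      = ∑ l, mpd i A y k l * (A y).adjugate l k := by
    intro k
    rw [← Matrix.cramer_transpose_apply, Matrix.cramer_eq_adjugate_mulVec, Matrix.mulVec,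
      dotProduct, ← Matrix.adjugate_transpose]
    exact Finset.sum_congr rfl fun l _ => by rw [Matrix.transpose_apply, mul_comm]
  have e4 : (A y).adjugate = (A y).det • (A y)⁻¹ := by
    rw [Matrix.inv_def, smul_smul, Ring.mul_inverse_cancel _ (h y hy).isUnit, one_smul]
  rw [e1]
  simp only [e3, e4, Matrix.trace, Matrix.diag, Matrix.mul_apply, Matrix.smul_apply, smul_eq_mul,
    Finset.mul_sum]
  rw [Finset.sum_comm]
  exact Finset.sum_congr rfl fun l _ => Finset.sum_congr rfl fun k _ => by ring

end MatrixFunctions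

/-! ### Smooth metrics on open sets of the model space -/

/-- `G` is a smooth Riemannian metric on the open set `U`. -/
structure IsMetricOn (G : E4 → Matrix (Fin 4) (Fin 4) ℝ) (U : Set E4) : Prop where
  isOpen : IsOpen U
  smooth : MSmoothOn G U
  posDef : ∀ y ∈ U, (G y).PosDef

/-- The pairing `⟨∇u, ∇v⟩ = g^{ij} ∂_i u ∂_j v`. -/
def ipC (G : E4 → Matrix (Fin 4) (Fin 4) ℝ) (u v : E4 → ℝ) (y : E4) : ℝ :=
  ∑ i, ∑ j, (G y)⁻¹ i j * pd i u y * pd j v y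

/-- The value `Ric(∇u, ∇v)`. -/
def ricFormC (G : E4 → Matrix (Fin 4) (Fin 4) ℝ) (u v : E4 → ℝ) (y : E4) : ℝ :=
  ∑ i, ricSharp G (gradC G u) y i * pd i v y

/-- The connection matrix `(Γ_i)^k_j` of the `i`-th coordinate direction. -/
def conn (G : E4 → Matrix (Fin 4) (Fin 4) ℝ) (i : Fin 4) (y : E4) : Matrix (Fin 4) (Fin 4) ℝ :=
  Matrix.of fun k j => christoffel G k i j y

/-- The first-order part of the weak form of the operator `N`. -/
def lowerC (γ₂ γ₃ : ℝ) (G : E4 → Matrix (Fin 4) (Fin 4) ℝ) (u v : E4 → ℝ) (y : E4) : ℝ :=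
  γ₂ / 2 * (2 / 3 * scalar G y * ipC G u v y - 2 * ricFormC G u v y)
    - 2 * γ₃ * (scalar G y * ipC G u v y)

/-- The weak form of the operator `N`: the integrand of `∫ v N(u)` once all derivatives in excess
of the second have been moved to the test function `v`. -/
def weakC (γ₂ γ₃ : ℝ) (G : E4 → Matrix (Fin 4) (Fin 4) ℝ) (u v : E4 → ℝ) (y : E4) : ℝ :=
  γ₂ / 2 * (lapC G u y * lapC G v y)
    + 6 * γ₃ * ((lapC G u y + gradSqC G u y) * lapC G v y)
    + 12 * γ₃ * ((lapC G u y + gradSqC G u y) * ipC G u v y)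
    + lowerC γ₂ γ₃ G u v y

variable {G : E4 → Matrix (Fin 4) (Fin 4) ℝ} {U : Set E4} {u v : E4 → ℝ} {y : E4}

namespace IsMetricOn

theorem mono (hG : IsMetricOn G U) {V : Set E4} (hV : IsOpen V) (h : V ⊆ U) : IsMetricOn G V :=
  ⟨hV, fun i j => (hG.smooth i j).mono h, fun y hy => hG.posDef y (h hy)⟩

theorem det_pos (hG : IsMetricOn G U) (hy : y ∈ U) : 0 < (G y).det := (hG.posDef y hy).det_pos

theorem det_ne (hG : IsMetricOn G U) : ∀ y ∈ U, (G y).det ≠ 0 := fun _ hy => (hG.det_pos hy).ne'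

theorem symm (hG : IsMetricOn G U) (hy : y ∈ U) : (G y)ᵀ = G y := by
  have := (hG.posDef y hy).1
  simpa [Matrix.IsHermitian, Matrix.conjTranspose_eq_transpose_of_trivial] using this

theorem inv_symm (hG : IsMetricOn G U) (hy : y ∈ U) : ((G y)⁻¹)ᵀ = (G y)⁻¹ := by
  rw [Matrix.transpose_nonsing_inv, hG.symm hy]

theorem symm_apply (hG : IsMetricOn G U) (hy : y ∈ U) (i j : Fin 4) : G y i j = G y j i := by
  conv_lhs => rw [← hG.symm hy]
  rfl

theorem inv_symm_apply (hG : IsMetricOn G U) (hy : y ∈ U) (i j : Fin 4) :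
    (G y)⁻¹ i j = (G y)⁻¹ j i := by
  conv_lhs => rw [← hG.inv_symm hy]
  rfl

theorem inv_mul (hG : IsMetricOn G U) (hy : y ∈ U) : (G y)⁻¹ * G y = 1 :=
  Matrix.nonsing_inv_mul _ (hG.det_ne y hy).isUnit

theorem mul_inv (hG : IsMetricOn G U) (hy : y ∈ U) : G y * (G y)⁻¹ = 1 :=
  Matrix.mul_nonsing_inv _ (hG.det_ne y hy).isUnit

theorem inv_smooth (hG : IsMetricOn G U) (i j : Fin 4) :
    ContDiffOn ℝ ∞ (fun z => (G z)⁻¹ i j) U :=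
  hG.smooth.inv hG.det_ne i j

theorem sqrt_det_pos (hG : IsMetricOn G U) (hy : y ∈ U) : 0 < Real.sqrt (G y).det :=
  Real.sqrt_pos.2 (hG.det_pos hy)

theorem sqrt_det_smooth (hG : IsMetricOn G U) :
    ContDiffOn ℝ ∞ (fun z => Real.sqrt (G z).det) U :=
  hG.smooth.det.sqrt hG.det_ne

theorem christoffel_smooth (hG : IsMetricOn G U) (k i j : Fin 4) :
    ContDiffOn ℝ ∞ (christoffel G k i j) U := by
  refine contDiffOn_const.mul (ContDiffOn.sum fun l _ => (hG.inv_smooth k l).mul ?_)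
  exact ((contDiffOn_pd hG.isOpen (hG.smooth j l) i).add
    (contDiffOn_pd hG.isOpen (hG.smooth i l) j)).sub (contDiffOn_pd hG.isOpen (hG.smooth i j) l)

theorem conn_smooth (hG : IsMetricOn G U) (i : Fin 4) : MSmoothOn (conn G i) U :=
  fun k j => hG.christoffel_smooth k i j

theorem ricci_smooth (hG : IsMetricOn G U) (i j : Fin 4) : ContDiffOn ℝ ∞ (ricci G i j) U := by
  have hc := hG.christoffel_smooth
  have hd : ∀ l k i j, ContDiffOn ℝ ∞ (pd l (christoffel G k i j)) U :=
    fun l k i j => contDiffOn_pd hG.isOpen (hc k i j) l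
  exact (ContDiffOn.sum fun k _ => (hd k k i j).sub (hd j k i k)).add
    (ContDiffOn.sum fun k _ => ContDiffOn.sum fun l _ =>
      ((hc k k l).mul (hc l i j)).sub ((hc k j l).mul (hc l i k)))

theorem scalar_smooth (hG : IsMetricOn G U) : ContDiffOn ℝ ∞ (scalar G) U :=
  ContDiffOn.sum fun i _ => ContDiffOn.sum fun j _ => (hG.inv_smooth i j).mul (hG.ricci_smooth i j)

theorem gradC_smooth (hG : IsMetricOn G U) (hu : ContDiffOn ℝ ∞ u U) (i : Fin 4) :
    ContDiffOn ℝ ∞ (fun z => gradC G u z i) U :=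
  ContDiffOn.sum fun j _ => (hG.inv_smooth i j).mul (contDiffOn_pd hG.isOpen hu j)

theorem ipC_smooth (hG : IsMetricOn G U) (hu : ContDiffOn ℝ ∞ u U) (hv : ContDiffOn ℝ ∞ v U) :
    ContDiffOn ℝ ∞ (ipC G u v) U :=
  ContDiffOn.sum fun i _ => ContDiffOn.sum fun j _ =>
    ((hG.inv_smooth i j).mul (contDiffOn_pd hG.isOpen hu i)).mul (contDiffOn_pd hG.isOpen hv j)

theorem gradSqC_smooth (hG : IsMetricOn G U) (hu : ContDiffOn ℝ ∞ u U) :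
    ContDiffOn ℝ ∞ (gradSqC G u) U :=
  hG.ipC_smooth hu hu

theorem divC_smooth (hG : IsMetricOn G U) {X : E4 → Fin 4 → ℝ}
    (hX : ∀ i, ContDiffOn ℝ ∞ (fun z => X z i) U) : ContDiffOn ℝ ∞ (divC G X) U := by
  refine (hG.sqrt_det_smooth.inv fun z hz => (hG.sqrt_det_pos hz).ne').mul
    (ContDiffOn.sum fun i _ => contDiffOn_pd hG.isOpen ?_ i)
  exact hG.sqrt_det_smooth.mul (hX i)

theorem lapC_smooth (hG : IsMetricOn G U) (hu : ContDiffOn ℝ ∞ u U) :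
    ContDiffOn ℝ ∞ (lapC G u) U :=
  hG.divC_smooth (hG.gradC_smooth hu)

theorem ricSharp_smooth (hG : IsMetricOn G U) {X : E4 → Fin 4 → ℝ}
    (hX : ∀ i, ContDiffOn ℝ ∞ (fun z => X z i) U) (i : Fin 4) :
    ContDiffOn ℝ ∞ (fun z => ricSharp G X z i) U :=
  ContDiffOn.sum fun j _ => ContDiffOn.sum fun k _ =>
    ((hG.inv_smooth i j).mul (hG.ricci_smooth j k)).mul (hX k)

theorem ricFormC_smooth (hG : IsMetricOn G U) (hu : ContDiffOn ℝ ∞ u U)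
    (hv : ContDiffOn ℝ ∞ v U) : ContDiffOn ℝ ∞ (ricFormC G u v) U :=
  ContDiffOn.sum fun i _ =>
    (hG.ricSharp_smooth (hG.gradC_smooth hu) i).mul (contDiffOn_pd hG.isOpen hv i)

theorem lowerC_smooth (hG : IsMetricOn G U) (γ₂ γ₃ : ℝ) (hu : ContDiffOn ℝ ∞ u U)
    (hv : ContDiffOn ℝ ∞ v U) : ContDiffOn ℝ ∞ (lowerC γ₂ γ₃ G u v) U :=
  (contDiffOn_const.mul (((contDiffOn_const.mul hG.scalar_smooth).mul (hG.ipC_smooth hu hv)).sub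
    (contDiffOn_const.mul (hG.ricFormC_smooth hu hv)))).sub
    (contDiffOn_const.mul (hG.scalar_smooth.mul (hG.ipC_smooth hu hv)))

theorem weakC_smooth (hG : IsMetricOn G U) (γ₂ γ₃ : ℝ) (hu : ContDiffOn ℝ ∞ u U)
    (hv : ContDiffOn ℝ ∞ v U) : ContDiffOn ℝ ∞ (weakC γ₂ γ₃ G u v) U := by
  have h1 := hG.lapC_smooth hu
  have h2 := hG.lapC_smooth hv
  have h3 := hG.gradSqC_smooth hu
  exact (((contDiffOn_const.mul (h1.mul h2)).add (contDiffOn_const.mul ((h1.add h3).mul h2))).add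
    (contDiffOn_const.mul ((h1.add h3).mul (hG.ipC_smooth hu hv)))).add
    (hG.lowerC_smooth γ₂ γ₃ hu hv)

theorem paneitz_field_smooth (hG : IsMetricOn G U) (hu : ContDiffOn ℝ ∞ u U) (i : Fin 4) :
    ContDiffOn ℝ ∞
      (fun z => 2 / 3 * scalar G z * gradC G u z i - 2 * ricSharp G (gradC G u) z i) U :=
  ((contDiffOn_const.mul hG.scalar_smooth).mul (hG.gradC_smooth hu i)).sub
    (contDiffOn_const.mul (hG.ricSharp_smooth (hG.gradC_smooth hu) i))

theorem quasilinear_field_smooth (hG : IsMetricOn G U) (hu : ContDiffOn ℝ ∞ u U) (i : Fin 4) :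
    ContDiffOn ℝ ∞ (fun z => (lapC G u z + gradSqC G u z) * gradC G u z i) U :=
  ((hG.lapC_smooth hu).add (hG.gradSqC_smooth hu)).mul (hG.gradC_smooth hu i)

theorem scalar_field_smooth (hG : IsMetricOn G U) (hu : ContDiffOn ℝ ∞ u U) (i : Fin 4) :
    ContDiffOn ℝ ∞ (fun z => scalar G z * gradC G u z i) U :=
  hG.scalar_smooth.mul (hG.gradC_smooth hu i)

theorem opNC_smooth (hG : IsMetricOn G U) (γ₂ γ₃ : ℝ) (hu : ContDiffOn ℝ ∞ u U) :
    ContDiffOn ℝ ∞ (opNC γ₂ γ₃ G u) U := by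
  have h1 := hG.lapC_smooth hu
  exact (((contDiffOn_const.mul ((hG.lapC_smooth h1).sub
      (hG.divC_smooth (hG.paneitz_field_smooth hu)))).add
    (contDiffOn_const.mul (hG.lapC_smooth (h1.add (hG.gradSqC_smooth hu))))).sub
    (contDiffOn_const.mul (hG.divC_smooth (hG.quasilinear_field_smooth hu)))).add
    (contDiffOn_const.mul (hG.divC_smooth (hG.scalar_field_smooth hu)))

/-! ### The Levi-Civita connection -/

theorem christoffel_symm (hG : IsMetricOn G U) (hy : y ∈ U) (k i j : Fin 4) :
    christoffel G k i j y = christoffel G k j i y := by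
  unfold christoffel
  congr 1
  refine Finset.sum_congr rfl fun l _ => ?_
  rw [pd_eqOn hG.isOpen (fun z hz => hG.symm_apply hz i j) l hy]
  ring

/-- Compatibility of the connection with the metric. -/
theorem mpd_metric (hG : IsMetricOn G U) (hy : y ∈ U) (i : Fin 4) :
    mpd i G y = (conn G i y)ᵀ * G y + G y * conn G i y := by
  have hlow : ∀ a j, (G y * conn G i y) a j = (1 / 2) * (pd i (fun z => G z j a) y
      + pd j (fun z => G z i a) y - pd a (fun z => G z i j) y) := by
    intro a j
    let w : Fin 4 → ℝ := fun l => pd i (fun z => G z j l) y + pd j (fun z => G z i l) y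
      - pd l (fun z => G z i j) y
    have h1 : (fun k => conn G i y k j) = (1 / 2 : ℝ) • ((G y)⁻¹ *ᵥ w) := by
      funext k
      simp [conn, christoffel, Matrix.mulVec, dotProduct, w]
    have h2 : (G y * conn G i y) a j = (G y *ᵥ (fun k => conn G i y k j)) a := by
      simp [Matrix.mul_apply, Matrix.mulVec, dotProduct]
    rw [h2, h1, Matrix.mulVec_smul, Matrix.mulVec_mulVec, hG.mul_inv hy, Matrix.one_mulVec]
    simp [w]
  have hsym : ∀ l a b, pd l (fun z => G z a b) y = pd l (fun z => G z b a) y :=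
    fun l a b => pd_eqOn hG.isOpen (fun z hz => hG.symm_apply hz a b) l hy
  have ht : (conn G i y)ᵀ * G y = (G y * conn G i y)ᵀ := by
    rw [Matrix.transpose_mul, hG.symm hy]
  ext a j
  rw [ht, Matrix.add_apply, Matrix.transpose_apply, hlow, hlow, hsym i a j, hsym j i a, hsym a i j]
  simp only [mpd, Matrix.of_apply]
  rw [hsym i a j, hsym j a i, hsym a j i]
  ring

/-- The Levi-Civita connection is the only torsion-free connection compatible with the metric. -/
theorem conn_unique (hG : IsMetricOn G U) (hy : y ∈ U)
    {C : Fin 4 → Matrix (Fin 4) (Fin 4) ℝ} (hs : ∀ i j k, C i k j = C j k i)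
    (hC : ∀ i, mpd i G y = (C i)ᵀ * G y + G y * C i) (i : Fin 4) : conn G i y = C i := by
  -- `D i` is the difference of the connections, with the upper index lowered
  let D : Fin 4 → Matrix (Fin 4) (Fin 4) ℝ := fun i => G y * (conn G i y - C i)
  have h1 : ∀ i, (D i)ᵀ + D i = 0 := by
    intro i
    have e := hG.mpd_metric hy i
    rw [hC i] at e
    simp only [D, Matrix.transpose_mul, Matrix.transpose_sub, hG.symm hy, mul_sub]
    have e' : (conn G i y)ᵀ * G y + G y * conn G i y - ((C i)ᵀ * G y + G y * C i) = 0 := by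
      rw [e, sub_self]
    rw [← e']
    abel
  have h2 : ∀ i a j, D i a j = D j a i := by
    intro i a j
    simp only [D, Matrix.mul_apply, Matrix.sub_apply]
    refine Finset.sum_congr rfl fun k _ => ?_
    rw [hs i j k]
    simp only [conn, Matrix.of_apply]
    rw [hG.christoffel_symm hy]
  have h3 : ∀ i a j, D i j a = - D i a j := by
    intro i a j
    have := congrFun (congrFun (h1 i) a) j
    simp only [Matrix.add_apply, Matrix.transpose_apply, Matrix.zero_apply] at this
    linarith
  -- symmetric in one pair of indices and antisymmetric in another, so it vanishes
  have h4 : ∀ i, D i = 0 := by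
    intro i
    ext a j
    simp only [Matrix.zero_apply]
    have a1 := h2 i a j
    have a2 := h3 j a i
    have a3 := h2 j i a
    have a4 := h3 a i j
    have a5 := h2 a j i
    have a6 := h3 i j a
    linarith
  have h5 : (G y)⁻¹ * D i = 0 := by rw [h4, mul_zero]
  simp only [D] at h5
  rw [← mul_assoc, hG.inv_mul hy, one_mul] at h5
  exact sub_eq_zero.1 h5

/-- The logarithmic derivative of the volume density is the trace of the connection. -/
theorem pd_sqrt_det (hG : IsMetricOn G U) (hy : y ∈ U) (i : Fin 4) :
    pd i (fun z => Real.sqrt (G z).det) y = Real.sqrt (G y).det * (conn G i y).trace := by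
  have hd := differentiableAt_of_contDiffOn hG.isOpen hG.smooth.det hy
  rw [pd_comp_real (g := Real.sqrt) (Real.hasDerivAt_sqrt (hG.det_ne y hy)).differentiableAt hd,
    (Real.hasDerivAt_sqrt (hG.det_ne y hy)).deriv,
    pd_det hG.isOpen hG.smooth hG.det_ne hy, hG.mpd_metric hy]
  have e : ((G y)⁻¹ * ((conn G i y)ᵀ * G y + G y * conn G i y)).trace
      = 2 * (conn G i y).trace := by
    rw [mul_add, Matrix.trace_add, ← mul_assoc, Matrix.trace_mul_comm, ← mul_assoc, hG.mul_inv hy,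
      ← mul_assoc, hG.inv_mul hy, one_mul, one_mul, Matrix.trace_transpose]
    ring
  rw [e]
  have hp := hG.sqrt_det_pos hy
  have hsq : Real.sqrt (G y).det * Real.sqrt (G y).det = (G y).det :=
    Real.mul_self_sqrt (hG.det_pos hy).le
  field_simp
  rw [pow_two, hsq]

theorem divC_eq (hG : IsMetricOn G U) {X : E4 → Fin 4 → ℝ}
    (hX : ∀ i, ContDiffOn ℝ ∞ (fun z => X z i) U) (hy : y ∈ U) :
    divC G X y = ∑ i, (pd i (fun z => X z i) y + (conn G i y).trace * X y i) := by
  unfold divC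
  rw [Finset.mul_sum]
  refine Finset.sum_congr rfl fun i _ => ?_
  rw [pd_mul (differentiableAt_of_contDiffOn hG.isOpen hG.sqrt_det_smooth hy)
    (differentiableAt_of_contDiffOn hG.isOpen (hX i) hy), hG.pd_sqrt_det hy]
  have hp := hG.sqrt_det_pos hy
  field_simp

/-- The Ricci tensor is the trace `(F_kj)^k_i` of the curvature
`F_kj = ∂_k Γ_j - ∂_j Γ_k + [Γ_k, Γ_j]` of the connection matrices. -/
theorem ricci_eq (hG : IsMetricOn G U) (hy : y ∈ U) (i j : Fin 4) :
    ricci G i j y = ∑ k, (mpd k (conn G j) y - mpd j (conn G k) y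
      + conn G k y * conn G j y - conn G j y * conn G k y) k i := by
  have hs : ∀ l k i j, pd l (christoffel G k i j) y = pd l (christoffel G k j i) y :=
    fun l k i j => pd_eqOn hG.isOpen (fun z hz => hG.christoffel_symm hz k i j) l hy
  unfold ricci
  rw [← Finset.sum_add_distrib]
  refine Finset.sum_congr rfl fun k _ => ?_
  simp only [Matrix.sub_apply, Matrix.add_apply, Matrix.mul_apply, mpd, conn, Matrix.of_apply,
    Finset.sum_sub_distrib]
  rw [hs k k i j, hs j k i k, add_sub_assoc]
  congr 2
  · refine Finset.sum_congr rfl fun l _ => ?_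
    rw [hG.christoffel_symm hy l i j]
  · refine Finset.sum_congr rfl fun l _ => ?_
    rw [hG.christoffel_symm hy l i k]

end IsMetricOn

/-! ### Invariance under changes of coordinates -/

/-- The Jacobian matrix `∂_i T^a` of a map of the model space. -/
def jac (T : E4 → E4) (y : E4) : Matrix (Fin 4) (Fin 4) ℝ :=
  Matrix.of fun a i => pd i (fun z => T z a) y

/-- `T` is a smooth map of `U₀` into `U₁` that pulls the metric `G₁` back to the metric `G₀`. -/
structure IsCoordChange (T : E4 → E4) (G₀ : E4 → Matrix (Fin 4) (Fin 4) ℝ) (U₀ : Set E4)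
    (G₁ : E4 → Matrix (Fin 4) (Fin 4) ℝ) (U₁ : Set E4) : Prop where
  source : IsMetricOn G₀ U₀
  target : IsMetricOn G₁ U₁
  smooth : ContDiffOn ℝ ∞ T U₀
  mapsTo : MapsTo T U₀ U₁
  pullback : ∀ y ∈ U₀, G₀ y = (jac T y)ᵀ * G₁ (T y) * jac T y

namespace IsCoordChange

variable {T : E4 → E4} {G₀ G₁ : E4 → Matrix (Fin 4) (Fin 4) ℝ} {U₀ U₁ : Set E4}
  {u₀ u₁ v₀ v₁ : E4 → ℝ} {y : E4}

theorem coord_smooth (h : IsCoordChange T G₀ U₀ G₁ U₁) (a : Fin 4) :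
    ContDiffOn ℝ ∞ (fun z => T z a) U₀ :=
  (EuclideanSpace.proj a : E4 →L[ℝ] ℝ).contDiff.comp_contDiffOn h.smooth

theorem jac_smooth (h : IsCoordChange T G₀ U₀ G₁ U₁) : MSmoothOn (jac T) U₀ :=
  fun a i => contDiffOn_pd h.source.isOpen (h.coord_smooth a) i

theorem det_ne (h : IsCoordChange T G₀ U₀ G₁ U₁) : ∀ y ∈ U₀, (jac T y).det ≠ 0 := by
  intro y hy h0
  have h1 := h.source.det_ne y hy
  rw [h.pullback y hy, Matrix.det_mul, h0, mul_zero] at h1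
  exact h1 rfl

theorem mul_inv (h : IsCoordChange T G₀ U₀ G₁ U₁) (hy : y ∈ U₀) : jac T y * (jac T y)⁻¹ = 1 :=
  Matrix.mul_nonsing_inv _ (h.det_ne y hy).isUnit

theorem inv_metric (h : IsCoordChange T G₀ U₀ G₁ U₁) (hy : y ∈ U₀) :
    (G₀ y)⁻¹ = (jac T y)⁻¹ * (G₁ (T y))⁻¹ * ((jac T y)⁻¹)ᵀ := by
  rw [h.pullback y hy, Matrix.mul_inv_rev, Matrix.mul_inv_rev, Matrix.transpose_nonsing_inv,
    mul_assoc]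

theorem comp_smooth (h : IsCoordChange T G₀ U₀ G₁ U₁) (hu : ContDiffOn ℝ ∞ u₁ U₁) :
    ContDiffOn ℝ ∞ (fun z => u₁ (T z)) U₀ :=
  hu.comp h.smooth h.mapsTo

theorem pd_eq (h : IsCoordChange T G₀ U₀ G₁ U₁) (hu : ContDiffOn ℝ ∞ u₁ U₁)
    (huv : ∀ z ∈ U₀, u₀ z = u₁ (T z)) (hy : y ∈ U₀) (i : Fin 4) :
    pd i u₀ y = ∑ a, jac T y a i * pd a u₁ (T y) := by
  rw [pd_eqOn h.source.isOpen (v := fun z => u₁ (T z)) huv i hy]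
  exact pd_comp (differentiableAt_of_contDiffOn h.source.isOpen h.smooth hy)
    (differentiableAt_of_contDiffOn h.target.isOpen hu (h.mapsTo hy)) i

theorem pd_vec_eq (h : IsCoordChange T G₀ U₀ G₁ U₁) (hu : ContDiffOn ℝ ∞ u₁ U₁)
    (huv : ∀ z ∈ U₀, u₀ z = u₁ (T z)) (hy : y ∈ U₀) :
    (fun i => pd i u₀ y) = (jac T y)ᵀ *ᵥ (fun a => pd a u₁ (T y)) := by
  funext i
  rw [h.pd_eq hu huv hy]
  rfl

theorem gradC_eq (h : IsCoordChange T G₀ U₀ G₁ U₁) (hu : ContDiffOn ℝ ∞ u₁ U₁)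
    (huv : ∀ z ∈ U₀, u₀ z = u₁ (T z)) (hy : y ∈ U₀) :
    gradC G₀ u₀ y = (jac T y)⁻¹ *ᵥ gradC G₁ u₁ (T y) := by
  have e : ∀ (G : E4 → Matrix (Fin 4) (Fin 4) ℝ) (u : E4 → ℝ) (z : E4),
      gradC G u z = (G z)⁻¹ *ᵥ (fun i => pd i u z) := fun G u z => rfl
  rw [e, e, h.pd_vec_eq hu huv hy, h.inv_metric hy, Matrix.mulVec_mulVec, Matrix.mulVec_mulVec,
    mul_assoc, ← Matrix.transpose_mul, h.mul_inv hy, Matrix.transpose_one, mul_one]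

/-- The pairing of a vector field with a differential is invariant. -/
theorem pairing_eq (h : IsCoordChange T G₀ U₀ G₁ U₁) (hv : ContDiffOn ℝ ∞ v₁ U₁)
    (hvv : ∀ z ∈ U₀, v₀ z = v₁ (T z)) (hy : y ∈ U₀) {X₀ X₁ : Fin 4 → ℝ}
    (hX : X₀ = (jac T y)⁻¹ *ᵥ X₁) : ∑ i, X₀ i * pd i v₀ y = ∑ i, X₁ i * pd i v₁ (T y) := by
  have e : ∑ i, X₀ i * pd i v₀ y = X₀ ⬝ᵥ (fun i => pd i v₀ y) := rfl
  rw [e, h.pd_vec_eq hv hvv hy, hX, Matrix.dotProduct_mulVec, ← Matrix.mulVec_transpose,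
    Matrix.transpose_transpose, Matrix.mulVec_mulVec, h.mul_inv hy, Matrix.one_mulVec]
  rfl

theorem ipC_eq_sum (G : E4 → Matrix (Fin 4) (Fin 4) ℝ) (u v : E4 → ℝ) (hG : ((G y)⁻¹)ᵀ = (G y)⁻¹) :
    ipC G u v y = ∑ i, gradC G u y i * pd i v y := by
  unfold ipC gradC
  rw [Finset.sum_comm]
  refine Finset.sum_congr rfl fun j _ => ?_
  rw [Finset.sum_mul]
  refine Finset.sum_congr rfl fun i _ => ?_
  have : (G y)⁻¹ i j = (G y)⁻¹ j i := by
    conv_lhs => rw [← hG]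
    rfl
  rw [this]

theorem ipC_eq (h : IsCoordChange T G₀ U₀ G₁ U₁) (hu : ContDiffOn ℝ ∞ u₁ U₁)
    (huv : ∀ z ∈ U₀, u₀ z = u₁ (T z)) (hv : ContDiffOn ℝ ∞ v₁ U₁)
    (hvv : ∀ z ∈ U₀, v₀ z = v₁ (T z)) (hy : y ∈ U₀) :
    ipC G₀ u₀ v₀ y = ipC G₁ u₁ v₁ (T y) := by
  rw [ipC_eq_sum _ _ _ (h.source.inv_symm hy), ipC_eq_sum _ _ _ (h.target.inv_symm (h.mapsTo hy))]
  exact h.pairing_eq hv hvv hy (h.gradC_eq hu huv hy)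

theorem gradSqC_eq (h : IsCoordChange T G₀ U₀ G₁ U₁) (hu : ContDiffOn ℝ ∞ u₁ U₁)
    (huv : ∀ z ∈ U₀, u₀ z = u₁ (T z)) (hy : y ∈ U₀) :
    gradSqC G₀ u₀ y = gradSqC G₁ u₁ (T y) :=
  h.ipC_eq hu huv hu huv hy

theorem mpd_jac_symm (h : IsCoordChange T G₀ U₀ G₁ U₁) (hy : y ∈ U₀) (i j a : Fin 4) :
    mpd i (jac T) y a j = mpd j (jac T) y a i :=
  pd_comm h.source.isOpen (h.coord_smooth a) hy i j

/-- The pull-back `∂_i T^a Γ_a` of the connection matrices of the target. -/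
def pullConn (T : E4 → E4) (G₁ : E4 → Matrix (Fin 4) (Fin 4) ℝ) (i : Fin 4) (y : E4) :
    Matrix (Fin 4) (Fin 4) ℝ :=
  ∑ a, jac T y a i • conn G₁ a (T y)

/-- The transformation law of the connection is that of a gauge potential. -/
theorem conn_eq (h : IsCoordChange T G₀ U₀ G₁ U₁) (hy : y ∈ U₀) (i : Fin 4) :
    conn G₀ i y = (jac T y)⁻¹ * (pullConn T G₁ i y * jac T y + mpd i (jac T) y) := by
  refine h.source.conn_unique hy (C := fun i => (jac T y)⁻¹ *
    (pullConn T G₁ i y * jac T y + mpd i (jac T) y)) ?_ ?_ i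
  · intro i j k
    simp only [Matrix.mul_apply (M := (jac T y)⁻¹)]
    refine Finset.sum_congr rfl fun b _ => ?_
    congr 1
    rw [Matrix.add_apply, Matrix.add_apply, h.mpd_jac_symm hy i j]
    congr 1
    simp only [pullConn, Matrix.sum_apply, Matrix.smul_apply, Matrix.mul_apply, smul_eq_mul,
      Finset.sum_mul]
    rw [Finset.sum_comm]
    refine Finset.sum_congr rfl fun c _ => Finset.sum_congr rfl fun a _ => ?_
    have := h.target.christoffel_symm (h.mapsTo hy) b a c
    simp only [conn, Matrix.of_apply]
    rw [this]
    ring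
  · intro i
    have hc : MSmoothOn (fun z => G₁ (T z)) U₀ := fun k l => h.comp_smooth (h.target.smooth k l)
    have hJ := h.jac_smooth
    have e1 : mpd i (fun z => G₁ (T z)) y
        = (pullConn T G₁ i y)ᵀ * G₁ (T y) + G₁ (T y) * pullConn T G₁ i y := by
      have : mpd i (fun z => G₁ (T z)) y = ∑ a, jac T y a i • mpd a G₁ (T y) := by
        ext k l
        simp only [Matrix.sum_apply, Matrix.smul_apply, smul_eq_mul]
        exact h.pd_eq (h.target.smooth k l) (fun z _ => rfl) hy i
      rw [this]
      simp only [h.target.mpd_metric (h.mapsTo hy), pullConn, Matrix.transpose_sum,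
        Matrix.transpose_smul, Matrix.sum_mul, Matrix.mul_sum, Matrix.smul_mul, Matrix.mul_smul,
        smul_add, Finset.sum_add_distrib]
    have hGs := h.target.symm (h.mapsTo hy)
    rw [mpd_eqOn h.source.isOpen (B := fun z => ((jac T z)ᵀ * G₁ (T z)) * jac T z)
      h.pullback i hy, mpd_mul h.source.isOpen (hJ.transpose.mul hc) hJ hy,
      mpd_mul h.source.isOpen hJ.transpose hc hy, mpd_transpose, e1, h.pullback y hy]
    have hK := h.mul_inv hy
    have hK' : ((jac T y)⁻¹)ᵀ * (jac T y)ᵀ = 1 := by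
      rw [← Matrix.transpose_mul, hK, Matrix.transpose_one]
    simp only [Matrix.transpose_mul, Matrix.transpose_add]
    generalize jac T y = J at *
    generalize J⁻¹ = K at *
    generalize pullConn T G₁ i y = A at *
    generalize mpd i (jac T) y = D at *
    generalize G₁ (T y) = g at *
    have f1 : (Jᵀ * Aᵀ + Dᵀ) * Kᵀ * (Jᵀ * g * J) = (Jᵀ * Aᵀ + Dᵀ) * (Kᵀ * Jᵀ) * (g * J) := by
      noncomm_ring
    have f2 : Jᵀ * g * J * (K * (A * J + D)) = Jᵀ * g * (J * K) * (A * J + D) := by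
      noncomm_ring
    rw [f1, f2, hK, hK']
    noncomm_ring

theorem pullConn_smooth (h : IsCoordChange T G₀ U₀ G₁ U₁) (i : Fin 4) :
    MSmoothOn (pullConn T G₁ i) U₀ := by
  intro k l
  simp only [pullConn, Matrix.sum_apply, Matrix.smul_apply, smul_eq_mul]
  exact ContDiffOn.sum fun a _ => (h.jac_smooth a i).mul
    (h.comp_smooth (h.target.conn_smooth a k l))

theorem mpd_pullConn (h : IsCoordChange T G₀ U₀ G₁ U₁) (hy : y ∈ U₀) (i j : Fin 4) :
    mpd j (pullConn T G₁ i) y = (∑ a, mpd j (jac T) y a i • conn G₁ a (T y))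
      + ∑ a, ∑ b, (jac T y a i * jac T y b j) • mpd b (conn G₁ a) (T y) := by
  ext k l
  have e : (fun z => pullConn T G₁ i z k l)
      = fun z => ∑ a, jac T z a i * conn G₁ a (T z) k l := by
    funext z
    simp only [pullConn, Matrix.sum_apply, Matrix.smul_apply, smul_eq_mul]
  have h1 : ∀ a, DifferentiableAt ℝ (fun z => jac T z a i) y :=
    fun a => differentiableAt_of_contDiffOn h.source.isOpen (h.jac_smooth a i) hy
  have h2 : ∀ a, DifferentiableAt ℝ (fun z => conn G₁ a (T z) k l) y :=
    fun a => differentiableAt_of_contDiffOn h.source.isOpen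
      (h.comp_smooth (h.target.conn_smooth a k l)) hy
  have e2 : mpd j (pullConn T G₁ i) y k l = pd j (fun z => pullConn T G₁ i z k l) y := rfl
  rw [e2, e, pd_sum fun a _ => (h1 a).fun_mul (h2 a)]
  simp only [Matrix.add_apply, Matrix.sum_apply, Matrix.smul_apply, smul_eq_mul]
  rw [← Finset.sum_add_distrib]
  refine Finset.sum_congr rfl fun a _ => ?_
  rw [pd_mul (h1 a) (h2 a), h.pd_eq (h.target.conn_smooth a k l) (fun z _ => rfl) hy,
    Finset.mul_sum, add_comm]
  congr 1
  exact Finset.sum_congr rfl fun b _ => by rw [mul_assoc]; rfl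

/-- The derivative of the transformation law of the connection, before antisymmetrization. -/
theorem mpd_conn_add (h : IsCoordChange T G₀ U₀ G₁ U₁) (hy : y ∈ U₀) (i j : Fin 4) :
    mpd i (conn G₀ j) y + conn G₀ i y * conn G₀ j y = (jac T y)⁻¹ *
      ((mpd i (pullConn T G₁ j) y + pullConn T G₁ i y * pullConn T G₁ j y) * jac T y
        + (pullConn T G₁ j y * mpd i (jac T) y + pullConn T G₁ i y * mpd j (jac T) y)
        + mpd i (mpd j (jac T)) y) := by
  have hO := h.source.isOpen
  have hJ := h.jac_smooth
  have hP := h.pullConn_smooth j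
  have hD := MSmoothOn.mpd hO hJ j
  rw [mpd_eqOn hO (fun z hz => h.conn_eq hz j) i hy,
    mpd_mul hO (hJ.inv h.det_ne) ((hP.mul hJ).add hD) hy, mpd_add hO (hP.mul hJ) hD hy,
    mpd_mul hO hP hJ hy, mpd_inv hO hJ h.det_ne hy, h.conn_eq hy, h.conn_eq hy]
  have hK := h.mul_inv hy
  generalize jac T y = J at *
  generalize J⁻¹ = K at *
  have f : ∀ A D A' D' : Matrix (Fin 4) (Fin 4) ℝ, K * (A * J + D) * (K * (A' * J + D'))
      = K * A * (J * K) * (A' * J + D') + K * D * K * (A' * J + D') := by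
    intros; noncomm_ring
  rw [f, hK]
  noncomm_ring

theorem mpd_mpd_jac (h : IsCoordChange T G₀ U₀ G₁ U₁) (hy : y ∈ U₀) (i j : Fin 4) :
    mpd i (mpd j (jac T)) y = mpd j (mpd i (jac T)) y := by
  ext k l
  exact pd_comm h.source.isOpen (h.jac_smooth k l) hy i j

/-- The curvature of the connection matrices is tensorial. -/
theorem curvature_eq (h : IsCoordChange T G₀ U₀ G₁ U₁) (hy : y ∈ U₀) (i j : Fin 4) :
    mpd i (conn G₀ j) y - mpd j (conn G₀ i) y + conn G₀ i y * conn G₀ j y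
        - conn G₀ j y * conn G₀ i y
      = (jac T y)⁻¹ * (∑ a, ∑ b, (jac T y a i * jac T y b j) •
        (mpd a (conn G₁ b) (T y) - mpd b (conn G₁ a) (T y) + conn G₁ a (T y) * conn G₁ b (T y)
          - conn G₁ b (T y) * conn G₁ a (T y))) * jac T y := by
  have e1 := h.mpd_conn_add hy i j
  have e2 := h.mpd_conn_add hy j i
  have e3 : ∑ a, ∑ b, (jac T y a i * jac T y b j) •
        (mpd a (conn G₁ b) (T y) - mpd b (conn G₁ a) (T y) + conn G₁ a (T y) * conn G₁ b (T y)
          - conn G₁ b (T y) * conn G₁ a (T y))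
      = mpd i (pullConn T G₁ j) y - mpd j (pullConn T G₁ i) y
        + pullConn T G₁ i y * pullConn T G₁ j y - pullConn T G₁ j y * pullConn T G₁ i y := by
    have f1 : ∑ a, mpd i (jac T) y a j • conn G₁ a (T y)
        = ∑ a, mpd j (jac T) y a i • conn G₁ a (T y) :=
      Finset.sum_congr rfl fun a _ => by rw [h.mpd_jac_symm hy i j]
    have f2 : ∑ a, ∑ b, (jac T y a j * jac T y b i) • mpd b (conn G₁ a) (T y)
        = ∑ a, ∑ b, (jac T y a i * jac T y b j) • mpd a (conn G₁ b) (T y) := by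
      rw [Finset.sum_comm]
      exact Finset.sum_congr rfl fun a _ => Finset.sum_congr rfl fun b _ => by
        rw [mul_comm (jac T y b j)]
    have f3 : ∀ i j : Fin 4, pullConn T G₁ i y * pullConn T G₁ j y
        = ∑ a, ∑ b, (jac T y a i * jac T y b j) • (conn G₁ a (T y) * conn G₁ b (T y)) := by
      intro i j
      simp only [pullConn, Matrix.sum_mul, Matrix.mul_sum, Matrix.smul_mul, Matrix.mul_smul,
        Finset.smul_sum, smul_smul]
      rw [Finset.sum_comm]
      exact Finset.sum_congr rfl fun a _ => Finset.sum_congr rfl fun b _ => by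
        rw [mul_comm (jac T y b j)]
    have f4 : ∑ a, ∑ b, (jac T y a j * jac T y b i) • (conn G₁ a (T y) * conn G₁ b (T y))
        = ∑ a, ∑ b, (jac T y a i * jac T y b j) • (conn G₁ b (T y) * conn G₁ a (T y)) := by
      rw [Finset.sum_comm]
      exact Finset.sum_congr rfl fun a _ => Finset.sum_congr rfl fun b _ => by
        rw [mul_comm (jac T y b j)]
    rw [h.mpd_pullConn hy, h.mpd_pullConn hy, f1, f2, f3, f3, f4]
    simp only [smul_sub, smul_add, Finset.sum_sub_distrib, Finset.sum_add_distrib]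
    abel
  rw [e3]
  have e4 : ∀ a b c d : Matrix (Fin 4) (Fin 4) ℝ, a - b + c - d = (a + c) - (b + d) := by
    intros; abel
  rw [e4, e1, e2, h.mpd_mpd_jac hy i j]
  noncomm_ring

/-- The Ricci tensor, as a contraction of the curvature, is a covariant tensor. -/
theorem ricci_eq (h : IsCoordChange T G₀ U₀ G₁ U₁) (hy : y ∈ U₀) :
    (Matrix.of fun i j => ricci G₀ i j y)
      = (jac T y)ᵀ * (Matrix.of fun i j => ricci G₁ i j (T y)) * jac T y := by
  ext i j
  rw [Matrix.of_apply, h.source.ricci_eq hy]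
  simp only [h.curvature_eq hy]
  generalize hF : (fun a b => mpd a (conn G₁ b) (T y) - mpd b (conn G₁ a) (T y)
    + conn G₁ a (T y) * conn G₁ b (T y) - conn G₁ b (T y) * conn G₁ a (T y)) = F
  have hF' : ∀ a b, mpd a (conn G₁ b) (T y) - mpd b (conn G₁ a) (T y)
    + conn G₁ a (T y) * conn G₁ b (T y) - conn G₁ b (T y) * conn G₁ a (T y) = F a b := by
    intro a b; rw [← hF]
  have hR : ∀ i j, ricci G₁ i j (T y) = ∑ k, F k j k i := by
    intro i j
    rw [h.target.ricci_eq (h.mapsTo hy)]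
    simp only [hF']
  simp only [hF']
  have hK : ∀ a c, ∑ k, jac T y a k * (jac T y)⁻¹ k c = if a = c then 1 else 0 := by
    intro a c
    rw [← Matrix.mul_apply, h.mul_inv hy, Matrix.one_apply]
  simp only [Matrix.mul_apply, Matrix.transpose_apply, Matrix.of_apply, hR, Matrix.sum_apply,
    Matrix.smul_apply, smul_eq_mul]
  -- the sum over `k` contracts `J` with its inverse
  calc ∑ k, ∑ d, (∑ c, (jac T y)⁻¹ k c * ∑ a, ∑ b, jac T y a k * jac T y b j * F a b c d)
        * jac T y d i
      = ∑ d, ∑ c, ∑ a, ∑ b, (∑ k, jac T y a k * (jac T y)⁻¹ k c)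
          * (jac T y b j * F a b c d * jac T y d i) := by
        rw [Finset.sum_comm]
        refine Finset.sum_congr rfl fun d _ => ?_
        simp only [Finset.sum_mul, Finset.mul_sum]
        rw [Finset.sum_comm]
        refine Finset.sum_congr rfl fun c _ => ?_
        rw [Finset.sum_comm]
        refine Finset.sum_congr rfl fun a _ => ?_
        rw [Finset.sum_comm]
        refine Finset.sum_congr rfl fun b _ => Finset.sum_congr rfl fun k _ => by ring
    _ = ∑ d, ∑ a, ∑ b, jac T y b j * F a b a d * jac T y d i := by
        refine Finset.sum_congr rfl fun d _ => ?_
        rw [Finset.sum_comm]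
        refine Finset.sum_congr rfl fun a _ => ?_
        simp only [hK, ite_mul, one_mul, zero_mul]
        rw [Finset.sum_comm]
        simp
    _ = ∑ b, (∑ d, jac T y d i * ∑ a, F a b a d) * jac T y b j := by
        simp only [Finset.sum_mul, Finset.mul_sum]
        rw [Finset.sum_congr rfl fun d _ => Finset.sum_comm, Finset.sum_comm]
        exact Finset.sum_congr rfl fun b _ => Finset.sum_congr rfl fun d _ =>
          Finset.sum_congr rfl fun a _ => by ring

theorem scalar_eq (h : IsCoordChange T G₀ U₀ G₁ U₁) (hy : y ∈ U₀) :
    scalar G₀ y = scalar G₁ (T y) := by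
  have e : ∀ {G : E4 → Matrix (Fin 4) (Fin 4) ℝ} {z : E4}, ((G z)⁻¹)ᵀ = (G z)⁻¹ →
      scalar G z = ((G z)⁻¹ * Matrix.of fun i j => ricci G i j z).trace := by
    intro G z hG
    simp only [scalar, Matrix.trace, Matrix.diag, Matrix.mul_apply, Matrix.of_apply]
    rw [Finset.sum_comm]
    refine Finset.sum_congr rfl fun i _ => Finset.sum_congr rfl fun j _ => ?_
    conv_lhs => rw [← hG]
    rfl
  rw [e (h.source.inv_symm hy), e (h.target.inv_symm (h.mapsTo hy)), h.ricci_eq hy,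
    h.inv_metric hy]
  have hK := h.mul_inv hy
  have hK' : ((jac T y)⁻¹)ᵀ * (jac T y)ᵀ = 1 := by
    rw [← Matrix.transpose_mul, hK, Matrix.transpose_one]
  generalize jac T y = J at *
  generalize J⁻¹ = K at *
  generalize (Matrix.of fun i j => ricci G₁ i j (T y)) = R at *
  generalize (G₁ (T y))⁻¹ = g at *
  have : K * g * Kᵀ * (Jᵀ * R * J) = K * (g * (Kᵀ * Jᵀ) * R * J) := by noncomm_ring
  rw [this, hK', Matrix.trace_mul_comm, mul_one, mul_assoc, hK, mul_one]

theorem ricSharp_eq (h : IsCoordChange T G₀ U₀ G₁ U₁) (hy : y ∈ U₀) {X₀ X₁ : E4 → Fin 4 → ℝ}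
    (hX : X₀ y = (jac T y)⁻¹ *ᵥ X₁ (T y)) :
    ricSharp G₀ X₀ y = (jac T y)⁻¹ *ᵥ ricSharp G₁ X₁ (T y) := by
  have e : ∀ (G : E4 → Matrix (Fin 4) (Fin 4) ℝ) (X : E4 → Fin 4 → ℝ) (z : E4),
      ricSharp G X z = ((G z)⁻¹ * Matrix.of fun i j => ricci G i j z) *ᵥ X z := by
    intro G X z
    funext i
    simp only [ricSharp, Matrix.mulVec, dotProduct, Matrix.mul_apply, Matrix.of_apply,
      Finset.sum_mul]
    rw [Finset.sum_comm]
  rw [e, e, hX, h.ricci_eq hy, h.inv_metric hy, Matrix.mulVec_mulVec, Matrix.mulVec_mulVec]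
  congr 1
  have hK := h.mul_inv hy
  have hK' : ((jac T y)⁻¹)ᵀ * (jac T y)ᵀ = 1 := by
    rw [← Matrix.transpose_mul, hK, Matrix.transpose_one]
  generalize jac T y = J at *
  generalize J⁻¹ = K at *
  generalize (Matrix.of fun i j => ricci G₁ i j (T y)) = R at *
  generalize (G₁ (T y))⁻¹ = g at *
  have : K * g * Kᵀ * (Jᵀ * R * J) * K = K * g * (Kᵀ * Jᵀ) * R * (J * K) := by noncomm_ring
  rw [this, hK', hK]
  noncomm_ring

/-- The divergence is invariant. The derivative of the Jacobian matrix produced by the components is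
cancelled by the one in the trace of the connection. -/
theorem divC_eq (h : IsCoordChange T G₀ U₀ G₁ U₁) {X₀ X₁ : E4 → Fin 4 → ℝ}
    (hX₁ : ∀ i, ContDiffOn ℝ ∞ (fun z => X₁ z i) U₁)
    (hX : ∀ z ∈ U₀, X₀ z = (jac T z)⁻¹ *ᵥ X₁ (T z)) (hy : y ∈ U₀) :
    divC G₀ X₀ y = divC G₁ X₁ (T y) := by
  have hO := h.source.isOpen
  have hJi := h.jac_smooth.inv h.det_ne
  have hXT : ∀ a, ContDiffOn ℝ ∞ (fun z => X₁ (T z) a) U₀ := fun a => h.comp_smooth (hX₁ a)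
  have hX0e : ∀ i, EqOn (fun z => X₀ z i) (fun z => ∑ a, (jac T z)⁻¹ i a * X₁ (T z) a) U₀ := by
    intro i z hz
    simp only [hX z hz]
    rfl
  have hX₀ : ∀ i, ContDiffOn ℝ ∞ (fun z => X₀ z i) U₀ := fun i =>
    (ContDiffOn.sum fun a _ => (hJi i a).mul (hXT a)).congr (hX0e i)
  rw [h.source.divC_eq hX₀ hy, h.target.divC_eq hX₁ (h.mapsTo hy)]
  -- the derivative of the components
  have e1 : ∑ i, pd i (fun z => X₀ z i) y
      = (∑ a, pd a (fun z => X₁ z a) (T y))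
        - ∑ i, ((jac T y)⁻¹ * mpd i (jac T) y).trace * X₀ y i := by
    have d1 : ∀ i, pd i (fun z => X₀ z i) y
        = (∑ a, (jac T y)⁻¹ i a * ∑ b, jac T y b i * pd b (fun z => X₁ z a) (T y))
          - (((jac T y)⁻¹ * mpd i (jac T) y) *ᵥ X₀ y) i := by
      intro i
      rw [pd_eqOn hO (hX0e i) i hy, pd_sum fun a _ =>
        (differentiableAt_of_contDiffOn hO (hJi i a) hy).fun_mul
          (differentiableAt_of_contDiffOn hO (hXT a) hy)]
      have d2 : ∀ a, pd i (fun z => (jac T z)⁻¹ i a * X₁ (T z) a) y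
          = (jac T y)⁻¹ i a * (∑ b, jac T y b i * pd b (fun z => X₁ z a) (T y))
            - ((jac T y)⁻¹ * mpd i (jac T) y * (jac T y)⁻¹) i a * X₁ (T y) a := by
        intro a
        rw [pd_mul (differentiableAt_of_contDiffOn hO (hJi i a) hy)
          (differentiableAt_of_contDiffOn hO (hXT a) hy), h.pd_eq (hX₁ a) (fun z _ => rfl) hy]
        have d3 : pd i (fun z => (jac T z)⁻¹ i a) y = mpd i (fun z => (jac T z)⁻¹) y i a := rfl
        rw [d3, mpd_inv hO h.jac_smooth h.det_ne hy, Matrix.neg_apply]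
        ring
      rw [Finset.sum_congr rfl fun a _ => d2 a, Finset.sum_sub_distrib, hX y hy,
        Matrix.mulVec_mulVec]
      rfl
    rw [Finset.sum_congr rfl fun i _ => d1 i, Finset.sum_sub_distrib]
    congr 1
    · have hK : ∀ a c, ∑ k, jac T y a k * (jac T y)⁻¹ k c = if a = c then 1 else 0 := by
        intro a c
        rw [← Matrix.mul_apply, h.mul_inv hy, Matrix.one_apply]
      calc ∑ i, ∑ a, (jac T y)⁻¹ i a * ∑ b, jac T y b i * pd b (fun z => X₁ z a) (T y)
          = ∑ a, ∑ b, (∑ i, jac T y b i * (jac T y)⁻¹ i a) * pd b (fun z => X₁ z a) (T y) := by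
            simp only [Finset.mul_sum, Finset.sum_mul]
            rw [Finset.sum_comm]
            refine Finset.sum_congr rfl fun a _ => ?_
            rw [Finset.sum_comm]
            exact Finset.sum_congr rfl fun b _ => Finset.sum_congr rfl fun i _ => by ring
        _ = _ := by simp [hK]
    · simp only [Matrix.mulVec, dotProduct, Matrix.trace, Matrix.diag, Finset.sum_mul,
        Matrix.mul_apply]
      rw [Finset.sum_comm]
      refine Finset.sum_congr rfl fun i _ => Finset.sum_congr rfl fun k _ =>
        Finset.sum_congr rfl fun b _ => ?_
      rw [h.mpd_jac_symm hy]
  have e2 : ∀ i, (conn G₀ i y).trace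
      = (∑ a, jac T y a i * (conn G₁ a (T y)).trace) + ((jac T y)⁻¹ * mpd i (jac T) y).trace := by
    intro i
    rw [h.conn_eq hy, mul_add, Matrix.trace_add, Matrix.trace_mul_comm, mul_assoc, h.mul_inv hy,
      mul_one]
    simp only [pullConn, Matrix.trace_sum, Matrix.trace_smul, smul_eq_mul]
  have e3 : ∑ i, (∑ a, jac T y a i * (conn G₁ a (T y)).trace) * X₀ y i
      = ∑ a, (conn G₁ a (T y)).trace * X₁ (T y) a := by
    have d : X₁ (T y) = jac T y *ᵥ X₀ y := by
      rw [hX y hy, Matrix.mulVec_mulVec, h.mul_inv hy, Matrix.one_mulVec]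
    rw [d]
    simp only [Matrix.mulVec, dotProduct, Finset.sum_mul, Finset.mul_sum]
    rw [Finset.sum_comm]
    exact Finset.sum_congr rfl fun a _ => Finset.sum_congr rfl fun i _ => by ring
  rw [Finset.sum_add_distrib, Finset.sum_add_distrib, e1, ← e3]
  simp only [e2, add_mul, Finset.sum_add_distrib]
  ring

theorem lapC_eq (h : IsCoordChange T G₀ U₀ G₁ U₁) (hu : ContDiffOn ℝ ∞ u₁ U₁)
    (huv : ∀ z ∈ U₀, u₀ z = u₁ (T z)) (hy : y ∈ U₀) :
    lapC G₀ u₀ y = lapC G₁ u₁ (T y) :=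
  h.divC_eq (h.target.gradC_smooth hu) (fun _ hz => h.gradC_eq hu huv hz) hy

theorem ricFormC_eq (h : IsCoordChange T G₀ U₀ G₁ U₁) (hu : ContDiffOn ℝ ∞ u₁ U₁)
    (huv : ∀ z ∈ U₀, u₀ z = u₁ (T z)) (hv : ContDiffOn ℝ ∞ v₁ U₁)
    (hvv : ∀ z ∈ U₀, v₀ z = v₁ (T z)) (hy : y ∈ U₀) :
    ricFormC G₀ u₀ v₀ y = ricFormC G₁ u₁ v₁ (T y) :=
  h.pairing_eq hv hvv hy (h.ricSharp_eq hy (h.gradC_eq hu huv hy))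

theorem lowerC_eq (h : IsCoordChange T G₀ U₀ G₁ U₁) (γ₂ γ₃ : ℝ) (hu : ContDiffOn ℝ ∞ u₁ U₁)
    (huv : ∀ z ∈ U₀, u₀ z = u₁ (T z)) (hv : ContDiffOn ℝ ∞ v₁ U₁)
    (hvv : ∀ z ∈ U₀, v₀ z = v₁ (T z)) (hy : y ∈ U₀) :
    lowerC γ₂ γ₃ G₀ u₀ v₀ y = lowerC γ₂ γ₃ G₁ u₁ v₁ (T y) := by
  unfold lowerC
  rw [h.ricFormC_eq hu huv hv hvv hy, h.ipC_eq hu huv hv hvv hy, h.scalar_eq hy]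

theorem weakC_eq (h : IsCoordChange T G₀ U₀ G₁ U₁) (γ₂ γ₃ : ℝ) (hu : ContDiffOn ℝ ∞ u₁ U₁)
    (huv : ∀ z ∈ U₀, u₀ z = u₁ (T z)) (hv : ContDiffOn ℝ ∞ v₁ U₁)
    (hvv : ∀ z ∈ U₀, v₀ z = v₁ (T z)) (hy : y ∈ U₀) :
    weakC γ₂ γ₃ G₀ u₀ v₀ y = weakC γ₂ γ₃ G₁ u₁ v₁ (T y) := by
  unfold weakC
  rw [h.lowerC_eq γ₂ γ₃ hu huv hv hvv hy, h.ipC_eq hu huv hv hvv hy, h.lapC_eq hu huv hy,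
    h.lapC_eq hv hvv hy, h.gradSqC_eq hu huv hy]

theorem opNC_eq (h : IsCoordChange T G₀ U₀ G₁ U₁) (γ₂ γ₃ : ℝ) (hu : ContDiffOn ℝ ∞ u₁ U₁)
    (huv : ∀ z ∈ U₀, u₀ z = u₁ (T z)) (hy : y ∈ U₀) :
    opNC γ₂ γ₃ G₀ u₀ y = opNC γ₂ γ₃ G₁ u₁ (T y) := by
  have hl := h.target.lapC_smooth hu
  have hg := h.target.gradSqC_smooth hu
  have hlE : ∀ z ∈ U₀, lapC G₀ u₀ z = lapC G₁ u₁ (T z) := fun z hz => h.lapC_eq hu huv hz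
  have hgE : ∀ z ∈ U₀, gradSqC G₀ u₀ z = gradSqC G₁ u₁ (T z) := fun z hz => h.gradSqC_eq hu huv hz
  have hG : ∀ z ∈ U₀, gradC G₀ u₀ z = (jac T z)⁻¹ *ᵥ gradC G₁ u₁ (T z) :=
    fun z hz => h.gradC_eq hu huv hz
  have hR : ∀ z ∈ U₀, ricSharp G₀ (gradC G₀ u₀) z
      = (jac T z)⁻¹ *ᵥ ricSharp G₁ (gradC G₁ u₁) (T z) := fun z hz => h.ricSharp_eq hz (hG z hz)
  have smul_field : ∀ (F : ℝ) (K : Matrix (Fin 4) (Fin 4) ℝ) (X : Fin 4 → ℝ),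
      (fun i => F * (K *ᵥ X) i) = K *ᵥ fun i => F * X i := by
    intro F K X
    exact (Matrix.mulVec_smul K F X).symm
  unfold opNC paneitzC
  rw [h.lapC_eq hl hlE hy, h.lapC_eq (hl.add hg) (u₁ := fun z => lapC G₁ u₁ z + gradSqC G₁ u₁ z)
      (fun z hz => by rw [hlE z hz, hgE z hz]) hy,
    h.divC_eq (h.target.paneitz_field_smooth hu) (fun z hz => ?_) hy,
    h.divC_eq (h.target.quasilinear_field_smooth hu) (fun z hz => ?_) hy,
    h.divC_eq (h.target.scalar_field_smooth hu) (fun z hz => ?_) hy]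
  · rw [h.scalar_eq hz, hG z hz, smul_field]
  · rw [hlE z hz, hgE z hz, hG z hz, smul_field]
  · have := Matrix.mulVec_sub (jac T z)⁻¹ (fun i => 2 / 3 * scalar G₁ (T z) * gradC G₁ u₁ (T z) i)
      (fun i => 2 * ricSharp G₁ (gradC G₁ u₁) (T z) i)
    rw [h.scalar_eq hz, hG z hz, hR z hz]
    rw [← smul_field, ← smul_field] at this
    exact this.symm

end IsCoordChange

/-! ### Product and chain rules in coordinates -/

theorem ipC_eq_sum_pd (G : E4 → Matrix (Fin 4) (Fin 4) ℝ) (u v : E4 → ℝ) (y : E4) :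
    ipC G u v y = (fun i => pd i u y) ⬝ᵥ ((G y)⁻¹ *ᵥ fun j => pd j v y) := by
  simp only [ipC, dotProduct, Matrix.mulVec, Finset.mul_sum]
  exact Finset.sum_congr rfl fun i _ => Finset.sum_congr rfl fun j _ => by ring

namespace IsMetricOn

variable {G : E4 → Matrix (Fin 4) (Fin 4) ℝ} {U : Set E4} {u v w χ : E4 → ℝ} {y : E4}

theorem divC_mul (hG : IsMetricOn G U) {X : E4 → Fin 4 → ℝ} (hu : ContDiffOn ℝ ∞ u U)
    (hX : ∀ i, ContDiffOn ℝ ∞ (fun z => X z i) U) (hy : y ∈ U) :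
    divC G (fun z i => u z * X z i) y = u y * divC G X y + ∑ i, X y i * pd i u y := by
  rw [hG.divC_eq (fun i => hu.mul (hX i)) hy, hG.divC_eq hX hy, Finset.mul_sum,
    ← Finset.sum_add_distrib]
  refine Finset.sum_congr rfl fun i _ => ?_
  rw [pd_mul (differentiableAt_of_contDiffOn hG.isOpen hu hy)
    (differentiableAt_of_contDiffOn hG.isOpen (hX i) hy)]
  ring

theorem divC_add (hG : IsMetricOn G U) {X Y : E4 → Fin 4 → ℝ}
    (hX : ∀ i, ContDiffOn ℝ ∞ (fun z => X z i) U) (hY : ∀ i, ContDiffOn ℝ ∞ (fun z => Y z i) U)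
    (hy : y ∈ U) : divC G (fun z i => X z i + Y z i) y = divC G X y + divC G Y y := by
  rw [hG.divC_eq (fun i => (hX i).add (hY i)) hy, hG.divC_eq hX hy, hG.divC_eq hY hy,
    ← Finset.sum_add_distrib]
  refine Finset.sum_congr rfl fun i _ => ?_
  rw [pd_add (differentiableAt_of_contDiffOn hG.isOpen (hX i) hy)
    (differentiableAt_of_contDiffOn hG.isOpen (hY i) hy)]
  ring

theorem divC_const_mul (hG : IsMetricOn G U) {X : E4 → Fin 4 → ℝ} (a : ℝ)
    (hX : ∀ i, ContDiffOn ℝ ∞ (fun z => X z i) U) (hy : y ∈ U) :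
    divC G (fun z i => a * X z i) y = a * divC G X y := by
  rw [hG.divC_mul (u := fun _ => a) contDiffOn_const hX hy]
  simp [pd_const]

theorem divC_congr (hG : IsMetricOn G U) {X Y : E4 → Fin 4 → ℝ} (h : ∀ z ∈ U, X z = Y z)
    (hy : y ∈ U) : divC G X y = divC G Y y := by
  unfold divC
  congr 1
  refine Finset.sum_congr rfl fun i _ => ?_
  exact pd_eqOn hG.isOpen (fun z hz => by simp only [h z hz]) i hy

theorem ipC_symm (hG : IsMetricOn G U) (hy : y ∈ U) : ipC G u v y = ipC G v u y := by
  unfold ipC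
  rw [Finset.sum_comm]
  refine Finset.sum_congr rfl fun i _ => Finset.sum_congr rfl fun j _ => ?_
  rw [hG.inv_symm_apply hy]
  ring

theorem sum_gradC_mul (hG : IsMetricOn G U) (hy : y ∈ U) :
    ∑ i, gradC G u y i * pd i v y = ipC G u v y :=
  (IsCoordChange.ipC_eq_sum _ _ _ (hG.inv_symm hy)).symm

theorem lapC_mul (hG : IsMetricOn G U) (hu : ContDiffOn ℝ ∞ u U) (hv : ContDiffOn ℝ ∞ v U)
    (hy : y ∈ U) :
    lapC G (fun z => u z * v z) y = u y * lapC G v y + v y * lapC G u y + 2 * ipC G u v y := by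
  have hgu := hG.gradC_smooth hu
  have hgv := hG.gradC_smooth hv
  have e : lapC G (fun z => u z * v z) y
      = divC G (fun z i => u z * gradC G v z i + v z * gradC G u z i) y := by
    refine hG.divC_congr (fun z hz => ?_) hy
    funext i
    simp only [gradC, Finset.mul_sum, ← Finset.sum_add_distrib]
    refine Finset.sum_congr rfl fun j _ => ?_
    rw [pd_mul (differentiableAt_of_contDiffOn hG.isOpen hu hz)
      (differentiableAt_of_contDiffOn hG.isOpen hv hz)]
    ring
  rw [e, hG.divC_add (fun i => hu.mul (hgv i)) (fun i => hv.mul (hgu i)) hy,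
    hG.divC_mul hu hgv hy, hG.divC_mul hv hgu hy, hG.sum_gradC_mul hy, hG.sum_gradC_mul hy,
    hG.ipC_symm (u := v) hy]
  unfold lapC
  ring

theorem lapC_comp (hG : IsMetricOn G U) {g : ℝ → ℝ} (hg : ContDiff ℝ ∞ g)
    (hu : ContDiffOn ℝ ∞ u U) (hy : y ∈ U) :
    lapC G (fun z => g (u z)) y
      = deriv g (u y) * lapC G u y + deriv (deriv g) (u y) * ipC G u u y := by
  have hg' : ContDiff ℝ ∞ (deriv g) := ((contDiff_infty_iff_deriv).1 hg).2
  have hgu := hG.gradC_smooth hu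
  have e : lapC G (fun z => g (u z)) y
      = divC G (fun z i => deriv g (u z) * gradC G u z i) y := by
    refine hG.divC_congr (fun z hz => ?_) hy
    funext i
    simp only [gradC, Finset.mul_sum]
    refine Finset.sum_congr rfl fun j _ => ?_
    rw [pd_comp_real (hg.differentiable (by simp)).differentiableAt
      (differentiableAt_of_contDiffOn hG.isOpen hu hz)]
    ring
  have e2 : ∑ i, gradC G u y i * pd i (fun z => deriv g (u z)) y
      = deriv (deriv g) (u y) * ipC G u u y := by
    rw [← hG.sum_gradC_mul hy, Finset.mul_sum]
    refine Finset.sum_congr rfl fun i _ => ?_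
    rw [pd_comp_real (hg'.differentiable (by simp)).differentiableAt
      (differentiableAt_of_contDiffOn hG.isOpen hu hy)]
    ring
  rw [e, hG.divC_mul (u := fun z => deriv g (u z)) (hg'.comp_contDiffOn hu) hgu hy, e2]
  rfl

theorem pd_testFunction (hU : IsOpen U) {ψ : ℝ → ℝ} (hψ : ContDiff ℝ ∞ ψ)
    (hχ : ContDiffOn ℝ ∞ χ U) (hw : ContDiffOn ℝ ∞ w U) (hy : y ∈ U) (i : Fin 4) :
    pd i (fun z => χ z ^ 4 * ψ (w z)) y
      = χ y ^ 4 * deriv ψ (w y) * pd i w y + 4 * χ y ^ 3 * ψ (w y) * pd i χ y := by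
  have hdχ := differentiableAt_of_contDiffOn hU hχ hy
  have hdw := differentiableAt_of_contDiffOn hU hw hy
  have hdψ : DifferentiableAt ℝ ψ (w y) := (hψ.differentiable (by simp)).differentiableAt
  rw [pd_mul (u := fun z => χ z ^ 4) (v := fun z => ψ (w z)) (hdχ.pow 4) (hdψ.comp y hdw), pd_comp_real hdψ hdw,
    pd_comp_real (g := fun t => t ^ 4) (by fun_prop) hdχ]
  simp
  ring

theorem ipC_testFunction (hU : IsOpen U) {ψ : ℝ → ℝ} (hψ : ContDiff ℝ ∞ ψ)
    (hχ : ContDiffOn ℝ ∞ χ U) (hw : ContDiffOn ℝ ∞ w U) (hy : y ∈ U) :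
    ipC G u (fun z => χ z ^ 4 * ψ (w z)) y
      = χ y ^ 4 * deriv ψ (w y) * ipC G u w y + 4 * χ y ^ 3 * ψ (w y) * ipC G u χ y := by
  simp only [ipC, Finset.mul_sum, ← Finset.sum_add_distrib]
  refine Finset.sum_congr rfl fun i _ => Finset.sum_congr rfl fun j _ => ?_
  rw [pd_testFunction hU hψ hχ hw hy]
  ring

theorem lowerC_testFunction (hU : IsOpen U) {ψ : ℝ → ℝ} (hψ : ContDiff ℝ ∞ ψ)
    (hχ : ContDiffOn ℝ ∞ χ U) (hw : ContDiffOn ℝ ∞ w U) (hy : y ∈ U) (γ₂ γ₃ : ℝ) :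
    lowerC γ₂ γ₃ G u (fun z => χ z ^ 4 * ψ (w z)) y
      = χ y ^ 4 * deriv ψ (w y) * lowerC γ₂ γ₃ G u w y
        + 4 * χ y ^ 3 * ψ (w y) * lowerC γ₂ γ₃ G u χ y := by
  have e : ricFormC G u (fun z => χ z ^ 4 * ψ (w z)) y
      = χ y ^ 4 * deriv ψ (w y) * ricFormC G u w y
        + 4 * χ y ^ 3 * ψ (w y) * ricFormC G u χ y := by
    simp only [ricFormC, Finset.mul_sum, ← Finset.sum_add_distrib]
    refine Finset.sum_congr rfl fun i _ => ?_
    rw [pd_testFunction hU hψ hχ hw hy]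
    ring
  unfold lowerC
  rw [e, ipC_testFunction hU hψ hχ hw hy]
  ring

theorem lapC_testFunction (hG : IsMetricOn G U) {ψ : ℝ → ℝ} (hψ : ContDiff ℝ ∞ ψ)
    (hχ : ContDiffOn ℝ ∞ χ U) (hw : ContDiffOn ℝ ∞ w U) (hy : y ∈ U) :
    lapC G (fun z => χ z ^ 4 * ψ (w z)) y
      = χ y ^ 4 * (deriv ψ (w y) * lapC G w y + deriv (deriv ψ) (w y) * ipC G w w y)
        + 8 * χ y ^ 3 * deriv ψ (w y) * ipC G χ w y
        + ψ (w y) * (4 * χ y ^ 3 * lapC G χ y + 12 * χ y ^ 2 * ipC G χ χ y) := by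
  have hp : ContDiff ℝ ∞ (fun t : ℝ => t ^ 4) := by fun_prop
  have hψw : ContDiffOn ℝ ∞ (fun z => ψ (w z)) U := hψ.comp_contDiffOn hw
  have d1 : deriv (fun t : ℝ => t ^ 4) = fun t => 4 * t ^ 3 := by
    funext t; simp
  have d2 : deriv (fun t : ℝ => 4 * t ^ 3) = fun t => 12 * t ^ 2 := by
    funext t
    rw [deriv_const_mul _ (by fun_prop)]
    simp
    ring
  have e : ipC G (fun z => χ z ^ 4) (fun z => ψ (w z)) y
      = 4 * χ y ^ 3 * deriv ψ (w y) * ipC G χ w y := by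
    simp only [ipC, Finset.mul_sum]
    refine Finset.sum_congr rfl fun i _ => Finset.sum_congr rfl fun j _ => ?_
    rw [pd_comp_real (g := fun t : ℝ => t ^ 4) (by fun_prop)
        (differentiableAt_of_contDiffOn hG.isOpen hχ hy),
      pd_comp_real (hψ.differentiable (by simp)).differentiableAt
        (differentiableAt_of_contDiffOn hG.isOpen hw hy), d1]
    ring
  rw [hG.lapC_mul (u := fun z => χ z ^ 4) (v := fun z => ψ (w z)) (hχ.pow 4) hψw hy,
    hG.lapC_comp hψ hw hy, hG.lapC_comp (g := fun t : ℝ => t ^ 4) hp hχ hy, e, d1, d2]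
  ring

/-! ### Pointwise estimates in coordinates -/

theorem ipC_self_nonneg (hG : IsMetricOn G U) (hy : y ∈ U) : 0 ≤ ipC G u u y := by
  rw [ipC_eq_sum_pd]
  have := (hG.posDef y hy).inv.posSemidef.dotProduct_mulVec_nonneg (fun i => pd i u y)
  simpa using this

/-- The Cauchy-Schwarz inequality for the inverse metric. -/
theorem inv_cauchy_schwarz (hG : IsMetricOn G U) (hy : y ∈ U) (a b : Fin 4 → ℝ) :
    (a ⬝ᵥ ((G y)⁻¹ *ᵥ b)) ^ 2 ≤ (a ⬝ᵥ ((G y)⁻¹ *ᵥ a)) * (b ⬝ᵥ ((G y)⁻¹ *ᵥ b)) := by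
  have hnn : ∀ c : Fin 4 → ℝ, 0 ≤ c ⬝ᵥ ((G y)⁻¹ *ᵥ c) := by
    intro c
    have := (hG.posDef y hy).inv.posSemidef.dotProduct_mulVec_nonneg c
    simpa using this
  have hs : b ⬝ᵥ ((G y)⁻¹ *ᵥ a) = a ⬝ᵥ ((G y)⁻¹ *ᵥ b) := by
    rw [Matrix.dotProduct_mulVec, ← Matrix.mulVec_transpose, hG.inv_symm hy, dotProduct_comm]
  have hq : ∀ t : ℝ, 0 ≤ (b ⬝ᵥ ((G y)⁻¹ *ᵥ b)) * (t * t)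
      + (2 * (a ⬝ᵥ ((G y)⁻¹ *ᵥ b))) * t + a ⬝ᵥ ((G y)⁻¹ *ᵥ a) := by
    intro t
    have := hnn (a + t • b)
    simp only [Matrix.mulVec_add, Matrix.mulVec_smul, dotProduct_add, add_dotProduct,
      smul_dotProduct, dotProduct_smul, smul_eq_mul, hs] at this
    nlinarith
  have := discrim_le_zero hq
  unfold discrim at this
  nlinarith

theorem ipC_sq_le (hG : IsMetricOn G U) (hy : y ∈ U) :
    ipC G u v y ^ 2 ≤ ipC G u u y * ipC G v v y := by
  simp only [ipC_eq_sum_pd]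
  exact hG.inv_cauchy_schwarz hy _ _

/-- A partial derivative is the scalar product of the gradient with a coordinate vector. -/
theorem pd_sq_le (hG : IsMetricOn G U) (hy : y ∈ U) (i : Fin 4) :
    pd i u y ^ 2 ≤ G y i i * ipC G u u y := by
  have h := hG.inv_cauchy_schwarz hy (fun j => pd j u y) (G y *ᵥ Pi.single i 1)
  rw [Matrix.mulVec_mulVec, hG.inv_mul hy, Matrix.one_mulVec, ← ipC_eq_sum_pd] at h
  simp only [dotProduct_single, mul_one] at h
  have e : (G y *ᵥ Pi.single i (1 : ℝ)) i = G y i i := by simp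
  rw [e] at h
  linarith [mul_comm (G y i i) (ipC G u u y)]

theorem abs_pd_le (hG : IsMetricOn G U) (hy : y ∈ U) (i : Fin 4) :
    |pd i u y| ≤ Real.sqrt (G y i i) * Real.sqrt (ipC G u u y) := by
  have hnn : 0 ≤ G y i i := (hG.posDef y hy).diag_pos.le
  rw [← Real.sqrt_mul hnn]
  exact Real.abs_le_sqrt (hG.pd_sq_le hy i)

/-- On compact sets, the first-order part of the weak form, which is a bilinear form in the
gradients with continuous coefficients, is controlled by the lengths of the gradients. -/
theorem exists_lowerC_bound (hG : IsMetricOn G U) (γ₂ γ₃ : ℝ) {K : Set E4} (hK : IsCompact K)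
    (hKU : K ⊆ U) : ∃ C : ℝ, 0 ≤ C ∧ ∀ y ∈ K, ∀ u v : E4 → ℝ,
      |lowerC γ₂ γ₃ G u v y| ≤ C * Real.sqrt (ipC G u u y) * Real.sqrt (ipC G v v y) := by
  -- the coefficients of `lowerC` as a bilinear form in the differentials
  let L : Fin 4 → Fin 4 → E4 → ℝ := fun i j y =>
    γ₂ / 2 * (2 / 3 * scalar G y * (G y)⁻¹ i j
      - 2 * ∑ a, ∑ b, (G y)⁻¹ j a * ricci G a b y * (G y)⁻¹ b i)
    - 2 * γ₃ * (scalar G y * (G y)⁻¹ i j)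
  have hL : ∀ i j, ContinuousOn (L i j) U := by
    intro i j
    have h1 : ∀ i j, ContinuousOn (fun z => (G z)⁻¹ i j) U := fun i j =>
      (hG.inv_smooth i j).continuousOn
    have h2 := hG.scalar_smooth.continuousOn
    have h3 : ∀ i j, ContinuousOn (ricci G i j) U := fun i j => (hG.ricci_smooth i j).continuousOn
    refine ContinuousOn.sub (continuousOn_const.mul (ContinuousOn.sub
      ((continuousOn_const.mul h2).mul (h1 i j)) (continuousOn_const.mul ?_)))
      (continuousOn_const.mul (h2.mul (h1 i j)))
    exact continuousOn_finsetSum _ fun a _ => continuousOn_finsetSum _ fun b _ =>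
      ((h1 j a).mul (h3 a b)).mul (h1 b i)
  have hexp : ∀ u v : E4 → ℝ, ∀ y, lowerC γ₂ γ₃ G u v y
      = ∑ i, ∑ j, L i j y * pd i u y * pd j v y := by
    intro u v y
    have r : ricFormC G u v y = ∑ i, ∑ j,
        (∑ a, ∑ b, (G y)⁻¹ j a * ricci G a b y * (G y)⁻¹ b i) * pd i u y * pd j v y := by
      simp only [ricFormC, ricSharp, gradC, Finset.sum_mul, Finset.mul_sum]
      rw [Finset.sum_comm]
      conv_rhs => rw [Finset.sum_comm]
      rw [Finset.sum_comm]
      refine Finset.sum_congr rfl fun j _ => ?_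
      rw [Finset.sum_comm' (t' := Finset.univ) (s' := fun _ => Finset.univ) (by simp)]
      conv_lhs => enter [2, a]; rw [Finset.sum_comm]
      rw [Finset.sum_comm]
      conv_rhs => enter [2, i]; rw [Finset.sum_comm]
      refine Finset.sum_congr rfl fun i _ => ?_
      refine Finset.sum_congr rfl fun b _ => Finset.sum_congr rfl fun a _ => by ring
    rw [lowerC, r, ipC]
    simp only [L, Finset.mul_sum, ← Finset.sum_sub_distrib]
    refine Finset.sum_congr rfl fun i _ => Finset.sum_congr rfl fun j _ => ?_
    simp only [Finset.sum_mul, Finset.mul_sum]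
    ring_nf
    simp only [Finset.sum_mul, Finset.mul_sum]
    ring_nf
  let κ : E4 → ℝ := fun y => ∑ i, ∑ j, |L i j y| * (Real.sqrt (G y i i) * Real.sqrt (G y j j))
  have hκ : ContinuousOn κ U := by
    refine continuousOn_finsetSum _ fun i _ => continuousOn_finsetSum _ fun j _ => ?_
    exact (hL i j).abs.mul ((hG.smooth i i).continuousOn.sqrt.mul
      (hG.smooth j j).continuousOn.sqrt)
  obtain ⟨C, hC⟩ := hK.exists_bound_of_continuousOn (hκ.mono hKU)
  refine ⟨max C 0, le_max_right _ _, fun y hy u v => ?_⟩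
  have h1 : |lowerC γ₂ γ₃ G u v y| ≤ κ y * Real.sqrt (ipC G u u y) * Real.sqrt (ipC G v v y) := by
    rw [hexp]
    simp only [κ, Finset.sum_mul]
    refine (Finset.abs_sum_le_sum_abs _ _).trans (Finset.sum_le_sum fun i _ => ?_)
    refine (Finset.abs_sum_le_sum_abs _ _).trans (Finset.sum_le_sum fun j _ => ?_)
    rw [abs_mul, abs_mul]
    have a1 := hG.abs_pd_le (u := u) (hKU hy) i
    have a2 := hG.abs_pd_le (u := v) (hKU hy) j
    calc |L i j y| * |pd i u y| * |pd j v y|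
        ≤ |L i j y| * (Real.sqrt (G y i i) * Real.sqrt (ipC G u u y))
          * (Real.sqrt (G y j j) * Real.sqrt (ipC G v v y)) := by gcongr
      _ = _ := by ring
  have h2 : κ y ≤ max C 0 := ((le_abs_self _).trans (hC y hy)).trans (le_max_left _ _)
  refine h1.trans ?_
  gcongr

/-- On compact sets, the Laplacian and the gradient are controlled by the coordinate
derivatives. -/
theorem exists_lapC_bound (hG : IsMetricOn G U) {K : Set E4} (hK : IsCompact K) (hKU : K ⊆ U) :
    ∃ C : ℝ, 0 ≤ C ∧ ∀ y ∈ K, ∀ u : E4 → ℝ, ContDiffOn ℝ ∞ u U →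
      ∀ D₁ D₂ : ℝ, (∀ i, |pd i u y| ≤ D₁) → (∀ i j, |pd i (pd j u) y| ≤ D₂) →
      |lapC G u y| ≤ C * (D₁ + D₂) ∧ ipC G u u y ≤ C * D₁ ^ 2 := by
  have h1 : ∀ i j, ContinuousOn (fun z => (G z)⁻¹ i j) U := fun i j =>
    (hG.inv_smooth i j).continuousOn
  have h2 : ∀ i j, ContinuousOn (pd i (fun z => (G z)⁻¹ i j)) U := fun i j =>
    (contDiffOn_pd hG.isOpen (hG.inv_smooth i j) i).continuousOn
  have h3 : ∀ i, ContinuousOn (fun z => (conn G i z).trace) U := fun i =>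
    continuousOn_finsetSum _ fun k _ => (hG.conn_smooth i k k).continuousOn
  let κ : E4 → ℝ := fun y => ∑ i, ∑ j, (|(G y)⁻¹ i j| + (|pd i (fun z => (G z)⁻¹ i j) y|
    + |(conn G i y).trace| * |(G y)⁻¹ i j|))
  have hκ : ContinuousOn κ U := by
    refine continuousOn_finsetSum _ fun i _ => continuousOn_finsetSum _ fun j _ => ?_
    exact (h1 i j).abs.add ((h2 i j).abs.add ((h3 i).abs.mul (h1 i j).abs))
  obtain ⟨C, hC⟩ := hK.exists_bound_of_continuousOn (hκ.mono hKU)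
  refine ⟨max C 0, le_max_right _ _, fun y hy u hu D₁ D₂ hD₁ hD₂ => ?_⟩
  have hκC : κ y ≤ max C 0 := ((le_abs_self _).trans (hC y hy)).trans (le_max_left _ _)
  have hD₁' : 0 ≤ D₁ := (abs_nonneg _).trans (hD₁ 0)
  have hD₂' : 0 ≤ D₂ := (abs_nonneg _).trans (hD₂ 0 0)
  have hyU := hKU hy
  constructor
  · have e : lapC G u y = ∑ i, ∑ j, ((G y)⁻¹ i j * pd i (pd j u) y
        + (pd i (fun z => (G z)⁻¹ i j) y + (conn G i y).trace * (G y)⁻¹ i j) * pd j u y) := by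
      unfold lapC
      rw [hG.divC_eq (hG.gradC_smooth hu) hyU]
      refine Finset.sum_congr rfl fun i _ => ?_
      have d : ∀ j, DifferentiableAt ℝ (fun z => (G z)⁻¹ i j * pd j u z) y := fun j =>
        differentiableAt_of_contDiffOn hG.isOpen
          ((hG.inv_smooth i j).mul (contDiffOn_pd hG.isOpen hu j)) hyU
      simp only [gradC]
      rw [pd_sum fun j _ => d j, Finset.mul_sum, ← Finset.sum_add_distrib]
      refine Finset.sum_congr rfl fun j _ => ?_
      rw [pd_mul (differentiableAt_of_contDiffOn hG.isOpen (hG.inv_smooth i j) hyU)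
        (differentiableAt_of_contDiffOn hG.isOpen (contDiffOn_pd hG.isOpen hu j) hyU)]
      ring
    have : |lapC G u y| ≤ κ y * (D₁ + D₂) := by
      rw [e]
      simp only [κ, Finset.sum_mul]
      refine (Finset.abs_sum_le_sum_abs _ _).trans (Finset.sum_le_sum fun i _ => ?_)
      refine (Finset.abs_sum_le_sum_abs _ _).trans (Finset.sum_le_sum fun j _ => ?_)
      refine (abs_add_le _ _).trans ?_
      rw [abs_mul, abs_mul]
      have b1 := hD₁ j
      have b2 := hD₂ i j
      have b3 : |pd i (fun z => (G z)⁻¹ i j) y + (conn G i y).trace * (G y)⁻¹ i j|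
          ≤ |pd i (fun z => (G z)⁻¹ i j) y| + |(conn G i y).trace| * |(G y)⁻¹ i j| := by
        refine (abs_add_le _ _).trans ?_
        rw [abs_mul]
      calc _ ≤ |(G y)⁻¹ i j| * (D₁ + D₂) + (|pd i (fun z => (G z)⁻¹ i j) y|
              + |(conn G i y).trace| * |(G y)⁻¹ i j|) * (D₁ + D₂) := by
            gcongr
            · linarith
            · linarith
        _ = _ := by ring
    exact this.trans (by gcongr)
  · have : ipC G u u y ≤ κ y * D₁ ^ 2 := by
      unfold ipC
      simp only [κ, Finset.sum_mul]
      refine Finset.sum_le_sum fun i _ => Finset.sum_le_sum fun j _ => ?_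
      have b1 := hD₁ i
      have b2 := hD₁ j
      calc (G y)⁻¹ i j * pd i u y * pd j u y ≤ |(G y)⁻¹ i j * pd i u y * pd j u y| := le_abs_self _
        _ = |(G y)⁻¹ i j| * |pd i u y| * |pd j u y| := by rw [abs_mul, abs_mul]
        _ ≤ |(G y)⁻¹ i j| * D₁ * D₁ := by gcongr
        _ = |(G y)⁻¹ i j| * D₁ ^ 2 := by ring
        _ ≤ _ := by
          refine mul_le_mul_of_nonneg_right ?_ (sq_nonneg _)
          have := mul_nonneg (abs_nonneg (conn G i y).trace) (abs_nonneg ((G y)⁻¹ i j))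
          linarith [abs_nonneg (pd i (fun z => (G z)⁻¹ i j) y)]
    exact this.trans (by gcongr)

end IsMetricOn

/-! ### Integration by parts in coordinates -/

section Support

variable {U K : Set E4} {f : E4 → ℝ} {y : E4}

/-- Extension by zero of a smooth function on `U` that vanishes outside a compact subset. -/
theorem contDiff_indicator (hU : IsOpen U) (hK : IsCompact K) (hKU : K ⊆ U)
    (hf : ContDiffOn ℝ ∞ f U) (h0 : ∀ y ∈ U \ K, f y = 0) : ContDiff ℝ ∞ (U.indicator f) := by
  refine contDiff_iff_contDiffAt.2 fun y => ?_
  by_cases hy : y ∈ U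
  · refine (hf.contDiffAt (hU.mem_nhds hy)).congr_of_eventuallyEq ?_
    filter_upwards [hU.mem_nhds hy] with z hz using indicator_of_mem hz f
  · have hyK : y ∈ Kᶜ := fun h => hy (hKU h)
    refine (contDiffAt_const (c := (0 : ℝ))).congr_of_eventuallyEq ?_
    filter_upwards [hK.isClosed.isOpen_compl.mem_nhds hyK] with z hz
    by_cases hzU : z ∈ U
    · rw [indicator_of_mem hzU, h0 z ⟨hzU, hz⟩]
    · exact indicator_of_notMem hzU f

theorem hasCompactSupport_indicator (hK : IsCompact K) (h0 : ∀ y ∈ U \ K, f y = 0) :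
    HasCompactSupport (U.indicator f) := by
  refine HasCompactSupport.intro hK fun y hy => ?_
  by_cases hyU : y ∈ U
  · rw [indicator_of_mem hyU, h0 y ⟨hyU, hy⟩]
  · exact indicator_of_notMem hyU f

theorem integrableOn_of_vanish (hU : IsOpen U) (hK : IsCompact K) (hKU : K ⊆ U)
    (hf : ContinuousOn f U) (h0 : ∀ y ∈ U \ K, f y = 0) : IntegrableOn f U := by
  have h1 : IntegrableOn f K := (hf.mono hKU).integrableOn_compact hK
  exact h1.of_forall_sdiff_eq_zero hU.measurableSet h0

theorem pd_vanish (hU : IsOpen U) (hK : IsCompact K) (h0 : ∀ y ∈ U \ K, f y = 0) (i : Fin 4) :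
    ∀ y ∈ U \ K, pd i f y = 0 := by
  intro y hy
  rw [pd_eqOn (v := fun _ => 0) (hU.sdiff hK.isClosed) h0 i hy, pd_const]

theorem integral_pd_eq_zero (hU : IsOpen U) (hK : IsCompact K) (hKU : K ⊆ U)
    (hf : ContDiffOn ℝ ∞ f U) (h0 : ∀ y ∈ U \ K, f y = 0) (i : Fin 4) :
    ∫ y in U, pd i f y = 0 := by
  have hF := contDiff_indicator hU hK hKU hf h0
  have hFs := hasCompactSupport_indicator hK h0
  have e : ∀ y ∈ U, pd i f y = pd i (U.indicator f) y := fun y hy =>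
    pd_eqOn hU (fun z hz => (indicator_of_mem hz f).symm) i hy
  rw [setIntegral_congr_fun hU.measurableSet e, setIntegral_eq_integral_of_forall_compl_eq_zero]
  · have hcont : Continuous fun y => fderiv ℝ (U.indicator f) y (EuclideanSpace.single i 1) :=
      (hF.continuous_fderiv (by simp)).clm_apply continuous_const
    have hint : Integrable fun y => fderiv ℝ (U.indicator f) y (EuclideanSpace.single i 1) :=
      hcont.integrable_of_hasCompactSupport (hFs.fderiv_apply ℝ _)
    have := integral_mul_fderiv_eq_neg_fderiv_mul_of_integrable (μ := (volume : Measure E4))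
      (f := fun _ => (1 : ℝ)) (g := U.indicator f) (v := EuclideanSpace.single i 1)
      (by simp) (by simpa using hint)
      (by simpa using hF.continuous.integrable_of_hasCompactSupport hFs)
      (fun x _ => differentiableAt_const _) (fun x _ => (hF.differentiable (by simp)).differentiableAt)
    simpa [pd] using this
  · intro y hy
    have hyK : y ∈ Kᶜ := fun h => hy (hKU h)
    have : U.indicator f =ᶠ[𝓝 y] fun _ => 0 := by
      filter_upwards [hK.isClosed.isOpen_compl.mem_nhds hyK] with z hz
      by_cases hzU : z ∈ U
      · rw [indicator_of_mem hzU, h0 z ⟨hzU, hz⟩]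
      · exact indicator_of_notMem hzU f
    rw [pd_congr this, pd_const]

end Support

/-- The function `f` is, on `U`, the divergence of a smooth vector field that vanishes outside
the set `K`. -/
def IsCompactDiv (G : E4 → Matrix (Fin 4) (Fin 4) ℝ) (U K : Set E4) (f : E4 → ℝ) : Prop :=
  ∃ Z : E4 → Fin 4 → ℝ, (∀ i, ContDiffOn ℝ ∞ (fun z => Z z i) U) ∧
    (∀ y ∈ U \ K, Z y = 0) ∧ ∀ y ∈ U, f y = divC G Z y

namespace IsMetricOn

variable {G : E4 → Matrix (Fin 4) (Fin 4) ℝ} {U K : Set E4} {f g u v Φ : E4 → ℝ} {y : E4}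

theorem isCompactDiv_add (hG : IsMetricOn G U) (hf : IsCompactDiv G U K f)
    (hg : IsCompactDiv G U K g) : IsCompactDiv G U K fun y => f y + g y := by
  obtain ⟨X, hX, hX0, hXf⟩ := hf
  obtain ⟨Y, hY, hY0, hYg⟩ := hg
  refine ⟨fun z i => X z i + Y z i, fun i => (hX i).add (hY i), fun y hy => ?_, fun y hy => ?_⟩
  · funext i
    simp [hX0 y hy, hY0 y hy]
  · simp only [hG.divC_add hX hY hy, hXf y hy, hYg y hy]

theorem isCompactDiv_const_mul (hG : IsMetricOn G U) (a : ℝ) (hf : IsCompactDiv G U K f) :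
    IsCompactDiv G U K fun y => a * f y := by
  obtain ⟨X, hX, hX0, hXf⟩ := hf
  refine ⟨fun z i => a * X z i, fun i => contDiffOn_const.mul (hX i), fun y hy => ?_,
    fun y hy => ?_⟩
  · funext i
    simp [hX0 y hy]
  · simp only [hG.divC_const_mul a hX hy, hXf y hy]

theorem isCompactDiv_mul_divC (hG : IsMetricOn G U) {X : E4 → Fin 4 → ℝ}
    (hΦ : ContDiffOn ℝ ∞ Φ U) (hX : ∀ i, ContDiffOn ℝ ∞ (fun z => X z i) U)
    (h0 : ∀ y ∈ U \ K, Φ y = 0) :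
    IsCompactDiv G U K fun y => Φ y * divC G X y + ∑ i, X y i * pd i Φ y := by
  refine ⟨fun z i => Φ z * X z i, fun i => hΦ.mul (hX i), fun y hy => ?_, fun y hy => ?_⟩
  · funext i
    simp [h0 y hy]
  · rw [hG.divC_mul hΦ hX hy]

/-- Green's second identity, in divergence form. -/
theorem isCompactDiv_green (hG : IsMetricOn G U) (hK : IsCompact K)
    (hΦ : ContDiffOn ℝ ∞ Φ U) (hu : ContDiffOn ℝ ∞ u U) (h0 : ∀ y ∈ U \ K, Φ y = 0) :
    IsCompactDiv G U K fun y => Φ y * lapC G u y - u y * lapC G Φ y := by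
  have hgu := hG.gradC_smooth hu
  have hgΦ := hG.gradC_smooth hΦ
  refine ⟨fun z i => Φ z * gradC G u z i + (-1) * (u z * gradC G Φ z i),
    fun i => (hΦ.mul (hgu i)).add (contDiffOn_const.mul (hu.mul (hgΦ i))),
    fun y hy => ?_, fun y hy => ?_⟩
  · funext i
    simp [h0 y hy, gradC, pd_vanish hG.isOpen hK h0 _ y hy]
  · rw [hG.divC_add (fun i => hΦ.mul (hgu i)) (fun i => contDiffOn_const.mul (hu.mul (hgΦ i))) hy,
      hG.divC_const_mul (-1) (fun i => hu.mul (hgΦ i)) hy, hG.divC_mul hΦ hgu hy,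
      hG.divC_mul hu hgΦ hy, hG.sum_gradC_mul hy, hG.sum_gradC_mul hy, hG.ipC_symm (u := Φ) hy]
    unfold lapC
    ring

/-- The divergence theorem for compactly supported vector fields. -/
theorem integral_isCompactDiv (hG : IsMetricOn G U) (hK : IsCompact K) (hKU : K ⊆ U)
    (hf : IsCompactDiv G U K f) : ∫ y in U, f y * Real.sqrt (G y).det = 0 := by
  obtain ⟨X, hX, hX0, hXf⟩ := hf
  have hs : ∀ i, ContDiffOn ℝ ∞ (fun z => Real.sqrt (G z).det * X z i) U :=
    fun i => hG.sqrt_det_smooth.mul (hX i)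
  have h0 : ∀ i, ∀ y ∈ U \ K, Real.sqrt (G y).det * X y i = 0 := by
    intro i y hy
    simp [hX0 y hy]
  have e : ∀ y ∈ U, f y * Real.sqrt (G y).det
      = ∑ i, pd i (fun z => Real.sqrt (G z).det * X z i) y := by
    intro y hy
    rw [hXf y hy, divC]
    have := (hG.sqrt_det_pos hy).ne'
    field_simp
  rw [setIntegral_congr_fun hG.isOpen.measurableSet e, integral_finsetSum]
  · exact Finset.sum_eq_zero fun i _ =>
      integral_pd_eq_zero hG.isOpen hK hKU (hs i) (h0 i) i
  · exact fun i _ => integrableOn_of_vanish hG.isOpen hK hKU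
      (contDiffOn_pd hG.isOpen (hs i) i).continuousOn (pd_vanish hG.isOpen hK (h0 i) i)

theorem lapC_vanish (hG : IsMetricOn G U) (hK : IsCompact K) (h0 : ∀ y ∈ U \ K, Φ y = 0) :
    ∀ y ∈ U \ K, lapC G Φ y = 0 := by
  intro y hy
  have h1 : ∀ i, ∀ z ∈ U \ K, Real.sqrt (G z).det * gradC G Φ z i = 0 := by
    intro i z hz
    simp [gradC, pd_vanish hG.isOpen hK h0 _ z hz]
  unfold lapC divC
  simp [pd_vanish hG.isOpen hK (h1 _) _ y hy]

theorem weakC_vanish (hG : IsMetricOn G U) (hK : IsCompact K) (γ₂ γ₃ : ℝ)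
    (h0 : ∀ y ∈ U \ K, Φ y = 0) : ∀ y ∈ U \ K, weakC γ₂ γ₃ G u Φ y = 0 := by
  intro y hy
  have h1 := fun i => pd_vanish hG.isOpen hK h0 i y hy
  have h2 := hG.lapC_vanish hK h0 y hy
  simp [weakC, lowerC, ipC, ricFormC, h1, h2]

/-- Integration by parts: the weak form of the operator `N` in coordinates. -/
theorem integral_opNC_mul (hG : IsMetricOn G U) (hK : IsCompact K) (hKU : K ⊆ U) (γ₂ γ₃ : ℝ)
    (hu : ContDiffOn ℝ ∞ u U) (hΦ : ContDiffOn ℝ ∞ Φ U) (h0 : ∀ y ∈ U \ K, Φ y = 0) :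
    ∫ y in U, opNC γ₂ γ₃ G u y * Φ y * Real.sqrt (G y).det
      = ∫ y in U, weakC γ₂ γ₃ G u Φ y * Real.sqrt (G y).det := by
  have hl := hG.lapC_smooth hu
  have hF := hl.add (hG.gradSqC_smooth hu)
  have c1 := hG.isCompactDiv_green hK hΦ hl h0
  have c2 := hG.isCompactDiv_mul_divC hΦ (hG.paneitz_field_smooth hu) h0
  have c3 := hG.isCompactDiv_green hK hΦ hF h0
  have c4 := hG.isCompactDiv_mul_divC hΦ (hG.quasilinear_field_smooth hu) h0
  have c5 := hG.isCompactDiv_mul_divC hΦ (hG.scalar_field_smooth hu) h0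
  have key : IsCompactDiv G U K fun y => opNC γ₂ γ₃ G u y * Φ y - weakC γ₂ γ₃ G u Φ y := by
    obtain ⟨Z, hZ, hZ0, hZf⟩ := hG.isCompactDiv_add (hG.isCompactDiv_add (hG.isCompactDiv_add
      (hG.isCompactDiv_const_mul (γ₂ / 2) (hG.isCompactDiv_add c1
        (hG.isCompactDiv_const_mul (-1) c2)))
      (hG.isCompactDiv_const_mul (6 * γ₃) c3)) (hG.isCompactDiv_const_mul (-12 * γ₃) c4))
      (hG.isCompactDiv_const_mul (2 * γ₃) c5)
    refine ⟨Z, hZ, hZ0, fun y hy => ?_⟩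
    rw [← hZf y hy]
    have s1 : ∑ i, (2 / 3 * scalar G y * gradC G u y i - 2 * ricSharp G (gradC G u) y i)
        * pd i Φ y = 2 / 3 * scalar G y * ipC G u Φ y - 2 * ricFormC G u Φ y := by
      rw [← hG.sum_gradC_mul hy, ricFormC, Finset.mul_sum, Finset.mul_sum,
        ← Finset.sum_sub_distrib]
      exact Finset.sum_congr rfl fun i _ => by ring
    have s2 : ∑ i, ((lapC G u y + gradSqC G u y) * gradC G u y i) * pd i Φ y
        = (lapC G u y + gradSqC G u y) * ipC G u Φ y := by
      rw [← hG.sum_gradC_mul hy, Finset.mul_sum]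
      exact Finset.sum_congr rfl fun i _ => by ring
    have s3 : ∑ i, (scalar G y * gradC G u y i) * pd i Φ y = scalar G y * ipC G u Φ y := by
      rw [← hG.sum_gradC_mul hy, Finset.mul_sum]
      exact Finset.sum_congr rfl fun i _ => by ring
    simp only [s1, s2, s3]
    unfold opNC paneitzC weakC lowerC
    ring
  have hz := hG.integral_isCompactDiv hK hKU key
  have hs := hG.sqrt_det_smooth.continuousOn
  have i1 : IntegrableOn (fun y => opNC γ₂ γ₃ G u y * Φ y * Real.sqrt (G y).det) U :=
    integrableOn_of_vanish hG.isOpen hK hKU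
      (((hG.opNC_smooth γ₂ γ₃ hu).continuousOn.mul hΦ.continuousOn).mul hs)
      (fun y hy => by simp [h0 y hy])
  have i2 : IntegrableOn (fun y => weakC γ₂ γ₃ G u Φ y * Real.sqrt (G y).det) U :=
    integrableOn_of_vanish hG.isOpen hK hKU
      ((hG.weakC_smooth γ₂ γ₃ hu hΦ).continuousOn.mul hs)
      (fun y hy => by simp [hG.weakC_vanish hK γ₂ γ₃ h0 y hy])
  simp only [sub_mul] at hz
  rw [integral_sub i1 i2] at hz
  linarith

end IsMetricOn

/-! ### The metric in the charts of a Riemannian manifold -/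

section Charts

variable {M : Type*} [EMetricSpace M] [ChartedSpace E4 M] [IsManifold (𝓡 4) ∞ M]

/-- The differential of the inverse of the preferred chart at `x₀`, with all tangent spaces
identified with the model space. -/
def chartSymmDeriv (x₀ : M) (y : E4) : E4 →L[ℝ] E4 :=
  mfderiv (𝓡 4) (𝓡 4) (extChartAt (𝓡 4) x₀).symm y

/-- The change of coordinates from the preferred chart at `x₀` to the preferred chart at `x₁`. -/
def chartChange (x₀ x₁ : M) (y : E4) : E4 :=
  extChartAt (𝓡 4) x₁ ((extChartAt (𝓡 4) x₀).symm y)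

/-- The domain of the change of coordinates from the chart at `x₀` to the chart at `x₁`. -/
def chartOverlap (x₀ x₁ : M) : Set E4 :=
  (extChartAt (𝓡 4) x₀).target ∩ (extChartAt (𝓡 4) x₀).symm ⁻¹' (extChartAt (𝓡 4) x₁).source

theorem isOpen_chartOverlap (x₀ x₁ : M) : IsOpen (chartOverlap x₀ x₁) :=
  (continuousOn_extChartAt_symm x₀).isOpen_inter_preimage (isOpen_extChartAt_target x₀)
    (isOpen_extChartAt_source x₁)

theorem contDiffOn_chartChange (x₀ x₁ : M) :
    ContDiffOn ℝ ∞ (chartChange x₀ x₁) (chartOverlap x₀ x₁) := by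
  have := contDiffOn_ext_coord_change (I := 𝓡 4) (n := ∞) x₁ x₀
  rwa [PartialEquiv.trans_source] at this

theorem mapsTo_chartChange (x₀ x₁ : M) :
    MapsTo (chartChange x₀ x₁) (chartOverlap x₀ x₁) (extChartAt (𝓡 4) x₁).target :=
  fun _ hy => (extChartAt (𝓡 4) x₁).map_source hy.2

theorem symm_chartChange (x₀ x₁ : M) {y : E4} (hy : y ∈ chartOverlap x₀ x₁) :
    (extChartAt (𝓡 4) x₁).symm (chartChange x₀ x₁ y) = (extChartAt (𝓡 4) x₀).symm y :=
  (extChartAt (𝓡 4) x₁).left_inv hy.2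

theorem inChart_chartChange (x₀ x₁ : M) (w : M → ℝ) {y : E4} (hy : y ∈ chartOverlap x₀ x₁) :
    inChart x₀ w y = inChart x₁ w (chartChange x₀ x₁ y) := by
  unfold inChart
  rw [symm_chartChange x₀ x₁ hy]

theorem mem_chartOverlap {x₀ x₁ x : M} (h₀ : x ∈ (extChartAt (𝓡 4) x₀).source)
    (h₁ : x ∈ (extChartAt (𝓡 4) x₁).source) : extChartAt (𝓡 4) x₀ x ∈ chartOverlap x₀ x₁ :=
  ⟨(extChartAt (𝓡 4) x₀).map_source h₀, by rwa [mem_preimage, (extChartAt (𝓡 4) x₀).left_inv h₀]⟩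

theorem chartChange_apply {x₀ x₁ x : M} (h₀ : x ∈ (extChartAt (𝓡 4) x₀).source) :
    chartChange x₀ x₁ (extChartAt (𝓡 4) x₀ x) = extChartAt (𝓡 4) x₁ x := by
  unfold chartChange
  rw [(extChartAt (𝓡 4) x₀).left_inv h₀]

theorem contDiffOn_inChart (x₀ : M) {w : M → ℝ} (hw : ContMDiff (𝓡 4) 𝓘(ℝ, ℝ) ∞ w) :
    ContDiffOn ℝ ∞ (inChart x₀ w) (extChartAt (𝓡 4) x₀).target :=
  (hw.comp_contMDiffOn (contMDiffOn_extChartAt_symm x₀)).contDiffOn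

theorem mdifferentiableAt_chart_symm {x₀ : M} {y : E4} (hy : y ∈ (extChartAt (𝓡 4) x₀).target) :
    MDifferentiableAt (𝓡 4) (𝓡 4) (extChartAt (𝓡 4) x₀).symm y :=
  ((contMDiffOn_extChartAt_symm (n := ∞) x₀).contMDiffAt
    ((isOpen_extChartAt_target x₀).mem_nhds hy)).mdifferentiableAt (by simp)

theorem chartSymmDeriv_injective {x₀ : M} {y : E4} (hy : y ∈ (extChartAt (𝓡 4) x₀).target) :
    Function.Injective (chartSymmDeriv x₀ y) := by
  have hx : (extChartAt (𝓡 4) x₀).symm y ∈ (extChartAt (𝓡 4) x₀).source :=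
    (extChartAt (𝓡 4) x₀).map_target hy
  have h1 := mdifferentiableAt_chart_symm hy
  have h2 : MDifferentiableAt (𝓡 4) 𝓘(ℝ, E4) (extChartAt (𝓡 4) x₀)
      ((extChartAt (𝓡 4) x₀).symm y) :=
    (contMDiffAt_extChartAt' (n := ∞) (by simpa using hx)).mdifferentiableAt (by simp)
  have h3 := mfderiv_comp y h2 h1
  have h4 : mfderiv (𝓡 4) 𝓘(ℝ, E4) (extChartAt (𝓡 4) x₀ ∘ (extChartAt (𝓡 4) x₀).symm) y
      = ContinuousLinearMap.id ℝ E4 := by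
    rw [Filter.EventuallyEq.mfderiv_eq (f := id), mfderiv_id]
    · rfl
    · filter_upwards [(isOpen_extChartAt_target x₀).mem_nhds hy] with z hz
      exact (extChartAt (𝓡 4) x₀).right_inv hz
  rw [h4] at h3
  intro a b hab
  have ha := congrArg (fun L : E4 →L[ℝ] E4 => L a) h3
  have hb := congrArg (fun L : E4 →L[ℝ] E4 => L b) h3
  have e : ∀ c : E4, (ContinuousLinearMap.id ℝ E4) c
      = mfderiv (𝓡 4) 𝓘(ℝ, E4) (extChartAt (𝓡 4) x₀) ((extChartAt (𝓡 4) x₀).symm y)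
        (chartSymmDeriv x₀ y c) := by
    intro c
    exact congrArg (fun L : E4 →L[ℝ] E4 => L c) h3
  have := e a
  rw [hab, ← e b] at this
  exact this

theorem chartSymmDeriv_chartChange {x₀ x₁ : M} {y : E4} (hy : y ∈ chartOverlap x₀ x₁) :
    chartSymmDeriv x₀ y
      = (chartSymmDeriv x₁ (chartChange x₀ x₁ y)).comp (fderiv ℝ (chartChange x₀ x₁) y) := by
  have hd : DifferentiableAt ℝ (chartChange x₀ x₁) y :=
    differentiableAt_of_contDiffOn (isOpen_chartOverlap x₀ x₁) (contDiffOn_chartChange x₀ x₁) hy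
  have h1 := mdifferentiableAt_chart_symm (mapsTo_chartChange x₀ x₁ hy)
  have h3 := mfderiv_comp y h1 hd.mdifferentiableAt
  rw [mfderiv_eq_fderiv] at h3
  have h4 : mfderiv (𝓡 4) (𝓡 4) ((extChartAt (𝓡 4) x₁).symm ∘ chartChange x₀ x₁) y
      = mfderiv (𝓡 4) (𝓡 4) (extChartAt (𝓡 4) x₀).symm y := by
    apply Filter.EventuallyEq.mfderiv_eq
    filter_upwards [(isOpen_chartOverlap x₀ x₁).mem_nhds hy] with z hz
    exact symm_chartChange x₀ x₁ hz
  exact h4.symm.trans h3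

variable [RiemannianBundle (fun x : M => TangentSpace (𝓡 4) x)]

/-- The inner product of the tangent space at `x`, as a function on the model space. -/
def metricForm (x : M) (v w : E4) : ℝ :=
  @inner ℝ (TangentSpace (𝓡 4) x) _ v w

theorem metricMatrix_apply (x₀ : M) (y : E4) (i j : Fin 4) :
    metricMatrix x₀ y i j = metricForm ((extChartAt (𝓡 4) x₀).symm y)
      (chartSymmDeriv x₀ y (EuclideanSpace.single i 1))
      (chartSymmDeriv x₀ y (EuclideanSpace.single j 1)) := rfl

theorem metricForm_sum_sum (x : M) (a b : Fin 4 → ℝ) (V : Fin 4 → E4) :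
    metricForm x (∑ i, a i • V i) (∑ j, b j • V j)
      = ∑ i, ∑ j, a i * b j * metricForm x (V i) (V j) := by
  have h := sum_inner (𝕜 := ℝ) (E := TangentSpace (𝓡 4) x) Finset.univ (fun i => a i • V i)
    (∑ j, b j • V j)
  refine h.trans (Finset.sum_congr rfl fun i _ => ?_)
  have h2 := inner_sum (𝕜 := ℝ) (E := TangentSpace (𝓡 4) x) Finset.univ (fun j => b j • V j)
    (a i • V i)
  refine h2.trans (Finset.sum_congr rfl fun j _ => ?_)
  have h3 := real_inner_smul_left (F := TangentSpace (𝓡 4) x) (V i) (b j • V j) (a i)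
  have h4 := real_inner_smul_right (F := TangentSpace (𝓡 4) x) (V i) (V j) (b j)
  refine h3.trans ((congrArg (a i * ·) h4).trans ?_)
  exact (mul_assoc _ _ _).symm

theorem metricForm_self_pos (x : M) {v : E4} (hv : v ≠ 0) : 0 < metricForm x v v :=
  (real_inner_self_pos (F := TangentSpace (𝓡 4) x)).2 hv

theorem metricMatrix_posDef (x₀ : M) {y : E4} (hy : y ∈ (extChartAt (𝓡 4) x₀).target) :
    (metricMatrix x₀ y).PosDef := by
  refine Matrix.PosDef.of_dotProduct_mulVec_pos ?_ ?_
  · ext i j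
    simp only [Matrix.conjTranspose_apply, star_trivial]
    exact real_inner_comm (F := TangentSpace (𝓡 4) ((extChartAt (𝓡 4) x₀).symm y)) _ _
  · intro a ha
    have e : star a ⬝ᵥ (metricMatrix x₀ y *ᵥ a) = metricForm ((extChartAt (𝓡 4) x₀).symm y)
        (chartSymmDeriv x₀ y (WithLp.toLp 2 a)) (chartSymmDeriv x₀ y (WithLp.toLp 2 a)) := by
      have hv : (WithLp.toLp 2 a : E4) = ∑ i, a i • (EuclideanSpace.single i (1 : ℝ) : E4) := by
        ext k
        simp [Pi.single_apply]
      rw [hv, map_sum]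
      simp only [map_smul]
      rw [metricForm_sum_sum]
      simp only [dotProduct, Matrix.mulVec, star_trivial, Finset.mul_sum, metricMatrix_apply]
      exact Finset.sum_congr rfl fun i _ => Finset.sum_congr rfl fun j _ => by ring
    rw [e]
    have hne : chartSymmDeriv x₀ y (WithLp.toLp 2 a) ≠ 0 := by
      intro h
      have := chartSymmDeriv_injective hy (h.trans (map_zero _).symm)
      exact ha (by simpa using congrArg WithLp.ofLp this)
    exact metricForm_self_pos _ hne

variable [IsContMDiffRiemannianBundle (𝓡 4) ∞ E4 (fun x : M => TangentSpace (𝓡 4) x)]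

theorem metricMatrix_smooth (x₀ : M) : MSmoothOn (metricMatrix x₀) (extChartAt (𝓡 4) x₀).target := by
  have hU := isOpen_extChartAt_target (I := 𝓡 4) x₀
  have hsec : ∀ i : Fin 4, ContMDiffOn (𝓡 4) (𝓡 4).tangent ∞
      (fun y : E4 => (⟨(extChartAt (𝓡 4) x₀).symm y,
        mfderiv (𝓡 4) (𝓡 4) (extChartAt (𝓡 4) x₀).symm y (EuclideanSpace.single i (1 : ℝ))⟩ :
        TangentBundle (𝓡 4) M)) (extChartAt (𝓡 4) x₀).target := by
    intro i
    have h1 : ContMDiffOn (𝓡 4) (𝓡 4).tangent ∞ (fun y : E4 =>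
        (⟨y, EuclideanSpace.single i (1 : ℝ)⟩ : TangentBundle (𝓡 4) E4))
        (extChartAt (𝓡 4) x₀).target :=
      contMDiffOn_vectorSpace_iff_contDiffOn.2 contDiffOn_const
    have h2 := (contMDiffOn_extChartAt_symm (I := 𝓡 4) (n := ∞) x₀).contMDiffOn_tangentMapWithin
      (m := ∞) (by simp) hU.uniqueMDiffOn
    refine (h2.comp h1 fun y hy => hy).congr fun y hy => ?_
    simp only [Function.comp_apply, tangentMapWithin, mfderivWithin_of_isOpen hU hy]
  intro i j
  exact ((hsec i).inner_bundle (hsec j)).contDiffOn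

theorem isMetricOn_metricMatrix (x₀ : M) :
    IsMetricOn (metricMatrix x₀) (extChartAt (𝓡 4) x₀).target :=
  ⟨isOpen_extChartAt_target x₀, metricMatrix_smooth x₀, fun _ hy => metricMatrix_posDef x₀ hy⟩

theorem isCoordChange_chartChange (x₀ x₁ : M) :
    IsCoordChange (chartChange x₀ x₁) (metricMatrix x₀) (chartOverlap x₀ x₁)
      (metricMatrix x₁) (extChartAt (𝓡 4) x₁).target where
  source := (isMetricOn_metricMatrix x₀).mono (isOpen_chartOverlap x₀ x₁) inter_subset_left
  target := isMetricOn_metricMatrix x₁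
  smooth := contDiffOn_chartChange x₀ x₁
  mapsTo := mapsTo_chartChange x₀ x₁
  pullback := by
    intro y hy
    have hd : DifferentiableAt ℝ (chartChange x₀ x₁) y :=
      differentiableAt_of_contDiffOn (isOpen_chartOverlap x₀ x₁) (contDiffOn_chartChange x₀ x₁) hy
    have key : ∀ i, chartSymmDeriv x₀ y (EuclideanSpace.single i 1)
        = ∑ a, jac (chartChange x₀ x₁) y a i •
          chartSymmDeriv x₁ (chartChange x₀ x₁ y) (EuclideanSpace.single a 1) := by
      intro i
      rw [chartSymmDeriv_chartChange hy, ContinuousLinearMap.comp_apply]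
      have hv : fderiv ℝ (chartChange x₀ x₁) y (EuclideanSpace.single i 1)
          = ∑ a, jac (chartChange x₀ x₁) y a i • (EuclideanSpace.single a (1 : ℝ) : E4) := by
        ext k
        have h3 : HasFDerivAt (fun z => chartChange x₀ x₁ z k)
            ((EuclideanSpace.proj k : E4 →L[ℝ] ℝ).comp (fderiv ℝ (chartChange x₀ x₁) y)) y :=
          (EuclideanSpace.proj k : E4 →L[ℝ] ℝ).hasFDerivAt.comp y hd.hasFDerivAt
        have : jac (chartChange x₀ x₁) y k i
            = fderiv ℝ (chartChange x₀ x₁) y (EuclideanSpace.single i 1) k := by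
          simp only [jac, Matrix.of_apply, pd]
          rw [h3.fderiv]
          rfl
        simp [Pi.single_apply, this]
      rw [hv, map_sum]
      simp only [map_smul]
    ext i j
    rw [metricMatrix_apply, key i, key j, metricForm_sum_sum]
    simp only [Matrix.mul_apply, Matrix.transpose_apply, metricMatrix_apply,
      symm_chartChange x₀ x₁ hy, Finset.sum_mul]
    rw [Finset.sum_comm]
    exact Finset.sum_congr rfl fun j _ => Finset.sum_congr rfl fun i _ => by ring

/-! ### Global operators and their expressions in charts -/

/-- The function `⟨∇u, ∇v⟩` on `M`. -/
def gradInner (u v : M → ℝ) (x : M) : ℝ :=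
  ipC (metricMatrix x) (inChart x u) (inChart x v) (extChartAt (𝓡 4) x x)

/-- The first-order part of the weak form of `N` on `M`. -/
def lowerForm (γ₂ γ₃ : ℝ) (u v : M → ℝ) (x : M) : ℝ :=
  lowerC γ₂ γ₃ (metricMatrix x) (inChart x u) (inChart x v) (extChartAt (𝓡 4) x x)

/-- The weak form of `N` on `M`. -/
def weakForm (γ₂ γ₃ : ℝ) (u v : M → ℝ) (x : M) : ℝ :=
  weakC γ₂ γ₃ (metricMatrix x) (inChart x u) (inChart x v) (extChartAt (𝓡 4) x x)

variable {u v w : M → ℝ} {x₀ x : M}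

theorem laplacian_eq (hu : ContMDiff (𝓡 4) 𝓘(ℝ, ℝ) ∞ u) (hx : x ∈ (extChartAt (𝓡 4) x₀).source) :
    laplacian u x = lapC (metricMatrix x₀) (inChart x₀ u) (extChartAt (𝓡 4) x₀ x) := by
  have h := (isCoordChange_chartChange x x₀).lapC_eq (contDiffOn_inChart x₀ hu)
    (fun z hz => inChart_chartChange x x₀ u hz) (mem_chartOverlap (mem_extChartAt_source x) hx)
  rwa [chartChange_apply (mem_extChartAt_source x)] at h

theorem gradInner_eq (hu : ContMDiff (𝓡 4) 𝓘(ℝ, ℝ) ∞ u) (hv : ContMDiff (𝓡 4) 𝓘(ℝ, ℝ) ∞ v)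
    (hx : x ∈ (extChartAt (𝓡 4) x₀).source) :
    gradInner u v x
      = ipC (metricMatrix x₀) (inChart x₀ u) (inChart x₀ v) (extChartAt (𝓡 4) x₀ x) := by
  have h := (isCoordChange_chartChange x x₀).ipC_eq (contDiffOn_inChart x₀ hu)
    (fun z hz => inChart_chartChange x x₀ u hz) (contDiffOn_inChart x₀ hv)
    (fun z hz => inChart_chartChange x x₀ v hz) (mem_chartOverlap (mem_extChartAt_source x) hx)
  rwa [chartChange_apply (mem_extChartAt_source x)] at h

theorem gradSq_eq_gradInner (u : M → ℝ) (x : M) : gradSq u x = gradInner u u x := rfl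

theorem lowerForm_eq (γ₂ γ₃ : ℝ) (hu : ContMDiff (𝓡 4) 𝓘(ℝ, ℝ) ∞ u)
    (hv : ContMDiff (𝓡 4) 𝓘(ℝ, ℝ) ∞ v) (hx : x ∈ (extChartAt (𝓡 4) x₀).source) :
    lowerForm γ₂ γ₃ u v x
      = lowerC γ₂ γ₃ (metricMatrix x₀) (inChart x₀ u) (inChart x₀ v) (extChartAt (𝓡 4) x₀ x) := by
  have h := (isCoordChange_chartChange x x₀).lowerC_eq γ₂ γ₃ (contDiffOn_inChart x₀ hu)
    (fun z hz => inChart_chartChange x x₀ u hz) (contDiffOn_inChart x₀ hv)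
    (fun z hz => inChart_chartChange x x₀ v hz) (mem_chartOverlap (mem_extChartAt_source x) hx)
  rwa [chartChange_apply (mem_extChartAt_source x)] at h

theorem weakForm_eq (γ₂ γ₃ : ℝ) (hu : ContMDiff (𝓡 4) 𝓘(ℝ, ℝ) ∞ u)
    (hv : ContMDiff (𝓡 4) 𝓘(ℝ, ℝ) ∞ v) (hx : x ∈ (extChartAt (𝓡 4) x₀).source) :
    weakForm γ₂ γ₃ u v x
      = weakC γ₂ γ₃ (metricMatrix x₀) (inChart x₀ u) (inChart x₀ v) (extChartAt (𝓡 4) x₀ x) := by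
  have h := (isCoordChange_chartChange x x₀).weakC_eq γ₂ γ₃ (contDiffOn_inChart x₀ hu)
    (fun z hz => inChart_chartChange x x₀ u hz) (contDiffOn_inChart x₀ hv)
    (fun z hz => inChart_chartChange x x₀ v hz) (mem_chartOverlap (mem_extChartAt_source x) hx)
  rwa [chartChange_apply (mem_extChartAt_source x)] at h

theorem opN_eq (γ₂ γ₃ : ℝ) (hu : ContMDiff (𝓡 4) 𝓘(ℝ, ℝ) ∞ u)
    (hx : x ∈ (extChartAt (𝓡 4) x₀).source) :
    opN γ₂ γ₃ u x
      = opNC γ₂ γ₃ (metricMatrix x₀) (inChart x₀ u) (extChartAt (𝓡 4) x₀ x) := by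
  have h := (isCoordChange_chartChange x x₀).opNC_eq γ₂ γ₃ (contDiffOn_inChart x₀ hu)
    (fun z hz => inChart_chartChange x x₀ u hz) (mem_chartOverlap (mem_extChartAt_source x) hx)
  rwa [chartChange_apply (mem_extChartAt_source x)] at h

theorem continuous_of_chart {F : M → ℝ} {f : M → E4 → ℝ}
    (hf : ∀ x₀, ContDiffOn ℝ ∞ (f x₀) (extChartAt (𝓡 4) x₀).target)
    (h : ∀ x₀, ∀ x ∈ (extChartAt (𝓡 4) x₀).source, F x = f x₀ (extChartAt (𝓡 4) x₀ x)) :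
    Continuous F := by
  refine continuous_iff_continuousAt.2 fun x => ?_
  have h1 : ContinuousAt (fun z => f x (extChartAt (𝓡 4) x z)) x :=
    ((hf x).contDiffAt (extChartAt_target_mem_nhds x)).continuousAt.comp
      (continuousAt_extChartAt x)
  refine h1.congr ?_
  filter_upwards [extChartAt_source_mem_nhds (I := 𝓡 4) x] with z hz using (h x z hz).symm

theorem continuous_laplacian (hu : ContMDiff (𝓡 4) 𝓘(ℝ, ℝ) ∞ u) : Continuous (laplacian u) :=
  continuous_of_chart (fun x₀ => (isMetricOn_metricMatrix x₀).lapC_smooth (contDiffOn_inChart x₀ hu))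
    fun _ _ hx => laplacian_eq hu hx

theorem continuous_gradInner (hu : ContMDiff (𝓡 4) 𝓘(ℝ, ℝ) ∞ u)
    (hv : ContMDiff (𝓡 4) 𝓘(ℝ, ℝ) ∞ v) : Continuous (gradInner u v) :=
  continuous_of_chart (fun x₀ => (isMetricOn_metricMatrix x₀).ipC_smooth
    (contDiffOn_inChart x₀ hu) (contDiffOn_inChart x₀ hv)) fun _ _ hx => gradInner_eq hu hv hx

theorem continuous_gradSq (hu : ContMDiff (𝓡 4) 𝓘(ℝ, ℝ) ∞ u) : Continuous (gradSq u) :=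
  continuous_gradInner hu hu

theorem continuous_weakForm (γ₂ γ₃ : ℝ) (hu : ContMDiff (𝓡 4) 𝓘(ℝ, ℝ) ∞ u)
    (hv : ContMDiff (𝓡 4) 𝓘(ℝ, ℝ) ∞ v) : Continuous (weakForm γ₂ γ₃ u v) :=
  continuous_of_chart (fun x₀ => (isMetricOn_metricMatrix x₀).weakC_smooth γ₂ γ₃
    (contDiffOn_inChart x₀ hu) (contDiffOn_inChart x₀ hv)) fun _ _ hx => weakForm_eq γ₂ γ₃ hu hv hx

theorem continuous_opN (γ₂ γ₃ : ℝ) (hu : ContMDiff (𝓡 4) 𝓘(ℝ, ℝ) ∞ u) :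
    Continuous (opN γ₂ γ₃ u) :=
  continuous_of_chart (fun x₀ => (isMetricOn_metricMatrix x₀).opNC_smooth γ₂ γ₃
    (contDiffOn_inChart x₀ hu)) fun _ _ hx => opN_eq γ₂ γ₃ hu hx

end Charts

/-! ### The Riemannian volume measure -/

theorem det_fderiv_eq_det_jac {T : E4 → E4} {y : E4} (hT : DifferentiableAt ℝ T y) :
    (fderiv ℝ T y).det = (jac T y).det := by
  have e : jac T y = LinearMap.toMatrix (EuclideanSpace.basisFun (Fin 4) ℝ).toBasis
      (EuclideanSpace.basisFun (Fin 4) ℝ).toBasis (fderiv ℝ T y : E4 →ₗ[ℝ] E4) := by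
    ext a i
    have h3 : HasFDerivAt (fun z => T z a)
        ((EuclideanSpace.proj a : E4 →L[ℝ] ℝ).comp (fderiv ℝ T y)) y :=
      (EuclideanSpace.proj a : E4 →L[ℝ] ℝ).hasFDerivAt.comp y hT.hasFDerivAt
    rw [LinearMap.toMatrix_apply]
    simp only [jac, Matrix.of_apply, pd]
    rw [h3.fderiv]
    simp
  rw [e, LinearMap.det_toMatrix]

section Volume

variable {M : Type*} [EMetricSpace M] [ChartedSpace E4 M] [IsManifold (𝓡 4) ∞ M]
  [RiemannianBundle (fun x : M => TangentSpace (𝓡 4) x)]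
  [IsContMDiffRiemannianBundle (𝓡 4) ∞ E4 (fun x : M => TangentSpace (𝓡 4) x)]
  [MeasurableSpace M] [BorelSpace M]

theorem aemeasurable_chart_symm (x₀ : M) : AEMeasurable (extChartAt (𝓡 4) x₀).symm
    (((volume : Measure E4).restrict (extChartAt (𝓡 4) x₀).target).withDensity
    (fun y => ENNReal.ofReal (Real.sqrt (metricMatrix x₀ y).det))) :=
  ((continuousOn_extChartAt_symm x₀).aemeasurable
    (isOpen_extChartAt_target x₀).measurableSet).mono_ac (withDensity_absolutelyContinuous _ _)

theorem measurableSet_chart_preimage (x₀ : M) {S : Set M} (hS : MeasurableSet S) :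
    MeasurableSet ((extChartAt (𝓡 4) x₀).target ∩ (extChartAt (𝓡 4) x₀).symm ⁻¹' S) := by
  have ht := (isOpen_extChartAt_target (I := 𝓡 4) x₀).measurableSet
  have h := ((continuousOn_extChartAt_symm (I := 𝓡 4) x₀).domRestrict.measurable hS)
  convert ht.subtype_image h using 1
  ext y
  simp [domRestrict_apply, and_comm]

theorem chartVolume_apply (x₀ : M) {S : Set M} (hS : MeasurableSet S) :
    chartVolume x₀ S = ∫⁻ y in (extChartAt (𝓡 4) x₀).target ∩ (extChartAt (𝓡 4) x₀).symm ⁻¹' S,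
      ENNReal.ofReal (Real.sqrt (metricMatrix x₀ y).det) := by
  have ht := (isOpen_extChartAt_target (I := 𝓡 4) x₀).measurableSet
  have hm := measurableSet_chart_preimage x₀ hS
  unfold chartVolume
  rw [Measure.map_apply_of_aemeasurable (aemeasurable_chart_symm x₀) hS]
  have hnull : (((volume : Measure E4).restrict (extChartAt (𝓡 4) x₀).target).withDensity
      (fun y => ENNReal.ofReal (Real.sqrt (metricMatrix x₀ y).det)))
      ((extChartAt (𝓡 4) x₀).target)ᶜ = 0 := by
    refine withDensity_absolutelyContinuous _ _ ?_
    rw [Measure.restrict_apply ht.compl, compl_inter_self, measure_empty]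
  rw [← measure_inter_add_sdiff _ ht, inter_comm, measure_mono_null
    (sdiff_subset_compl _ _) hnull, add_zero, withDensity_apply _ hm,
    Measure.restrict_restrict hm, inter_assoc, inter_comm, inter_assoc, inter_self, inter_comm]

theorem chartVolume_compl (x₀ : M) : chartVolume x₀ ((extChartAt (𝓡 4) x₀).source)ᶜ = 0 := by
  rw [chartVolume_apply x₀ (isOpen_extChartAt_source x₀).measurableSet.compl]
  have : (extChartAt (𝓡 4) x₀).target ∩
      (extChartAt (𝓡 4) x₀).symm ⁻¹' ((extChartAt (𝓡 4) x₀).source)ᶜ = ∅ := by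
    ext y
    simp only [mem_inter_iff, mem_preimage, mem_compl_iff, mem_empty_iff_false, iff_false, not_and,
      not_not]
    exact fun hy => (extChartAt (𝓡 4) x₀).map_target hy
  rw [this]
  simp

/-- The volume measures of two charts agree on the intersection of their domains. -/
theorem chartVolume_eq (x₀ x₁ : M) {S : Set M} (hS : MeasurableSet S)
    (h₀ : S ⊆ (extChartAt (𝓡 4) x₀).source) (h₁ : S ⊆ (extChartAt (𝓡 4) x₁).source) :
    chartVolume x₀ S = chartVolume x₁ S := by
  rw [chartVolume_apply x₀ hS, chartVolume_apply x₁ hS]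
  set s := (extChartAt (𝓡 4) x₀).target ∩ (extChartAt (𝓡 4) x₀).symm ⁻¹' S with hs
  have hsO : s ⊆ chartOverlap x₀ x₁ := fun y hy => ⟨hy.1, h₁ hy.2⟩
  have himg : (extChartAt (𝓡 4) x₁).target ∩ (extChartAt (𝓡 4) x₁).symm ⁻¹' S
      = chartChange x₀ x₁ '' s := by
    ext z
    constructor
    · rintro ⟨hz, hzS⟩
      refine ⟨extChartAt (𝓡 4) x₀ ((extChartAt (𝓡 4) x₁).symm z),
        ⟨(extChartAt (𝓡 4) x₀).map_source (h₀ hzS), ?_⟩, ?_⟩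
      · rwa [mem_preimage, (extChartAt (𝓡 4) x₀).left_inv (h₀ hzS)]
      · rw [chartChange_apply (h₀ hzS), (extChartAt (𝓡 4) x₁).right_inv hz]
    · rintro ⟨y, hy, rfl⟩
      refine ⟨mapsTo_chartChange x₀ x₁ (hsO hy), ?_⟩
      rw [mem_preimage, symm_chartChange x₀ x₁ (hsO hy)]
      exact hy.2
  have hd : ∀ y ∈ s, DifferentiableAt ℝ (chartChange x₀ x₁) y := fun y hy =>
    differentiableAt_of_contDiffOn (isOpen_chartOverlap x₀ x₁) (contDiffOn_chartChange x₀ x₁)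
      (hsO hy)
  have hinj : InjOn (chartChange x₀ x₁) s := by
    intro y hy z hz hyz
    have e := congrArg (extChartAt (𝓡 4) x₁).symm hyz
    rw [symm_chartChange x₀ x₁ (hsO hy), symm_chartChange x₀ x₁ (hsO hz)] at e
    exact (extChartAt (𝓡 4) x₀).symm.injOn hy.1 hz.1 e
  rw [himg, lintegral_image_eq_lintegral_abs_det_fderiv_mul volume
    (measurableSet_chart_preimage x₀ hS) (fun y hy => (hd y hy).hasFDerivAt.hasFDerivWithinAt) hinj]
  refine setLIntegral_congr_fun (measurableSet_chart_preimage x₀ hS) fun y hy => ?_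
  have hc := isCoordChange_chartChange x₀ x₁
  rw [det_fderiv_eq_det_jac (hd y hy), ← ENNReal.ofReal_mul (abs_nonneg _),
    hc.pullback y (hsO hy), Matrix.det_mul, Matrix.det_mul, Matrix.det_transpose]
  congr 1
  rw [← Real.sqrt_sq_eq_abs, ← Real.sqrt_mul (sq_nonneg _)]
  congr 1
  ring

theorem chartVolume_le_riemVolume (x₀ : M) : chartVolume x₀ ≤ riemVolume M :=
  le_iSup (fun x₀ : M => chartVolume x₀) x₀

/-- The Riemannian volume is given by the density `(det g)^{1/2}` in every chart. -/
theorem riemVolume_eq_chartVolume (x₀ : M) {S : Set M} (hS : MeasurableSet S)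
    (h₀ : S ⊆ (extChartAt (𝓡 4) x₀).source) : riemVolume M S = chartVolume x₀ S := by
  have hsrc := (isOpen_extChartAt_source (I := 𝓡 4) x₀).measurableSet
  refine le_antisymm ?_ (chartVolume_le_riemVolume x₀ S)
  -- outside the domain of the chart, the measure itself serves as an upper bound
  have hle : riemVolume M
      ≤ chartVolume x₀ + (riemVolume M).restrict ((extChartAt (𝓡 4) x₀).source)ᶜ := by
    refine iSup_le fun x₁ => Measure.le_iff.2 fun A hA => ?_
    have hsrc₁ := (isOpen_extChartAt_source (I := 𝓡 4) x₁).measurableSet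
    rw [Measure.add_apply, Measure.restrict_apply hA, ← measure_inter_add_sdiff A hsrc]
    refine add_le_add ?_ (by rw [sdiff_eq]; exact chartVolume_le_riemVolume x₁ _)
    rw [← measure_inter_add_sdiff (A ∩ (extChartAt (𝓡 4) x₀).source) hsrc₁,
      measure_mono_null (sdiff_subset_compl _ _) (chartVolume_compl x₁), add_zero,
      chartVolume_eq x₁ x₀ ((hA.inter hsrc).inter hsrc₁) inter_subset_right
        (inter_subset_left.trans inter_subset_right)]
    exact measure_mono (inter_subset_left.trans inter_subset_left)
  refine (hle S).trans ?_
  rw [Measure.add_apply, Measure.restrict_apply hS, disjoint_iff_inter_eq_empty.1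
    (disjoint_compl_right_iff_subset.2 h₀), measure_empty, add_zero]

theorem riemVolume_restrict_source (x₀ : M) :
    (riemVolume M).restrict (extChartAt (𝓡 4) x₀).source = chartVolume x₀ := by
  have hsrc := (isOpen_extChartAt_source (I := 𝓡 4) x₀).measurableSet
  ext S hS
  rw [Measure.restrict_apply hS, riemVolume_eq_chartVolume x₀ (hS.inter hsrc) inter_subset_right]
  conv_rhs => rw [← measure_inter_add_sdiff S hsrc,
    measure_mono_null (sdiff_subset_compl _ _) (chartVolume_compl x₀), add_zero]

/-- Integration of a function supported in the domain of a chart. -/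
theorem integral_riemVolume_eq (x₀ : M) {F : M → ℝ} (hF : Continuous F)
    (h0 : ∀ x ∉ (extChartAt (𝓡 4) x₀).source, F x = 0) :
    ∫ x, F x ∂(riemVolume M) = ∫ y in (extChartAt (𝓡 4) x₀).target,
      F ((extChartAt (𝓡 4) x₀).symm y) * Real.sqrt (metricMatrix x₀ y).det := by
  have ht := (isOpen_extChartAt_target (I := 𝓡 4) x₀).measurableSet
  rw [← setIntegral_eq_integral_of_forall_compl_eq_zero h0, riemVolume_restrict_source]
  unfold chartVolume
  rw [integral_map (aemeasurable_chart_symm x₀) hF.aestronglyMeasurable,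
    integral_withDensity_eq_integral_toReal_smul₀]
  · refine integral_congr_ae (Filter.Eventually.of_forall fun y => ?_)
    simp only [ENNReal.toReal_ofReal (Real.sqrt_nonneg _), smul_eq_mul, mul_comm]
  · exact ((isMetricOn_metricMatrix x₀).sqrt_det_smooth.continuousOn.aemeasurable ht).ennreal_ofReal
  · exact Filter.Eventually.of_forall fun y => ENNReal.ofReal_lt_top

theorem isLocallyFiniteMeasure_riemVolume : IsLocallyFiniteMeasure (riemVolume M) := by
  refine ⟨fun x => ?_⟩
  obtain ⟨R, hR, hRt⟩ := Metric.nhds_basis_closedBall.mem_iff.1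
    (extChartAt_target_mem_nhds (I := 𝓡 4) x)
  let V := (extChartAt (𝓡 4) x).source ∩ extChartAt (𝓡 4) x ⁻¹'
    Metric.ball (extChartAt (𝓡 4) x x) R
  have hV : IsOpen V := isOpen_extChartAt_preimage' x Metric.isOpen_ball
  refine ⟨V, hV.mem_nhds ⟨mem_extChartAt_source x, Metric.mem_ball_self hR⟩, ?_⟩
  rw [riemVolume_eq_chartVolume x hV.measurableSet inter_subset_left,
    chartVolume_apply x hV.measurableSet]
  have hsub : (extChartAt (𝓡 4) x).target ∩ (extChartAt (𝓡 4) x).symm ⁻¹' V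
      ⊆ Metric.closedBall (extChartAt (𝓡 4) x x) R := by
    rintro y ⟨hy, -, hyR⟩
    rw [mem_preimage, (extChartAt (𝓡 4) x).right_inv hy] at hyR
    exact Metric.ball_subset_closedBall hyR
  refine (lintegral_mono_set hsub).trans_lt ?_
  have hi : IntegrableOn (fun y => Real.sqrt (metricMatrix x y).det)
      (Metric.closedBall (extChartAt (𝓡 4) x x) R) :=
    ((isMetricOn_metricMatrix x).sqrt_det_smooth.continuousOn.mono hRt).integrableOn_compact
      (isCompact_closedBall _ _)
  exact hi.lintegral_lt_top

theorem isFiniteMeasure_riemVolume [CompactSpace M] : IsFiniteMeasure (riemVolume M) := by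
  have := isLocallyFiniteMeasure_riemVolume (M := M)
  exact ⟨isCompact_univ.measure_lt_top⟩

end Volume

/-! ### The weak form of the equation on the manifold -/

section Weak

variable {M : Type*} [EMetricSpace M] [CompactSpace M] [ChartedSpace E4 M] [IsManifold (𝓡 4) ∞ M]

/-- A finite smooth partition of unity subordinate to a family of open neighbourhoods of the
points of a compact manifold. -/
theorem exists_finite_partition (V : M → Set M) (hV : ∀ x, IsOpen (V x)) (hxV : ∀ x, x ∈ V x) :
    ∃ (t : Finset M) (ζ : M → M → ℝ), (∀ i, ContMDiff (𝓡 4) 𝓘(ℝ, ℝ) ∞ (ζ i)) ∧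
      (∀ i x, 0 ≤ ζ i x) ∧ (∀ x, ∑ i ∈ t, ζ i x = 1) ∧ ∀ i, tsupport (ζ i) ⊆ V i := by
  obtain ⟨f, hf⟩ := SmoothPartitionOfUnity.exists_isSubordinate (𝓡 4) isClosed_univ V hV
    (fun x _ => mem_iUnion.2 ⟨x, hxV x⟩)
  have hfin : {i | (Function.support (f i)).Nonempty}.Finite :=
    f.locallyFinite.finite_nonempty_of_compact
  refine ⟨hfin.toFinset, fun i => f i, fun i => (f i).contMDiff, fun i x => f.nonneg i x,
    fun x => ?_, hf⟩
  rw [← f.sum_eq_one (mem_univ x)]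
  refine (finsum_eq_sum_of_support_subset _ fun i hi => ?_).symm
  simp only [Finite.coe_toFinset, mem_ofPred_eq]
  exact ⟨x, hi⟩

variable [RiemannianBundle (fun x : M => TangentSpace (𝓡 4) x)]
  [IsContMDiffRiemannianBundle (𝓡 4) ∞ E4 (fun x : M => TangentSpace (𝓡 4) x)]

theorem pd_inChart_sum (x : M) (t : Finset M) {φ : M → M → ℝ} {Φ : M → ℝ}
    (hφ : ∀ i, ContMDiff (𝓡 4) 𝓘(ℝ, ℝ) ∞ (φ i)) (hΦ : ∀ z, Φ z = ∑ i ∈ t, φ i z) {y : E4}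
    (hy : y ∈ (extChartAt (𝓡 4) x).target) (a : Fin 4) :
    pd a (inChart x Φ) y = ∑ i ∈ t, pd a (inChart x (φ i)) y := by
  have e : inChart x Φ = fun z => ∑ i ∈ t, inChart x (φ i) z := by
    funext z
    exact hΦ _
  rw [e, pd_sum fun i _ => differentiableAt_of_contDiffOn (isOpen_extChartAt_target x)
    (contDiffOn_inChart x (hφ i)) hy]

theorem laplacian_sum (t : Finset M) {φ : M → M → ℝ} {Φ : M → ℝ}
    (hφ : ∀ i, ContMDiff (𝓡 4) 𝓘(ℝ, ℝ) ∞ (φ i)) (hΦ : ∀ z, Φ z = ∑ i ∈ t, φ i z) (x : M) :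
    laplacian Φ x = ∑ i ∈ t, laplacian (φ i) x := by
  have hG := isMetricOn_metricMatrix x
  have hy := mem_extChartAt_target (I := 𝓡 4) x
  have hg : ∀ z ∈ (extChartAt (𝓡 4) x).target, gradC (metricMatrix x) (inChart x Φ) z
      = fun a => ∑ i ∈ t, gradC (metricMatrix x) (inChart x (φ i)) z a := by
    intro z hz
    funext a
    simp only [gradC, pd_inChart_sum x t hφ hΦ hz, Finset.mul_sum]
    rw [Finset.sum_comm]
  unfold laplacian lapC
  rw [hG.divC_congr hg hy, hG.divC_eq (fun a => ContDiffOn.sum fun i _ =>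
    hG.gradC_smooth (contDiffOn_inChart x (hφ i)) a) hy]
  have e : ∀ i, divC (metricMatrix x) (gradC (metricMatrix x) (inChart x (φ i)))
      (extChartAt (𝓡 4) x x) = _ := fun i =>
    hG.divC_eq (hG.gradC_smooth (contDiffOn_inChart x (hφ i))) hy
  simp only [e]
  rw [Finset.sum_comm]
  refine Finset.sum_congr rfl fun a _ => ?_
  rw [pd_sum fun i _ => differentiableAt_of_contDiffOn hG.isOpen
    (hG.gradC_smooth (contDiffOn_inChart x (hφ i)) a) hy, Finset.mul_sum, Finset.sum_add_distrib]

theorem gradInner_sum (w : M → ℝ) (t : Finset M) {φ : M → M → ℝ} {Φ : M → ℝ}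
    (hφ : ∀ i, ContMDiff (𝓡 4) 𝓘(ℝ, ℝ) ∞ (φ i)) (hΦ : ∀ z, Φ z = ∑ i ∈ t, φ i z) (x : M) :
    gradInner w Φ x = ∑ i ∈ t, gradInner w (φ i) x := by
  have hy := mem_extChartAt_target (I := 𝓡 4) x
  simp only [gradInner, ipC, pd_inChart_sum x t hφ hΦ hy, Finset.mul_sum]
  rw [Finset.sum_comm (s := t)]
  exact Finset.sum_congr rfl fun a _ => Finset.sum_comm

theorem weakForm_sum (γ₂ γ₃ : ℝ) (w : M → ℝ) (t : Finset M) {φ : M → M → ℝ} {Φ : M → ℝ}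
    (hφ : ∀ i, ContMDiff (𝓡 4) 𝓘(ℝ, ℝ) ∞ (φ i)) (hΦ : ∀ z, Φ z = ∑ i ∈ t, φ i z) (x : M) :
    weakForm γ₂ γ₃ w Φ x = ∑ i ∈ t, weakForm γ₂ γ₃ w (φ i) x := by
  have hy := mem_extChartAt_target (I := 𝓡 4) x
  have hl := laplacian_sum t hφ hΦ x
  have hi := gradInner_sum w t hφ hΦ x
  unfold gradInner at hi
  have hr : ricFormC (metricMatrix x) (inChart x w) (inChart x Φ) (extChartAt (𝓡 4) x x)
      = ∑ i ∈ t, ricFormC (metricMatrix x) (inChart x w) (inChart x (φ i))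
        (extChartAt (𝓡 4) x x) := by
    simp only [ricFormC, pd_inChart_sum x t hφ hΦ hy, Finset.mul_sum]
    rw [Finset.sum_comm]
  unfold laplacian at hl
  unfold weakForm weakC lowerC
  rw [hl, hi, hr]
  simp only [Finset.mul_sum, Finset.sum_add_distrib, Finset.sum_sub_distrib, mul_sub]

variable [MeasurableSpace M] [BorelSpace M]

/-- Integration by parts against a function supported in the domain of a chart. -/
theorem integral_opN_mul_of_tsupport (γ₂ γ₃ : ℝ) {w φ : M → ℝ} (x₀ : M)
    (hw : ContMDiff (𝓡 4) 𝓘(ℝ, ℝ) ∞ w) (hφ : ContMDiff (𝓡 4) 𝓘(ℝ, ℝ) ∞ φ)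
    (hs : tsupport φ ⊆ (extChartAt (𝓡 4) x₀).source) :
    ∫ x, opN γ₂ γ₃ w x * φ x ∂(riemVolume M) = ∫ x, weakForm γ₂ γ₃ w φ x ∂(riemVolume M) := by
  have hG := isMetricOn_metricMatrix x₀
  have hwc := contDiffOn_inChart x₀ hw
  have hφc := contDiffOn_inChart x₀ hφ
  set K := extChartAt (𝓡 4) x₀ '' tsupport φ with hKdef
  have hK : IsCompact K :=
    (isClosed_tsupport φ).isCompact.image_of_continuousOn ((continuousOn_extChartAt x₀).mono hs)
  have hKU : K ⊆ (extChartAt (𝓡 4) x₀).target := by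
    rintro _ ⟨x, hx, rfl⟩
    exact (extChartAt (𝓡 4) x₀).map_source (hs hx)
  have h0 : ∀ y ∈ (extChartAt (𝓡 4) x₀).target \ K, inChart x₀ φ y = 0 := by
    rintro y ⟨hy, hyK⟩
    by_contra hne
    refine hyK ⟨(extChartAt (𝓡 4) x₀).symm y, subset_tsupport _ hne, ?_⟩
    exact (extChartAt (𝓡 4) x₀).right_inv hy
  have key := hG.integral_opNC_mul hK hKU γ₂ γ₃ hwc hφc h0
  rw [integral_riemVolume_eq x₀ (F := fun x => opN γ₂ γ₃ w x * φ x) ((continuous_opN γ₂ γ₃ hw).mul hφ.continuous),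
    integral_riemVolume_eq x₀ (continuous_weakForm γ₂ γ₃ hw hφ)]
  · refine Eq.trans ?_ (key.trans ?_)
    · refine setIntegral_congr_fun hG.isOpen.measurableSet fun y hy => ?_
      have := opN_eq γ₂ γ₃ hw ((extChartAt (𝓡 4) x₀).map_target hy)
      simp only [this, (extChartAt (𝓡 4) x₀).right_inv hy]
      rfl
    · refine setIntegral_congr_fun hG.isOpen.measurableSet fun y hy => ?_
      have := weakForm_eq γ₂ γ₃ hw hφ ((extChartAt (𝓡 4) x₀).map_target hy)
      simp only [this, (extChartAt (𝓡 4) x₀).right_inv hy]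
  · -- the weak form vanishes outside the support of the test function
    intro x hx
    have hx' : x ∉ tsupport φ := fun h => hx (hs h)
    have hz : ∀ y ∈ (extChartAt (𝓡 4) x).target ∩
        (extChartAt (𝓡 4) x).symm ⁻¹' (tsupport φ)ᶜ, inChart x φ y = 0 := by
      intro y hy
      exact image_eq_zero_of_notMem_tsupport (f := φ) hy.2
    have ho : IsOpen ((extChartAt (𝓡 4) x).target ∩
        (extChartAt (𝓡 4) x).symm ⁻¹' (tsupport φ)ᶜ) :=
      (continuousOn_extChartAt_symm x).isOpen_inter_preimage (isOpen_extChartAt_target x)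
        (isClosed_tsupport φ).isOpen_compl
    have hm := (isMetricOn_metricMatrix x).mono ho inter_subset_left
    refine hm.weakC_vanish isCompact_empty γ₂ γ₃ (fun y hy => hz y hy.1) _ ⟨⟨?_, ?_⟩, by simp⟩
    · exact mem_extChartAt_target x
    · rwa [mem_preimage, extChartAt_to_inv]
  · intro x hx
    have hx' : x ∉ tsupport φ := fun h => hx (hs h)
    rw [image_eq_zero_of_notMem_tsupport hx', mul_zero]

/-- The weak form of the operator `N` on a compact manifold. -/
theorem integral_opN_mul (γ₂ γ₃ : ℝ) {w φ : M → ℝ}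
    (hw : ContMDiff (𝓡 4) 𝓘(ℝ, ℝ) ∞ w) (hφ : ContMDiff (𝓡 4) 𝓘(ℝ, ℝ) ∞ φ) :
    ∫ x, opN γ₂ γ₃ w x * φ x ∂(riemVolume M) = ∫ x, weakForm γ₂ γ₃ w φ x ∂(riemVolume M) := by
  have := isFiniteMeasure_riemVolume (M := M)
  obtain ⟨t, ζ, hζ, -, hζ1, hζs⟩ := exists_finite_partition
    (fun x : M => (extChartAt (𝓡 4) x).source) (fun x => isOpen_extChartAt_source x)
    (fun x => mem_extChartAt_source x)
  have hsm : ∀ i, ContMDiff (𝓡 4) 𝓘(ℝ, ℝ) ∞ (fun z => ζ i z * φ z) := fun i => (hζ i).mul hφ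
  have hsum : ∀ z, φ z = ∑ i ∈ t, ζ i z * φ z := fun z => by
    rw [← Finset.sum_mul, hζ1, one_mul]
  have hcint : ∀ F : M → ℝ, Continuous F → Integrable F (riemVolume M) := fun F hF =>
    hF.integrable_of_hasCompactSupport (HasCompactSupport.of_compactSpace F)
  have e1 : ∀ x, opN γ₂ γ₃ w x * φ x = ∑ i ∈ t, opN γ₂ γ₃ w x * (ζ i x * φ x) := by
    intro x
    rw [← Finset.mul_sum, ← hsum x]
  simp only [e1, weakForm_sum γ₂ γ₃ w t hsm hsum]
  rw [integral_finsetSum, integral_finsetSum]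
  · refine Finset.sum_congr rfl fun i _ => integral_opN_mul_of_tsupport γ₂ γ₃ i hw (hsm i) ?_
    exact (tsupport_mul_subset_left).trans (hζs i)
  · exact fun i _ => hcint _ (continuous_weakForm γ₂ γ₃ hw (hsm i))
  · exact fun i _ => hcint _ ((continuous_opN γ₂ γ₃ hw).mul (hsm i).continuous)

end Weak

/-! ### Mollified indicator functions -/

/-- The convolution of the indicator function of `B` with `g`. -/
def indicatorConv (B : Set E4) (g : E4 → ℝ) : E4 → ℝ :=
  convolution (B.indicator fun _ => (1 : ℝ)) g (ContinuousLinearMap.mul ℝ ℝ) volume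

section Mollifier

variable {B : Set E4} {g : E4 → ℝ}

theorem locallyIntegrable_indicator_one (hB : MeasurableSet B) :
    LocallyIntegrable (B.indicator fun _ => (1 : ℝ)) (volume : Measure E4) :=
  (locallyIntegrable_const (1 : ℝ)).indicator hB

theorem indicatorConv_apply (B : Set E4) (g : E4 → ℝ) (s : E4) :
    indicatorConv B g s = ∫ t, B.indicator (fun _ => (1 : ℝ)) t * g (s - t) := rfl

theorem abs_indicatorConv_le (hg : Integrable g) (s : E4) :
    |indicatorConv B g s| ≤ ∫ t, |g t| := by
  rw [indicatorConv_apply, ← integral_sub_left_eq_self (fun t => |g t|) volume s]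
  have hi : Integrable (fun t => |g (s - t)|) := (hg.comp_sub_left s).abs
  rw [← Real.norm_eq_abs]
  refine norm_integral_le_of_norm_le hi (Filter.Eventually.of_forall fun t => ?_)
  by_cases ht : t ∈ B
  · simp [indicator_of_mem ht]
  · simp [indicator_of_notMem ht]

theorem contDiff_indicatorConv (hB : MeasurableSet B) (hg : ContDiff ℝ ∞ g)
    (hc : HasCompactSupport g) : ContDiff ℝ ∞ (indicatorConv B g) :=
  hc.contDiff_convolution_right _ (locallyIntegrable_indicator_one hB) hg

theorem pd_indicatorConv (hB : MeasurableSet B) (hg : ContDiff ℝ ∞ g)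
    (hc : HasCompactSupport g) (i : Fin 4) :
    pd i (indicatorConv B g) = indicatorConv B (pd i g) := by
  funext s
  have hd := hc.hasFDerivAt_convolution_right (ContinuousLinearMap.mul ℝ ℝ)
    (locallyIntegrable_indicator_one hB) (hg.of_le (by simp)) s
  have hex := (hc.fderiv ℝ).convolutionExists_right
    ((ContinuousLinearMap.mul ℝ ℝ).precompR E4) (locallyIntegrable_indicator_one hB)
    (hg.continuous_fderiv (by simp)) s
  unfold pd indicatorConv
  rw [hd.fderiv, convolution, ContinuousLinearMap.integral_apply hex]
  rfl

/-- Mollification of an indicator function at the scale `ε`. The bounds of the derivatives do not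
depend on the set. -/
theorem exists_mollified_indicator : ∃ C : ℝ, 0 ≤ C ∧ ∀ A : Set E4, MeasurableSet A →
    ∀ ε : ℝ, 0 < ε → ∃ u : E4 → ℝ, ContDiff ℝ ∞ u ∧ (∀ y, 0 ≤ u y ∧ u y ≤ 1) ∧
      (∀ y, Metric.ball y ε ⊆ A → u y = 1) ∧ (∀ y, Disjoint (Metric.ball y ε) A → u y = 0) ∧
      (∀ y i, |pd i u y| ≤ C / ε) ∧ ∀ y i j, |pd i (pd j u) y| ≤ C / ε ^ 2 := by
  let b : ContDiffBump (0 : E4) := ⟨1 / 2, 1, by norm_num, by norm_num⟩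
  set η : E4 → ℝ := b.normed volume with hη
  have hηs : ContDiff ℝ ∞ η := b.contDiff_normed
  have hηc : HasCompactSupport η := b.hasCompactSupport_normed
  have hη0 : ∀ t, 0 ≤ η t := fun t => b.nonneg_normed t
  have hη1 : ∫ t, η t = 1 := b.integral_normed
  have hηsupp : ∀ t, t ∉ Metric.ball (0 : E4) 1 → η t = 0 := by
    intro t ht
    by_contra hne
    have : t ∈ Function.support η := hne
    rw [hη, b.support_normed_eq] at this
    exact ht this
  have hηi : Integrable η := hηs.continuous.integrable_of_hasCompactSupport hηc
  have hpds : ∀ g : E4 → ℝ, ContDiff ℝ ∞ g → ∀ i, ContDiff ℝ ∞ (pd i g) := fun g hg i =>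
    contDiffOn_univ.1 (contDiffOn_pd isOpen_univ (contDiffOn_univ.2 hg) i)
  have hpdc : ∀ g : E4 → ℝ, HasCompactSupport g → ∀ i, HasCompactSupport (pd i g) :=
    fun g hg i => hg.fderiv_apply ℝ _
  have hpdi : ∀ i, Integrable (pd i η) := fun i =>
    (hpds η hηs i).continuous.integrable_of_hasCompactSupport (hpdc η hηc i)
  have hpdi2 : ∀ i j, Integrable (pd i (pd j η)) := fun i j =>
    (hpds _ (hpds η hηs j) i).continuous.integrable_of_hasCompactSupport
      (hpdc _ (hpdc η hηc j) i)
  let C₁ : ℝ := ∑ i, ∫ t, |pd i η t|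
  let C₂ : ℝ := ∑ i, ∑ j, ∫ t, |pd i (pd j η) t|
  have hC₁ : ∀ i, ∫ t, |pd i η t| ≤ C₁ := fun i =>
    Finset.single_le_sum (f := fun i => ∫ t, |pd i η t|)
      (fun i _ => integral_nonneg fun t => abs_nonneg _) (Finset.mem_univ i)
  have hC₂ : ∀ i j, ∫ t, |pd i (pd j η) t| ≤ C₂ := fun i j =>
    (Finset.single_le_sum (f := fun j => ∫ t, |pd i (pd j η) t|)
      (fun j _ => integral_nonneg fun t => abs_nonneg _) (Finset.mem_univ j)).trans
    (Finset.single_le_sum (f := fun i => ∑ j, ∫ t, |pd i (pd j η) t|)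
      (fun i _ => Finset.sum_nonneg fun j _ => integral_nonneg fun t => abs_nonneg _)
      (Finset.mem_univ i))
  have hC₁0 : 0 ≤ C₁ := Finset.sum_nonneg fun i _ => integral_nonneg fun t => abs_nonneg _
  have hC₂0 : 0 ≤ C₂ := Finset.sum_nonneg fun i _ => Finset.sum_nonneg fun j _ =>
    integral_nonneg fun t => abs_nonneg _
  refine ⟨C₁ + C₂, by positivity, fun A hA ε hε => ?_⟩
  -- rescale the set to the unit scale
  let B : Set E4 := (fun z : E4 => ε • z) ⁻¹' A
  have hB : MeasurableSet B := (measurable_const_smul ε) hA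
  let v := indicatorConv B η
  have hv : ContDiff ℝ ∞ v := contDiff_indicatorConv hB hηs hηc
  let T : E4 → E4 := fun y => ε⁻¹ • y
  have hT : ContDiff ℝ ∞ T := contDiff_const_smul _
  have hpdT : ∀ (f : E4 → ℝ), ContDiff ℝ ∞ f → ∀ i y,
      pd i (fun z => f (T z)) y = ε⁻¹ * pd i f (T y) := by
    intro f hf i y
    rw [pd_comp (hT.differentiable (by simp)).differentiableAt
      (hf.differentiable (by simp)).differentiableAt]
    have : ∀ a, pd i (fun z => T z a) y = if i = a then ε⁻¹ else 0 := by
      intro a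
      have h3 : HasFDerivAt (fun z : E4 => T z a) (ε⁻¹ • (EuclideanSpace.proj a : E4 →L[ℝ] ℝ)) y :=
        ((EuclideanSpace.proj a : E4 →L[ℝ] ℝ).hasFDerivAt (x := y)).const_smul ε⁻¹
      unfold pd
      rw [h3.fderiv]
      simp [eq_comm]
    simp [this]
  have hv1 : ∀ i s, |pd i v s| ≤ C₁ := by
    intro i s
    rw [pd_indicatorConv hB hηs hηc]
    exact (abs_indicatorConv_le (hpdi i) s).trans (hC₁ i)
  have hv2 : ∀ i j s, |pd i (pd j v) s| ≤ C₂ := by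
    intro i j s
    rw [pd_indicatorConv hB hηs hηc, pd_indicatorConv hB (hpds η hηs j) (hpdc η hηc j)]
    exact (abs_indicatorConv_le (hpdi2 i j) s).trans (hC₂ i j)
  have hmem : ∀ y t : E4, T y - t ∈ Metric.ball (0 : E4) 1 → ε • t ∈ Metric.ball y ε := by
    intro y t ht
    rw [mem_ball_zero_iff] at ht
    rw [mem_ball_iff_norm]
    have : ε • t - y = -(ε • (T y - t)) := by
      simp only [T, smul_sub, smul_smul, mul_inv_cancel₀ hε.ne', one_smul]
      abel
    rw [this, norm_neg, norm_smul, Real.norm_of_nonneg hε.le]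
    nlinarith
  refine ⟨fun y => v (T y), hv.comp hT, fun y => ⟨?_, ?_⟩, fun y hy => ?_, fun y hy => ?_,
    fun y i => ?_, fun y i j => ?_⟩
  · refine integral_nonneg fun t => ?_
    exact mul_nonneg (indicator_nonneg (fun _ _ => zero_le_one) t) (hη0 _)
  · refine (le_abs_self _).trans ((abs_indicatorConv_le hηi _).trans ?_)
    simp only [abs_of_nonneg (hη0 _)]
    exact hη1.le
  · have e : ∀ t, B.indicator (fun _ => (1 : ℝ)) t * η (T y - t) = η (T y - t) := by
      intro t
      by_cases ht : T y - t ∈ Metric.ball (0 : E4) 1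
      · have : t ∈ B := hy (hmem y t ht)
        rw [indicator_of_mem this, one_mul]
      · rw [hηsupp _ ht, mul_zero]
    show indicatorConv B η (T y) = 1
    rw [indicatorConv_apply]
    simp only [e]
    rw [integral_sub_left_eq_self η volume (T y), hη1]
  · have e : ∀ t, B.indicator (fun _ => (1 : ℝ)) t * η (T y - t) = 0 := by
      intro t
      by_cases ht : T y - t ∈ Metric.ball (0 : E4) 1
      · have : t ∉ B := fun h => disjoint_left.1 hy (hmem y t ht) h
        rw [indicator_of_notMem this, zero_mul]
      · rw [hηsupp _ ht, mul_zero]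
    show indicatorConv B η (T y) = 0
    rw [indicatorConv_apply]
    simp [e]
  · rw [hpdT v hv, abs_mul, abs_of_pos (inv_pos.2 hε), div_eq_inv_mul]
    gcongr
    exact (hv1 i _).trans (by linarith)
  · have e : pd j (fun y => v (T y)) = fun y => ε⁻¹ * pd j v (T y) := by
      funext y
      exact hpdT v hv j y
    have hc : DifferentiableAt ℝ (fun z => pd j v (T z)) y :=
      (((hpds v hv j).comp hT).differentiable (by simp)).differentiableAt
    rw [e, pd_mul (differentiableAt_const _) hc, pd_const, zero_mul, add_zero,
      hpdT _ (hpds v hv j), ← mul_assoc, abs_mul, div_eq_inv_mul, abs_of_pos (by positivity),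
      ← mul_inv, ← pow_two]
    gcongr
    exact (hv2 i j _).trans (by linarith)

end Mollifier

/-! ### The distance in charts -/

section Distance

open Manifold

variable {M : Type*} [EMetricSpace M] [ChartedSpace E4 M] [IsManifold (𝓡 4) ∞ M]
  [RiemannianBundle (fun x : M => TangentSpace (𝓡 4) x)]
  [IsContMDiffRiemannianBundle (𝓡 4) ∞ E4 (fun x : M => TangentSpace (𝓡 4) x)]
  [IsRiemannianManifold (𝓡 4) M]

-- the Euclidean norm on the tangent spaces of the model space
attribute [local instance] normedAddCommGroupTangentSpaceVectorSpace
attribute [local instance] normedSpaceTangentSpaceVectorSpace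

theorem enorm_apply_le_of_opENorm_le {E F : Type*} [SeminormedAddCommGroup E] [NormedSpace ℝ E]
    [SeminormedAddCommGroup F] [NormedSpace ℝ F] {f : E →L[ℝ] F} {C : ℝ≥0∞} (h : ‖f‖ₑ ≤ C) (v : E) :
    ‖f v‖ₑ ≤ C * ‖v‖ₑ :=
  (f.le_opENorm v).trans (by gcongr)

/-- The inverse of a chart is Lipschitz near the base point. -/
theorem exists_lipschitz_chart_symm (x : M) : ∃ R : ℝ, 0 < R ∧ ∃ L : ℝ, 0 < L ∧
    Metric.closedBall (extChartAt (𝓡 4) x x) R ⊆ (extChartAt (𝓡 4) x).target ∧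
    ∀ y ∈ Metric.ball (extChartAt (𝓡 4) x x) R, ∀ z ∈ Metric.ball (extChartAt (𝓡 4) x x) R,
      edist ((extChartAt (𝓡 4) x).symm y) ((extChartAt (𝓡 4) x).symm z)
        ≤ ENNReal.ofReal (L * dist y z) := by
  have hm : IsManifold (𝓡 4) 1 M := IsManifold.of_le (n := ∞) (by simp)
  have hcb : IsContinuousRiemannianBundle E4 (fun x : M => TangentSpace (𝓡 4) x) := by
    obtain ⟨g, hg, hg'⟩ := IsContMDiffRiemannianBundle.exists_contMDiff (IB := 𝓡 4) (n := ∞)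
      (F := E4) (E := fun x : M => TangentSpace (𝓡 4) x)
    exact ⟨g, hg.continuous, hg'⟩
  obtain ⟨C, C_pos, hC⟩ := eventually_enorm_mfderivWithin_symm_extChartAt_lt (𝓡 4) x
  have e : 𝓝[range (𝓡 4)] (extChartAt (𝓡 4) x x) = 𝓝 (extChartAt (𝓡 4) x x) := by simp
  rw [e] at hC
  obtain ⟨R, R_pos, hR⟩ := Metric.nhds_basis_closedBall.mem_iff.1
    (Filter.inter_mem (extChartAt_target_mem_nhds (I := 𝓡 4) x) hC)
  refine ⟨R, R_pos, C, by exact_mod_cast C_pos, hR.trans inter_subset_left, fun y hy z hz => ?_⟩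
  -- the image of the segment from `y` to `z` is a path of controlled length
  let η := ContinuousAffineMap.lineMap (R := ℝ) y z
  set γ := (extChartAt (𝓡 4) x).symm ∘ η
  have hη : ∀ t ∈ Icc (0 : ℝ) 1, η t ∈ Metric.closedBall (extChartAt (𝓡 4) x x) R := by
    intro t ht
    refine Metric.ball_subset_closedBall ((convex_ball _ _).segment_subset hy hz ?_)
    rw [segment_eq_image_lineMap]
    exact ⟨t, ht, rfl⟩
  have hη1 : MapsTo η (Icc 0 1) (extChartAt (𝓡 4) x).target := fun t ht => (hR (hη t ht)).1
  have η_smooth : ContMDiffOn 𝓘(ℝ, ℝ) 𝓘(ℝ, E4) 1 η (Icc 0 1) := by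
    apply ContMDiff.contMDiffOn
    rw [contMDiff_iff_contDiff]
    exact ContinuousAffineMap.contDiff _
  have hlen : edist ((extChartAt (𝓡 4) x).symm y) ((extChartAt (𝓡 4) x).symm z)
      ≤ pathELength (𝓡 4) γ 0 1 := by
    rw [IsRiemannianManifold.out (I := 𝓡 4)]
    apply riemannianEDist_le_pathELength _ _ _ zero_le_one
    · exact (contMDiffOn_extChartAt_symm x).comp η_smooth hη1
    · simp [γ, η, ContinuousAffineMap.coe_lineMap_eq]
    · simp [γ, η, ContinuousAffineMap.coe_lineMap_eq]
  have hd : ENNReal.ofReal (C * dist y z) = C * edist y z := by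
    rw [ENNReal.ofReal_mul (by positivity), edist_dist, ENNReal.ofReal_coe_nnreal]
  refine hlen.trans ?_
  rw [hd, ← lintegral_fderiv_lineMap_eq_edist, pathELength_eq_lintegral_mfderivWithin_Icc,
    ← lintegral_const_mul' _ _ ENNReal.coe_ne_top]
  apply setLIntegral_mono' measurableSet_Icc (fun t ht ↦ ?_)
  have : mfderivWithin 𝓘(ℝ, ℝ) (𝓡 4) γ (Icc 0 1) t =
      (mfderivWithin (𝓡 4) (𝓡 4) (extChartAt (𝓡 4) x).symm (range (𝓡 4)) (η t)) ∘L (mfderivWithin 𝓘(ℝ, ℝ) 𝓘(ℝ, E4) η (Icc 0 1) t) := by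
    apply mfderivWithin_comp
    · exact mdifferentiableWithinAt_extChartAt_symm (hη1 ht)
    · exact η_smooth.mdifferentiableOn one_ne_zero t ht
    · exact fun t ht => extChartAt_target_subset_range x (hη1 ht)
    · rw [uniqueMDiffWithinAt_iff_uniqueDiffWithinAt]
      exact uniqueDiffOn_Icc zero_lt_one t ht
  have : mfderivWithin 𝓘(ℝ, ℝ) (𝓡 4) γ (Icc 0 1) t 1 =
      (mfderivWithin (𝓡 4) (𝓡 4) (extChartAt (𝓡 4) x).symm (range (𝓡 4)) (η t)) (mfderivWithin 𝓘(ℝ, ℝ) 𝓘(ℝ, E4) η (Icc 0 1) t 1) :=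
    congr($this 1)
  rw [this]
  have h2 := (hR (hη t ht)).2
  refine (enorm_apply_le_of_opENorm_le h2.le _).trans ?_
  gcongr
  simp only [mfderivWithin_eq_fderivWithin]
  exact le_of_eq rfl

end Distance

/-! ### Volumes of balls and cutoff functions -/

section Cutoff

variable {M : Type*} [EMetricSpace M] [ChartedSpace E4 M] [IsManifold (𝓡 4) ∞ M]
  [RiemannianBundle (fun x : M => TangentSpace (𝓡 4) x)]
  [IsContMDiffRiemannianBundle (𝓡 4) ∞ E4 (fun x : M => TangentSpace (𝓡 4) x)]

theorem gradInner_self_nonneg (u : M → ℝ) (x : M) : 0 ≤ gradInner u u x :=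
  (isMetricOn_metricMatrix x).ipC_self_nonneg (mem_extChartAt_target x)

theorem gradInner_symm (u v : M → ℝ) (x : M) : gradInner u v x = gradInner v u x :=
  (isMetricOn_metricMatrix x).ipC_symm (mem_extChartAt_target x)

theorem gradInner_sq_le (u v : M → ℝ) (x : M) :
    gradInner u v x ^ 2 ≤ gradInner u u x * gradInner v v x :=
  (isMetricOn_metricMatrix x).ipC_sq_le (mem_extChartAt_target x)

theorem abs_gradInner_le (u v : M → ℝ) (x : M) :
    |gradInner u v x| ≤ √(gradInner u u x) * √(gradInner v v x) := by
  rw [← Real.sqrt_mul (gradInner_self_nonneg u x), ← Real.sqrt_sq_eq_abs]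
  exact Real.sqrt_le_sqrt (gradInner_sq_le u v x)

/-- The triangle inequality for the length of the gradient. -/
theorem sqrt_gradInner_sum_le [CompactSpace M] (t : Finset M) {φ : M → M → ℝ} {Φ : M → ℝ}
    (hφ : ∀ i, ContMDiff (𝓡 4) 𝓘(ℝ, ℝ) ∞ (φ i)) (hΦ : ∀ z, Φ z = ∑ i ∈ t, φ i z) (x : M) :
    √(gradInner Φ Φ x) ≤ ∑ i ∈ t, √(gradInner (φ i) (φ i) x) := by
  rcases (Real.sqrt_nonneg (gradInner Φ Φ x)).eq_or_lt with h | h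
  · rw [← h]
    exact Finset.sum_nonneg fun i _ => Real.sqrt_nonneg _
  · refine le_of_mul_le_mul_left ?_ h
    rw [Real.mul_self_sqrt (gradInner_self_nonneg Φ x), Finset.mul_sum]
    conv_lhs => rw [gradInner_sum Φ t hφ hΦ x]
    exact Finset.sum_le_sum fun i _ => (le_abs_self _).trans (abs_gradInner_le _ _ _)

theorem pd_inChart_of_eventuallyEq_const {u : M → ℝ} {x : M} {a : ℝ} (h : ∀ᶠ z in 𝓝 x, u z = a)
    (i : Fin 4) : ∀ᶠ y in 𝓝 (extChartAt (𝓡 4) x x), pd i (inChart x u) y = 0 := by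
  have h1 : ∀ᶠ y in 𝓝 (extChartAt (𝓡 4) x x), inChart x u y = a := by
    have hc := continuousAt_extChartAt_symm (I := 𝓡 4) x
    unfold ContinuousAt at hc
    rw [extChartAt_to_inv] at hc
    exact hc.eventually h
  filter_upwards [h1.eventually_nhds] with y hy
  rw [pd_congr (v := fun _ => a) hy, pd_const]

theorem gradInner_of_eventuallyEq_const {u : M → ℝ} (v : M → ℝ) {x : M} {a : ℝ}
    (h : ∀ᶠ z in 𝓝 x, u z = a) : gradInner u v x = 0 := by
  unfold gradInner ipC
  simp only [(pd_inChart_of_eventuallyEq_const h _).self_of_nhds, mul_zero, zero_mul,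
    Finset.sum_const_zero]

theorem laplacian_of_eventuallyEq_const {u : M → ℝ} {x : M} {a : ℝ}
    (h : ∀ᶠ z in 𝓝 x, u z = a) : laplacian u x = 0 := by
  unfold laplacian lapC divC
  have h1 : ∀ᶠ y in 𝓝 (extChartAt (𝓡 4) x x), ∀ i, pd i (inChart x u) y = 0 :=
    Filter.eventually_all.2 fun i => pd_inChart_of_eventuallyEq_const h i
  have h2 : ∀ i, pd i (fun z => √(metricMatrix x z).det * gradC (metricMatrix x) (inChart x u) z i)
      (extChartAt (𝓡 4) x x) = 0 := by
    intro i
    rw [pd_congr (v := fun _ => 0), pd_const]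
    filter_upwards [h1] with y hy
    simp [gradC, hy]
  simp only [h2, Finset.sum_const_zero, mul_zero]

/-- The coefficients of the first-order part of `N` are bounded on a compact manifold. -/
theorem exists_lowerForm_bound [CompactSpace M] (γ₂ γ₃ : ℝ) : ∃ K : ℝ, 0 ≤ K ∧
    ∀ (x : M) (u v : M → ℝ), ContMDiff (𝓡 4) 𝓘(ℝ, ℝ) ∞ u → ContMDiff (𝓡 4) 𝓘(ℝ, ℝ) ∞ v →
      |lowerForm γ₂ γ₃ u v x| ≤ K * √(gradInner u u x) * √(gradInner v v x) := by
  suffices h : ∃ K : ℝ, 0 ≤ K ∧ ∀ x ∈ (univ : Set M), ∀ u v : M → ℝ,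
      ContMDiff (𝓡 4) 𝓘(ℝ, ℝ) ∞ u → ContMDiff (𝓡 4) 𝓘(ℝ, ℝ) ∞ v →
      |lowerForm γ₂ γ₃ u v x| ≤ K * √(gradInner u u x) * √(gradInner v v x) by
    obtain ⟨K, hK, h⟩ := h
    exact ⟨K, hK, fun x => h x (mem_univ x)⟩
  refine isCompact_univ.induction_on (p := fun S => ∃ K : ℝ, 0 ≤ K ∧ ∀ x ∈ S, ∀ u v : M → ℝ,
      ContMDiff (𝓡 4) 𝓘(ℝ, ℝ) ∞ u → ContMDiff (𝓡 4) 𝓘(ℝ, ℝ) ∞ v →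
      |lowerForm γ₂ γ₃ u v x| ≤ K * √(gradInner u u x) * √(gradInner v v x))
    ⟨0, le_rfl, by simp⟩ ?_ ?_ ?_
  · rintro S T hST ⟨K, hK, h⟩
    exact ⟨K, hK, fun x hx => h x (hST hx)⟩
  · rintro S T ⟨K, hK, h⟩ ⟨K', hK', h'⟩
    refine ⟨max K K', hK.trans (le_max_left _ _), ?_⟩
    rintro x (hx | hx) u v hu hv
    · refine (h x hx u v hu hv).trans ?_
      gcongr
      exact le_max_left _ _
    · refine (h' x hx u v hu hv).trans ?_
      gcongr
      exact le_max_right _ _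
  · intro x₀ _
    obtain ⟨R, hR, hRt⟩ := Metric.nhds_basis_closedBall.mem_iff.1
      (extChartAt_target_mem_nhds (I := 𝓡 4) x₀)
    obtain ⟨K, hK, h⟩ := (isMetricOn_metricMatrix x₀).exists_lowerC_bound γ₂ γ₃
      (isCompact_closedBall _ _) hRt
    have hV := isOpen_extChartAt_preimage' (I := 𝓡 4) x₀
      (Metric.isOpen_ball (x := extChartAt (𝓡 4) x₀ x₀) (ε := R))
    refine ⟨_, mem_nhdsWithin_of_mem_nhds
      (hV.mem_nhds ⟨mem_extChartAt_source x₀, Metric.mem_ball_self hR⟩), K, hK, ?_⟩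
    rintro x ⟨hx, hxR⟩ u v hu hv
    rw [lowerForm_eq γ₂ γ₃ hu hv hx, gradInner_eq hu hu hx, gradInner_eq hv hv hx]
    exact h _ (Metric.ball_subset_closedBall hxR) _ _

variable [IsRiemannianManifold (𝓡 4) M]

/-- Small balls of a compact manifold have at least Euclidean volume, up to a constant. -/
theorem exists_volume_ball_lower_bound [CompactSpace M] [MeasurableSpace M] [BorelSpace M] :
    ∃ c s₀ : ℝ, 0 < c ∧ 0 < s₀ ∧ ∀ (q : M) (s : ℝ), 0 < s → s ≤ s₀ →
      ENNReal.ofReal (c * s ^ 4) ≤ riemVolume M (Metric.eball q (ENNReal.ofReal s)) := by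
  suffices h : ∃ c s₀ : ℝ, 0 < c ∧ 0 < s₀ ∧ ∀ q ∈ (univ : Set M), ∀ (s : ℝ), 0 < s → s ≤ s₀ →
      ENNReal.ofReal (c * s ^ 4) ≤ riemVolume M (Metric.eball q (ENNReal.ofReal s)) by
    obtain ⟨c, s₀, hc, hs, h⟩ := h
    exact ⟨c, s₀, hc, hs, fun q => h q (mem_univ q)⟩
  refine isCompact_univ.induction_on (p := fun S => ∃ c s₀ : ℝ, 0 < c ∧ 0 < s₀ ∧ ∀ q ∈ S,
      ∀ (s : ℝ), 0 < s → s ≤ s₀ →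
      ENNReal.ofReal (c * s ^ 4) ≤ riemVolume M (Metric.eball q (ENNReal.ofReal s)))
    ⟨1, 1, one_pos, one_pos, by simp⟩ ?_ ?_ ?_
  · rintro S T hST ⟨c, s₀, hc, hs, h⟩
    exact ⟨c, s₀, hc, hs, fun q hq => h q (hST hq)⟩
  · rintro S T ⟨c, s₀, hc, hs, h⟩ ⟨c', s₀', hc', hs', h'⟩
    refine ⟨min c c', min s₀ s₀', lt_min hc hc', lt_min hs hs', ?_⟩
    rintro q (hq | hq) s hs1 hs2
    · refine le_trans (ENNReal.ofReal_le_ofReal ?_) (h q hq s hs1 (hs2.trans (min_le_left _ _)))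
      gcongr
      exact min_le_left _ _
    · refine le_trans (ENNReal.ofReal_le_ofReal ?_) (h' q hq s hs1 (hs2.trans (min_le_right _ _)))
      gcongr
      exact min_le_right _ _
  · intro x _
    obtain ⟨R, hR, L, hL, hRt, hlip⟩ := exists_lipschitz_chart_symm x
    have hG := isMetricOn_metricMatrix x
    obtain ⟨y₀, hy₀, hmin⟩ := (isCompact_closedBall (extChartAt (𝓡 4) x x) R).exists_isMinOn
      ⟨_, Metric.mem_closedBall_self hR.le⟩ (hG.sqrt_det_smooth.continuousOn.mono hRt)
    set m := √(metricMatrix x y₀).det with hm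
    have hm0 : 0 < m := hG.sqrt_det_pos (hRt hy₀)
    have hV := isOpen_extChartAt_preimage' (I := 𝓡 4) x
      (Metric.isOpen_ball (x := extChartAt (𝓡 4) x x) (ε := R / 2))
    have hb0 : 0 < volume.real (Metric.ball (0 : E4) 1) :=
      ENNReal.toReal_pos (Metric.measure_ball_pos _ _ one_pos).ne' measure_ball_lt_top.ne
    refine ⟨_, mem_nhdsWithin_of_mem_nhds
      (hV.mem_nhds ⟨mem_extChartAt_source x, Metric.mem_ball_self (half_pos hR)⟩),
      m * ((1 / L) ^ 4 * volume.real (Metric.ball (0 : E4) 1)), L * (R / 2), by positivity,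
      by positivity, ?_⟩
    rintro q ⟨hq, hqR⟩ s hs hsL
    have hsub : Metric.ball (extChartAt (𝓡 4) x q) (s / L)
        ⊆ Metric.ball (extChartAt (𝓡 4) x x) R := by
      refine Metric.ball_subset_ball' ?_
      have h1 : s / L ≤ R / 2 := by rwa [div_le_iff₀ hL, mul_comm]
      have h2 : dist (extChartAt (𝓡 4) x q) (extChartAt (𝓡 4) x x) < R / 2 := hqR
      linarith
    have hsub2 : Metric.ball (extChartAt (𝓡 4) x q) (s / L) ⊆ (extChartAt (𝓡 4) x).target ∩
        (extChartAt (𝓡 4) x).symm ⁻¹' Metric.eball q (ENNReal.ofReal s) := by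
      intro z hz
      refine ⟨hRt (Metric.ball_subset_closedBall (hsub hz)), ?_⟩
      have h1 := hlip z (hsub hz) _ (hsub (Metric.mem_ball_self (by positivity)))
      rw [(extChartAt (𝓡 4) x).left_inv hq] at h1
      refine lt_of_le_of_lt h1 ((ENNReal.ofReal_lt_ofReal_iff hs).2 ?_)
      have h2 : dist z (extChartAt (𝓡 4) x q) < s / L := hz
      rwa [lt_div_iff₀ hL, mul_comm] at h2
    have hS : MeasurableSet (Metric.eball q (ENNReal.ofReal s)) := Metric.isOpen_eball.measurableSet
    calc ENNReal.ofReal (m * ((1 / L) ^ 4 * volume.real (Metric.ball (0 : E4) 1)) * s ^ 4)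
        = ENNReal.ofReal m * volume (Metric.ball (extChartAt (𝓡 4) x q) (s / L)) := by
          rw [Measure.addHaar_ball volume _ (by positivity : 0 ≤ s / L), finrank_euclideanSpace_fin,
            ← ofReal_measureReal measure_ball_lt_top.ne, ← ENNReal.ofReal_mul (by positivity),
            ← ENNReal.ofReal_mul (by positivity)]
          congr 1
          rw [div_pow, div_pow]
          ring
      _ = ∫⁻ y in Metric.ball (extChartAt (𝓡 4) x q) (s / L), ENNReal.ofReal m := by simp
      _ ≤ ∫⁻ y in Metric.ball (extChartAt (𝓡 4) x q) (s / L),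
            ENNReal.ofReal (√(metricMatrix x y).det) := by
          refine setLIntegral_mono' Metric.isOpen_ball.measurableSet fun y hy => ?_
          exact ENNReal.ofReal_le_ofReal (hmin (Metric.ball_subset_closedBall (hsub hy)))
      _ ≤ chartVolume x (Metric.eball q (ENNReal.ofReal s)) := by
          rw [chartVolume_apply x hS]
          exact lintegral_mono_set hsub2
      _ ≤ _ := chartVolume_le_riemVolume x _

/-- A function `ζ` supported near `x₀` can be cut off along an arbitrary set `A` at any scale `h`,
with bounds of the derivatives that do not depend on `A`. -/
theorem exists_local_cutoff (x₀ : M) : ∃ V : Set M, IsOpen V ∧ x₀ ∈ V ∧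
    ∀ ζ : M → ℝ, ContMDiff (𝓡 4) 𝓘(ℝ, ℝ) ∞ ζ → tsupport ζ ⊆ V → (∀ x, 0 ≤ ζ x) →
    ∃ C : ℝ, 0 ≤ C ∧ ∀ (A : Set M), IsOpen A → ∀ h : ℝ, 0 < h → h ≤ 1 →
    ∃ f : M → ℝ, ContMDiff (𝓡 4) 𝓘(ℝ, ℝ) ∞ f ∧ (∀ x, 0 ≤ f x ∧ f x ≤ ζ x) ∧
      (∀ x, Metric.eball x (ENNReal.ofReal (h / 4)) ⊆ A → f x = ζ x) ∧
      (∀ x, Disjoint (Metric.eball x (ENNReal.ofReal (h / 4))) A → f x = 0) ∧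
      ∀ x, |laplacian f x| ≤ C / h ^ 2 ∧ √(gradInner f f x) ≤ C / h := by
  obtain ⟨R, hR, L, hL, hRt, hlip⟩ := exists_lipschitz_chart_symm x₀
  obtain ⟨Cm, hCm, hmol⟩ := exists_mollified_indicator
  have hG := isMetricOn_metricMatrix x₀
  set T := (extChartAt (𝓡 4) x₀).target with hT
  have hTo : IsOpen T := isOpen_extChartAt_target x₀
  set y₀ := extChartAt (𝓡 4) x₀ x₀ with hy₀
  refine ⟨(extChartAt (𝓡 4) x₀).source ∩ extChartAt (𝓡 4) x₀ ⁻¹' Metric.ball y₀ (R / 2),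
    isOpen_extChartAt_preimage' (I := 𝓡 4) x₀ Metric.isOpen_ball,
    ⟨mem_extChartAt_source x₀, Metric.mem_ball_self (half_pos hR)⟩, fun ζ hζ hζs hζ0 => ?_⟩
  have hζsrc : tsupport ζ ⊆ (extChartAt (𝓡 4) x₀).source := fun x hx => (hζs hx).1
  set K := Metric.closedBall y₀ (R / 2) with hK
  have hKT : K ⊆ T := (Metric.closedBall_subset_closedBall (by linarith)).trans hRt
  have hKc : IsCompact K := isCompact_closedBall _ _
  obtain ⟨C₁, hC₁, hbound⟩ := hG.exists_lapC_bound hKc hKT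
  -- a common bound of the derivatives of `ζ` in the chart
  have hζc := contDiffOn_inChart x₀ hζ
  obtain ⟨Z, hZ⟩ : ∃ Z : ℝ, ∀ y ∈ K, |inChart x₀ ζ y| + (∑ i, |pd i (inChart x₀ ζ) y|)
      + ∑ i, ∑ j, |pd i (pd j (inChart x₀ ζ)) y| ≤ Z := by
    have hc : ContinuousOn (fun y => |inChart x₀ ζ y| + (∑ i, |pd i (inChart x₀ ζ) y|)
      + ∑ i, ∑ j, |pd i (pd j (inChart x₀ ζ)) y|) K := by
      refine ContinuousOn.mono (s := T) ?_ hKT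
      refine (hζc.continuousOn.abs.add (continuousOn_finsetSum _ fun i _ => ?_)).add
        (continuousOn_finsetSum _ fun i _ => continuousOn_finsetSum _ fun j _ => ?_)
      · exact (contDiffOn_pd hTo hζc i).continuousOn.abs
      · exact (contDiffOn_pd hTo (contDiffOn_pd hTo hζc j) i).continuousOn.abs
    obtain ⟨Z, hZ⟩ := hKc.exists_bound_of_continuousOn hc
    exact ⟨Z, fun y hy => (le_abs_self _).trans (hZ y hy)⟩
  have hZa : ∀ y ∈ K, |inChart x₀ ζ y| ≤ Z := fun y hy => by
    have h1 : 0 ≤ ∑ i, |pd i (inChart x₀ ζ) y| := Finset.sum_nonneg fun _ _ => abs_nonneg _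
    have h2 : 0 ≤ ∑ i, ∑ j, |pd i (pd j (inChart x₀ ζ)) y| :=
      Finset.sum_nonneg fun _ _ => Finset.sum_nonneg fun _ _ => abs_nonneg _
    linarith [hZ y hy]
  have hZb : ∀ y ∈ K, ∀ i, |pd i (inChart x₀ ζ) y| ≤ Z := fun y hy i => by
    have h1 := Finset.single_le_sum (f := fun i => |pd i (inChart x₀ ζ) y|)
      (fun _ _ => abs_nonneg _) (Finset.mem_univ i)
    have h2 : 0 ≤ ∑ i, ∑ j, |pd i (pd j (inChart x₀ ζ)) y| :=
      Finset.sum_nonneg fun _ _ => Finset.sum_nonneg fun _ _ => abs_nonneg _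
    have h3 := abs_nonneg (inChart x₀ ζ y)
    linarith [hZ y hy]
  have hZc : ∀ y ∈ K, ∀ i j, |pd i (pd j (inChart x₀ ζ)) y| ≤ Z := fun y hy i j => by
    have h1 : 0 ≤ ∑ i, |pd i (inChart x₀ ζ) y| := Finset.sum_nonneg fun _ _ => abs_nonneg _
    have h2 := Finset.single_le_sum (f := fun j => |pd i (pd j (inChart x₀ ζ)) y|)
      (fun _ _ => abs_nonneg _) (Finset.mem_univ j)
    have h4 := Finset.single_le_sum (f := fun i => ∑ j, |pd i (pd j (inChart x₀ ζ)) y|)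
      (fun _ _ => Finset.sum_nonneg fun _ _ => abs_nonneg _) (Finset.mem_univ i)
    have h3 := abs_nonneg (inChart x₀ ζ y)
    linarith [hZ y hy]
  have hZ0 : 0 ≤ Z := (abs_nonneg _).trans (hZa y₀ (Metric.mem_closedBall_self (by positivity)))
  -- the mollification at the scale `κ h` moves points of `M` by at most `h / 4`
  set κ := min (R / 2) (1 / (4 * L)) with hκ
  have hκ0 : 0 < κ := lt_min (by positivity) (by positivity)
  set a := Z * (1 + Cm / κ) with ha
  set b := Z * (1 + 2 * (Cm / κ) + Cm / κ ^ 2) with hb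
  have ha0 : 0 ≤ a := by positivity
  have hb0 : 0 ≤ b := by positivity
  refine ⟨C₁ * (a + b) + √C₁ * a, by positivity, fun A hA h h0 h1 => ?_⟩
  have hε : 0 < κ * h := by positivity
  have hεR : κ * h ≤ R / 2 := by nlinarith [min_le_left (R / 2) (1 / (4 * L))]
  have hεL : L * (κ * h) ≤ h / 4 := by
    have : L * κ ≤ 1 / 4 := by
      calc L * κ ≤ L * (1 / (4 * L)) := by gcongr; exact min_le_right _ _
        _ = 1 / 4 := by field_simp
    nlinarith
  have hAm : MeasurableSet (T ∩ (extChartAt (𝓡 4) x₀).symm ⁻¹' A) :=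
    ((continuousOn_extChartAt_symm x₀).isOpen_inter_preimage hTo hA).measurableSet
  obtain ⟨u, hu, hu01, hu1, hu0, hud, hudd⟩ := hmol _ hAm _ hε
  set f : M → ℝ := fun x => ζ x * u (extChartAt (𝓡 4) x₀ x) with hf
  have hfs : tsupport f ⊆ tsupport ζ := tsupport_mul_subset_left
  have hfsm : ContMDiff (𝓡 4) 𝓘(ℝ, ℝ) ∞ f := by
    refine contMDiff_of_tsupport fun x hx => (hζ x).mul ?_
    exact hu.contMDiff.contMDiffAt.comp x (contMDiffAt_extChartAt' (by
      have := hζsrc (hfs hx)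
      rwa [extChartAt_source] at this))
  -- a point of the support of `ζ`, and the ball about it in the chart
  have hball : ∀ x, ζ x ≠ 0 → ∀ z ∈ Metric.ball (extChartAt (𝓡 4) x₀ x) (κ * h),
      z ∈ T ∧ (extChartAt (𝓡 4) x₀).symm z ∈ Metric.eball x (ENNReal.ofReal (h / 4)) := by
    intro x hx z hz
    obtain ⟨hxs, hxR⟩ := hζs (subset_tsupport ζ hx)
    have hxR' : dist (extChartAt (𝓡 4) x₀ x) y₀ < R / 2 := hxR
    have hzR : z ∈ Metric.ball y₀ R := Metric.ball_subset_ball' (by linarith) hz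
    refine ⟨hRt (Metric.ball_subset_closedBall hzR), ?_⟩
    have h2 := hlip z hzR _ (Metric.ball_subset_ball (by linarith) hxR)
    rw [(extChartAt (𝓡 4) x₀).left_inv hxs] at h2
    refine lt_of_le_of_lt h2 ((ENNReal.ofReal_lt_ofReal_iff (by positivity)).2 ?_)
    have h3 : dist z (extChartAt (𝓡 4) x₀ x) < κ * h := hz
    nlinarith
  refine ⟨f, hfsm, fun x => ⟨mul_nonneg (hζ0 x) (hu01 _).1,
    mul_le_of_le_one_right (hζ0 x) (hu01 _).2⟩, fun x hx => ?_, fun x hx => ?_, fun x => ?_⟩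
  · by_cases hζx : ζ x = 0
    · simp [hf, hζx]
    · have : u (extChartAt (𝓡 4) x₀ x) = 1 :=
        hu1 _ fun z hz => ⟨(hball x hζx z hz).1, hx (hball x hζx z hz).2⟩
      simp only [hf, this, mul_one]
  · by_cases hζx : ζ x = 0
    · simp [hf, hζx]
    · have : u (extChartAt (𝓡 4) x₀ x) = 0 :=
        hu0 _ (disjoint_left.2 fun z hz hz' => disjoint_left.1 hx (hball x hζx z hz).2 hz'.2)
      simp only [hf, this, mul_zero]
  · by_cases hx : x ∈ tsupport ζ
    · obtain ⟨hxs, hxR⟩ := hζs hx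
      have hyK : extChartAt (𝓡 4) x₀ x ∈ K := Metric.ball_subset_closedBall hxR
      set y := extChartAt (𝓡 4) x₀ x with hy
      have hyT := hKT hyK
      have huc : ContDiffOn ℝ ∞ u T := hu.contDiffOn
      have heq : EqOn (inChart x₀ f) (fun z => inChart x₀ ζ z * u z) T := by
        intro z hz
        simp only [inChart, hf, (extChartAt (𝓡 4) x₀).right_inv hz]
      have dζ : ∀ z ∈ T, DifferentiableAt ℝ (inChart x₀ ζ) z :=
        fun z hz => differentiableAt_of_contDiffOn hTo hζc hz
      have du : ∀ z ∈ T, DifferentiableAt ℝ u z :=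
        fun z hz => differentiableAt_of_contDiffOn hTo huc hz
      have h1d : ∀ i, EqOn (pd i (inChart x₀ f))
          (fun z => inChart x₀ ζ z * pd i u z + pd i (inChart x₀ ζ) z * u z) T := by
        intro i z hz
        rw [pd_eqOn hTo heq i hz, pd_mul (dζ z hz) (du z hz)]
      have hu1' : |u y| ≤ 1 := abs_le.2 ⟨by linarith [(hu01 y).1], (hu01 y).2⟩
      have b1 : ∀ i, |pd i (inChart x₀ f) y| ≤ a / h := by
        intro i
        rw [h1d i hyT]
        calc |inChart x₀ ζ y * pd i u y + pd i (inChart x₀ ζ) y * u y|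
            ≤ |inChart x₀ ζ y| * |pd i u y| + |pd i (inChart x₀ ζ) y| * |u y| := by
              rw [← abs_mul, ← abs_mul]; exact abs_add_le _ _
          _ ≤ Z * (Cm / (κ * h)) + Z * 1 := by
              gcongr
              · exact hZa y hyK
              · exact hud y i
              · exact hZb y hyK i
          _ ≤ Z * (Cm / (κ * h)) + Z * (1 / h) := by
              gcongr
              exact (one_le_div h0).2 h1
          _ = a / h := by rw [ha]; field_simp; ring
      have b2 : ∀ i j, |pd i (pd j (inChart x₀ f)) y| ≤ b / h ^ 2 := by
        intro i j
        have dpu := differentiableAt_of_contDiffOn hTo (contDiffOn_pd hTo huc j) hyT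
        have dpζ := differentiableAt_of_contDiffOn hTo (contDiffOn_pd hTo hζc j) hyT
        rw [pd_eqOn hTo (h1d j) i hyT, pd_add (u := fun z => inChart x₀ ζ z * pd j u z)
            (v := fun z => pd j (inChart x₀ ζ) z * u z) ((dζ y hyT).mul dpu) (dpζ.mul (du y hyT)),
          pd_mul (dζ y hyT) dpu, pd_mul dpζ (du y hyT)]
        calc |inChart x₀ ζ y * pd i (pd j u) y + pd i (inChart x₀ ζ) y * pd j u y +
              (pd j (inChart x₀ ζ) y * pd i u y + pd i (pd j (inChart x₀ ζ)) y * u y)|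
            ≤ |inChart x₀ ζ y| * |pd i (pd j u) y| + |pd i (inChart x₀ ζ) y| * |pd j u y| +
              (|pd j (inChart x₀ ζ) y| * |pd i u y| + |pd i (pd j (inChart x₀ ζ)) y| * |u y|) := by
              simp only [← abs_mul]
              exact (abs_add_le _ _).trans (add_le_add (abs_add_le _ _) (abs_add_le _ _))
          _ ≤ Z * (Cm / (κ * h) ^ 2) + Z * (Cm / (κ * h)) + (Z * (Cm / (κ * h)) + Z * 1) := by
              gcongr
              · exact hZa y hyK
              · exact hudd y i j
              · exact hZb y hyK i
              · exact hud y j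
              · exact hZb y hyK j
              · exact hud y i
              · exact hZc y hyK i j
          _ ≤ Z * (Cm / (κ * h) ^ 2) + Z * (Cm / κ * (1 / h ^ 2)) +
                (Z * (Cm / κ * (1 / h ^ 2)) + Z * (1 / h ^ 2)) := by
              have e1 : (1 : ℝ) ≤ 1 / h ^ 2 := (one_le_div (by positivity)).2 (by nlinarith)
              have e2 : 1 / h ≤ 1 / h ^ 2 := by
                gcongr
                nlinarith
              have e3 : Cm / (κ * h) ≤ Cm / κ * (1 / h ^ 2) := by
                calc Cm / (κ * h) = Cm / κ * (1 / h) := by field_simp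
                  _ ≤ _ := by gcongr
              gcongr
          _ = b / h ^ 2 := by rw [hb]; field_simp; ring
      obtain ⟨h2, h3⟩ := hbound y hyK _ (contDiffOn_inChart x₀ hfsm) _ _ b1 b2
      rw [laplacian_eq hfsm hxs, gradInner_eq hfsm hfsm hxs]
      constructor
      · refine h2.trans ?_
        calc C₁ * (a / h + b / h ^ 2) ≤ C₁ * (a / h ^ 2 + b / h ^ 2) := by
              gcongr
              nlinarith
          _ = C₁ * (a + b) / h ^ 2 := by ring
          _ ≤ _ := by
              gcongr
              linarith [mul_nonneg (Real.sqrt_nonneg C₁) ha0]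
      · calc √(ipC (metricMatrix x₀) (inChart x₀ f) (inChart x₀ f) y)
            ≤ √(C₁ * (a / h) ^ 2) := Real.sqrt_le_sqrt h3
          _ = √C₁ * a / h := by
              rw [Real.sqrt_mul hC₁, Real.sqrt_sq (by positivity)]
              ring
          _ ≤ _ := by
              gcongr
              linarith [mul_nonneg hC₁ (add_nonneg ha0 hb0)]
    · have h2 : ∀ᶠ z in 𝓝 x, f z = 0 := by
        filter_upwards [(isClosed_tsupport ζ).isOpen_compl.mem_nhds hx] with z hz
        simp [hf, image_eq_zero_of_notMem_tsupport hz]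
      rw [laplacian_of_eventuallyEq_const h2, gradInner_of_eventuallyEq_const f h2]
      simp only [abs_zero, Real.sqrt_zero]
      exact ⟨by positivity, by positivity⟩

/-- Cutoff functions between concentric balls whose radii differ by at least `h`. -/
theorem exists_cutoff [CompactSpace M] : ∃ C : ℝ, 0 ≤ C ∧ ∀ (p : M) (ρ r h : ℝ), 0 < ρ → 0 < h →
    h ≤ 1 → ρ + h ≤ r → ∃ χ : M → ℝ, ContMDiff (𝓡 4) 𝓘(ℝ, ℝ) ∞ χ ∧ (∀ x, 0 ≤ χ x ∧ χ x ≤ 1) ∧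
      (∀ x ∈ Metric.eball p (ENNReal.ofReal ρ),
        χ x = 1 ∧ laplacian χ x = 0 ∧ gradInner χ χ x = 0) ∧
      (∀ x ∉ Metric.eball p (ENNReal.ofReal r),
        χ x = 0 ∧ laplacian χ x = 0 ∧ gradInner χ χ x = 0) ∧
      ∀ x, |laplacian χ x| ≤ C / h ^ 2 ∧ √(gradInner χ χ x) ≤ C / h := by
  choose V hV hxV hloc using fun x₀ : M => exists_local_cutoff x₀
  obtain ⟨t, ζ, hζ, hζ0, hζ1, hζs⟩ := exists_finite_partition V hV hxV
  choose C hC hcut using fun i => hloc i (ζ i) (hζ i) (hζs i) (hζ0 i)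
  refine ⟨∑ i ∈ t, C i, Finset.sum_nonneg fun i _ => hC i, fun p ρ r h hρ h0 h1 hr => ?_⟩
  choose f hf hf01 hf1 hf0 hfb using fun i =>
    hcut i (Metric.eball p (ENNReal.ofReal (ρ + h / 2))) Metric.isOpen_eball h h0 h1
  have hin : ∀ x ∈ Metric.eball p (ENNReal.ofReal (ρ + h / 4)), ∑ i ∈ t, f i x = 1 := by
    intro x hx
    rw [← hζ1 x]
    refine Finset.sum_congr rfl fun i _ => hf1 i x fun z hz => ?_
    have hx' : edist x p < ENNReal.ofReal (ρ + h / 4) := hx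
    have hz' : edist z x < ENNReal.ofReal (h / 4) := hz
    have h3 : ENNReal.ofReal (ρ + h / 2) = ENNReal.ofReal (h / 4) + ENNReal.ofReal (ρ + h / 4) := by
      rw [← ENNReal.ofReal_add (by positivity) (by positivity)]
      congr 1
      ring
    rw [Metric.mem_eball, h3]
    exact (edist_triangle z x p).trans_lt (ENNReal.add_lt_add hz' hx')
  have hout : ∀ x ∈ {x | ENNReal.ofReal (ρ + 3 * h / 4) < edist x p}, ∑ i ∈ t, f i x = 0 := by
    intro x hx
    refine Finset.sum_eq_zero fun i _ => hf0 i x (disjoint_left.2 fun z hz hzp => ?_)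
    have hx' : ENNReal.ofReal (ρ + 3 * h / 4) < edist x p := hx
    have hz' : edist x z < ENNReal.ofReal (h / 4) := by rw [edist_comm]; exact hz
    have hzp' : edist z p < ENNReal.ofReal (ρ + h / 2) := hzp
    have h3 : ENNReal.ofReal (ρ + 3 * h / 4)
        = ENNReal.ofReal (h / 4) + ENNReal.ofReal (ρ + h / 2) := by
      rw [← ENNReal.ofReal_add (by positivity) (by positivity)]
      congr 1
      ring
    rw [h3] at hx'
    exact lt_irrefl _ (hx'.trans ((edist_triangle x z p).trans_lt (ENNReal.add_lt_add hz' hzp')))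
  have hopen : IsOpen {x | ENNReal.ofReal (ρ + 3 * h / 4) < edist x p} :=
    isOpen_lt continuous_const (continuous_id.edist continuous_const)
  have hsm : ContMDiff (𝓡 4) 𝓘(ℝ, ℝ) ∞ fun x => ∑ i ∈ t, f i x :=
    contMDiff_finsetSum fun i _ => hf i
  refine ⟨fun x => ∑ i ∈ t, f i x, hsm, fun x => ⟨?_, ?_⟩, fun x hx => ?_, fun x hx => ?_,
    fun x => ⟨?_, ?_⟩⟩
  · exact Finset.sum_nonneg fun i _ => (hf01 i x).1
  · rw [← hζ1 x]
    exact Finset.sum_le_sum fun i _ => (hf01 i x).2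
  · have hx' : x ∈ Metric.eball p (ENNReal.ofReal (ρ + h / 4)) :=
      Metric.eball_subset_eball (ENNReal.ofReal_le_ofReal (by linarith)) hx
    have hev := Filter.eventually_of_mem (Metric.isOpen_eball.mem_nhds hx') hin
    exact ⟨hin x hx', laplacian_of_eventuallyEq_const hev, gradInner_of_eventuallyEq_const _ hev⟩
  · have hx' : x ∈ {x | ENNReal.ofReal (ρ + 3 * h / 4) < edist x p} := by
      have h2 : ENNReal.ofReal r ≤ edist x p := not_lt.1 hx
      refine lt_of_lt_of_le ((ENNReal.ofReal_lt_ofReal_iff (by linarith)).2 (by linarith)) h2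
    have hev := Filter.eventually_of_mem (hopen.mem_nhds hx') hout
    exact ⟨hout x hx', laplacian_of_eventuallyEq_const hev, gradInner_of_eventuallyEq_const _ hev⟩
  · rw [laplacian_sum t hf (fun _ => rfl) x, Finset.sum_div]
    exact (Finset.abs_sum_le_sum_abs _ _).trans (Finset.sum_le_sum fun i _ => (hfb i x).1)
  · rw [Finset.sum_div]
    exact (sqrt_gradInner_sum_le t hf (fun _ => rfl) x).trans
      (Finset.sum_le_sum fun i _ => (hfb i x).2)

end Cutoff

/-! ### Annuli inside the injectivity radius -/

section LocalDiffeo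

variable {M : Type*} [EMetricSpace M] [ChartedSpace E4 M] [IsManifold (𝓡 4) ∞ M]
  {E : Type*} [NormedAddCommGroup E] [NormedSpace ℝ E] [CompleteSpace E]

/-- The inverse function theorem: a smooth map with surjective differential is open. -/
theorem nhds_le_map_of_surjective_mfderiv {f : E → M} {v : E}
    (hf : ContMDiffAt 𝓘(ℝ, E) (𝓡 4) ∞ f v)
    (hd : Function.Surjective (mfderiv 𝓘(ℝ, E) (𝓡 4) f v)) : 𝓝 (f v) ≤ Filter.map f (𝓝 v) := by
  have hg : ContDiffAt ℝ ∞ (fun z => extChartAt (𝓡 4) (f v) (f z)) v := by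
    have := (contMDiffAt_iff.1 hf).2
    simpa only [Function.comp_def, modelWithCornersSelf_coe, range_id, contDiffWithinAt_univ,
      extChartAt_model_space_eq_id, PartialEquiv.refl_symm, PartialEquiv.refl_coe, id_eq] using this
  have hfd : (mfderiv 𝓘(ℝ, E) (𝓡 4) f v : E → E4)
      = fderiv ℝ (fun z => extChartAt (𝓡 4) (f v) (f z)) v := by
    rw [(hf.mdifferentiableAt (by simp)).mfderiv]
    simp only [writtenInExtChartAt, extChartAt_model_space_eq_id, PartialEquiv.refl_symm,
      PartialEquiv.refl_coe, Function.comp_id, id_eq, modelWithCornersSelf_coe, range_id,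
      fderivWithin_univ]
    rfl
  have hs := hg.hasStrictFDerivAt (by simp)
  have hmap := hs.map_nhds_eq_of_surj (LinearMap.range_eq_top.2 (by
    intro y
    obtain ⟨z, hz⟩ := hd y
    exact ⟨z, by rw [← hz, hfd]; rfl⟩))
  have hsrc : ∀ᶠ z in 𝓝 v, f z ∈ (extChartAt (𝓡 4) (f v)).source :=
    hf.continuousAt.eventually (extChartAt_source_mem_nhds (f v))
  have h1 : Filter.map f (𝓝 v)
      = Filter.map (fun z => (extChartAt (𝓡 4) (f v)).symm (extChartAt (𝓡 4) (f v) (f z))) (𝓝 v) := by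
    refine Filter.map_congr ?_
    filter_upwards [hsrc] with z hz
    exact ((extChartAt (𝓡 4) (f v)).left_inv hz).symm
  have h2 := map_extChartAt_symm_nhdsWithin_range (I := 𝓡 4) (f v)
  have e : 𝓝[range (𝓡 4)] (extChartAt (𝓡 4) (f v) (f v)) = 𝓝 (extChartAt (𝓡 4) (f v) (f v)) := by
    simp
  rw [e] at h2
  rw [h1, ← h2, ← hmap, Filter.map_map]
  rfl

/-- The image of an open ball under an injective local diffeomorphism is not compact. -/
theorem not_isCompact_image_ball [Nontrivial E] {f : E → M} {a : ℝ} (ha : 0 < a)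
    (hinj : InjOn f (Metric.ball 0 a)) (hf : ContMDiffOn 𝓘(ℝ, E) (𝓡 4) ∞ f (Metric.ball 0 a))
    (hd : ∀ v ∈ Metric.ball 0 a, Function.Bijective (mfderiv 𝓘(ℝ, E) (𝓡 4) f v)) :
    ¬ IsCompact (f '' Metric.ball 0 a) := by
  intro hK
  -- the images of the smaller balls form an increasing open cover without a largest member
  have hopen : ∀ b : Iio a, IsOpen (f '' Metric.ball 0 b.1) := by
    intro b
    refine isOpen_iff_mem_nhds.2 ?_
    rintro _ ⟨v, hv, rfl⟩
    have hva : v ∈ Metric.ball 0 a := Metric.ball_subset_ball b.2.le hv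
    exact nhds_le_map_of_surjective_mfderiv (hf.contMDiffAt (Metric.isOpen_ball.mem_nhds hva))
      (hd v hva).2 (Filter.image_mem_map (Metric.isOpen_ball.mem_nhds hv))
  obtain ⟨b, hb⟩ := hK.elim_directed_cover (fun b : Iio a => f '' Metric.ball 0 b.1) hopen
    (by
      rintro _ ⟨v, hv, rfl⟩
      obtain ⟨b, hb1, hb2⟩ := exists_between (mem_ball_zero_iff.1 hv)
      exact mem_iUnion.2 ⟨⟨b, hb2⟩, v, mem_ball_zero_iff.2 hb1, rfl⟩)
    (Monotone.directed_le (f := fun b : Iio a => f '' Metric.ball (0 : E) b.1)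
      fun b c hbc => image_mono (Metric.ball_subset_ball hbc))
  obtain ⟨s, hs1, hs2⟩ := exists_between (max_lt b.2 ha)
  have hs0 : 0 ≤ s := (le_max_right _ _).trans hs1.le
  obtain ⟨v, hv⟩ := exists_norm_eq E hs0
  obtain ⟨u, hu, huv⟩ := hb ⟨v, mem_ball_zero_iff.2 (hv ▸ hs2), rfl⟩
  have : u = v := hinj (Metric.ball_subset_ball b.2.le hu) (mem_ball_zero_iff.2 (hv ▸ hs2)) huv
  rw [this, mem_ball_zero_iff, hv] at hu
  exact absurd hu (not_lt.2 ((le_max_left _ _).trans hs1.le))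

end LocalDiffeo

section Annulus

variable {M : Type*} [EMetricSpace M] [CompactSpace M] [ChartedSpace E4 M] [IsManifold (𝓡 4) ∞ M]
  [RiemannianBundle (fun x : M => TangentSpace (𝓡 4) x)]

/-- Inside the injectivity radius, every distance is attained: otherwise a geodesic ball would be
compact, while it is diffeomorphic to an open ball. -/
theorem exists_edist_eq_of_lt_injRadius (p : M) {t r : ℝ} (htr : t ≤ r)
    (hr : ENNReal.ofReal r < injRadius M) : ∃ q, edist q p = ENNReal.ofReal t := by
  have h1 : ENNReal.ofReal r < injRadiusAt p := hr.trans_le (iInf_le _ p)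
  unfold injRadiusAt at h1
  obtain ⟨a, h2⟩ := lt_iSup_iff.1 h1
  obtain ⟨⟨hbij, hsm, hd⟩, h3⟩ := lt_iSup_iff.1 h2
  have ha : 0 < a := ENNReal.ofReal_pos.1 (zero_le.trans_lt h3)
  have hra : r < a := (ENNReal.ofReal_lt_ofReal_iff ha).1 h3
  have hconn : IsPreconnected (Metric.eball p (ENNReal.ofReal a)) := by
    rw [← hbij.image_eq]
    exact (convex_ball _ _).isPreconnected.image _ hsm.continuousOn
  have hp : p ∈ Metric.eball p (ENNReal.ofReal a) := Metric.mem_eball_self (ENNReal.ofReal_pos.2 ha)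
  by_cases hex : ∃ x ∈ Metric.eball p (ENNReal.ofReal a), ENNReal.ofReal t ≤ edist x p
  · obtain ⟨x, hx, hxt⟩ := hex
    obtain ⟨q, -, hq⟩ := hconn.intermediate_value hp hx
      (f := fun x => edist x p) (continuous_id.edist continuous_const).continuousOn
      ⟨by simp, hxt⟩
    exact ⟨q, hq⟩
  · exfalso
    push Not at hex
    have hcl : Metric.eball p (ENNReal.ofReal a) = Metric.closedEBall p (ENNReal.ofReal t) := by
      refine Subset.antisymm (fun x hx => (hex x hx).le) fun x hx => ?_
      exact lt_of_le_of_lt hx ((ENNReal.ofReal_lt_ofReal_iff ha).2 (htr.trans_lt hra))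
    have hK : IsCompact (Metric.eball p (ENNReal.ofReal a)) := by
      rw [hcl]
      exact Metric.isClosed_closedEBall.isCompact
    rw [← hbij.image_eq] at hK
    have hfd : FiniteDimensional ℝ (TangentSpace (𝓡 4) p) :=
      inferInstanceAs (FiniteDimensional ℝ E4)
    have hcomp : CompleteSpace (TangentSpace (𝓡 4) p) := FiniteDimensional.complete ℝ _
    have hnt : Nontrivial (TangentSpace (𝓡 4) p) := inferInstanceAs (Nontrivial E4)
    exact not_isCompact_image_ball ha hbij.injOn hsm hd hK

/-- The finite distances in a compact extended metric space are bounded. -/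
theorem exists_edist_le_of_ne_top : ∃ D : ℝ, 0 < D ∧
    ∀ x y : M, edist x y ≠ ⊤ → edist x y ≤ ENNReal.ofReal D := by
  obtain ⟨t, ht⟩ := isCompact_univ.elim_finite_subcover (fun c : M => Metric.eball c 1)
    (fun c => Metric.isOpen_eball)
    (fun x _ => mem_iUnion.2 ⟨x, Metric.mem_eball_self one_pos⟩)
  refine ⟨2 + ∑ c ∈ t, ∑ d ∈ t, (edist c d).toReal, ?_, fun x y hxy => ?_⟩
  · have : 0 ≤ ∑ c ∈ t, ∑ d ∈ t, (edist c d).toReal :=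
      Finset.sum_nonneg fun _ _ => Finset.sum_nonneg fun _ _ => ENNReal.toReal_nonneg
    linarith
  · obtain ⟨c, hc, hxc⟩ := mem_iUnion₂.1 (ht (mem_univ x))
    obtain ⟨d, hd, hyd⟩ := mem_iUnion₂.1 (ht (mem_univ y))
    have hxc' : edist x c < 1 := hxc
    have hyd' : edist y d < 1 := hyd
    have hcd : edist c d ≠ ⊤ := by
      refine ne_top_of_le_ne_top (b := edist x c + edist x y + edist y d) ?_ ?_
      · exact ENNReal.add_ne_top.2 ⟨ENNReal.add_ne_top.2 ⟨hxc'.ne_top, hxy⟩, hyd'.ne_top⟩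
      · calc edist c d ≤ edist c x + edist x y + edist y d := edist_triangle4 _ _ _ _
          _ = _ := by rw [edist_comm c x]
    have h1 : (edist c d).toReal ≤ ∑ c ∈ t, ∑ d ∈ t, (edist c d).toReal :=
      (Finset.single_le_sum (f := fun d => (edist c d).toReal)
        (fun _ _ => ENNReal.toReal_nonneg) hd).trans
      (Finset.single_le_sum (f := fun c => ∑ d ∈ t, (edist c d).toReal)
        (fun _ _ => Finset.sum_nonneg fun _ _ => ENNReal.toReal_nonneg) hc)
    calc edist x y ≤ edist x c + edist c d + edist d y := edist_triangle4 _ _ _ _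
      _ ≤ 1 + edist c d + 1 := by
          rw [edist_comm d y]
          gcongr
      _ = ENNReal.ofReal (2 + (edist c d).toReal) := by
          rw [ENNReal.ofReal_add zero_le_two ENNReal.toReal_nonneg, ENNReal.ofReal_toReal hcd,
            ENNReal.ofReal_ofNat, add_right_comm, one_add_one_eq_two]
      _ ≤ _ := ENNReal.ofReal_le_ofReal (by linarith)

/-- Annuli inside the injectivity radius have volume at least comparable with the fourth power of
their width, since they contain a ball of half that width. -/
theorem exists_volume_annulus_lower_bound
    [IsContMDiffRiemannianBundle (𝓡 4) ∞ E4 (fun x : M => TangentSpace (𝓡 4) x)]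
    [IsRiemannianManifold (𝓡 4) M] [MeasurableSpace M] [BorelSpace M] :
    ∃ c D : ℝ, 0 < c ∧ 0 < D ∧ ∀ (p : M) (ρ r : ℝ), 0 < ρ → ρ < r →
      ENNReal.ofReal r < injRadius M → r - ρ ≤ D ∧
      ENNReal.ofReal (c * (r - ρ) ^ 4) ≤
        riemVolume M (Metric.eball p (ENNReal.ofReal r) \ Metric.eball p (ENNReal.ofReal ρ)) := by
  obtain ⟨c, s₀, hc, hs₀, hvol⟩ := exists_volume_ball_lower_bound (M := M)
  obtain ⟨D, hD, hdiam⟩ := exists_edist_le_of_ne_top (M := M)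
  set κ := min (1 / 2) (s₀ / (2 * D)) with hκ
  have hκ0 : 0 < κ := lt_min (by norm_num) (by positivity)
  refine ⟨c * κ ^ 4, 2 * D, by positivity, by positivity, fun p ρ r hρ hρr hr => ?_⟩
  obtain ⟨q, hq⟩ := exists_edist_eq_of_lt_injRadius p (t := (ρ + r) / 2) (by linarith) hr
  have hrD : r - ρ ≤ 2 * D := by
    have h1 := hdiam q p (by rw [hq]; exact ENNReal.ofReal_ne_top)
    rw [hq, ENNReal.ofReal_le_ofReal_iff hD.le] at h1
    linarith
  refine ⟨hrD, ?_⟩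
  have hs : 0 < κ * (r - ρ) := mul_pos hκ0 (by linarith)
  have hs1 : κ * (r - ρ) ≤ (r - ρ) / 2 := by
    nlinarith [min_le_left (1 / 2) (s₀ / (2 * D))]
  have hs2 : κ * (r - ρ) ≤ s₀ := by
    calc κ * (r - ρ) ≤ s₀ / (2 * D) * (2 * D) := by
          gcongr
          exact min_le_right _ _
      _ = s₀ := by field_simp
  refine le_trans (le_of_eq ?_) ((hvol q _ hs hs2).trans (measure_mono fun x hx => ?_))
  · rw [mul_pow, mul_assoc]
  · have hx' : edist x q < ENNReal.ofReal ((r - ρ) / 2) :=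
      lt_of_lt_of_le hx (ENNReal.ofReal_le_ofReal hs1)
    constructor
    · have e : ENNReal.ofReal r = ENNReal.ofReal ((r - ρ) / 2) + ENNReal.ofReal ((ρ + r) / 2) := by
        rw [← ENNReal.ofReal_add (by linarith) (by linarith)]
        congr 1
        ring
      rw [Metric.mem_eball, e, ← hq]
      refine (edist_triangle x q p).trans_lt ?_
      rw [hq]
      exact ENNReal.add_lt_add_right ENNReal.ofReal_ne_top hx'
    · intro hxp
      have hxp' : edist x p < ENNReal.ofReal ρ := hxp
      have h2 : edist q p < ENNReal.ofReal ((ρ + r) / 2) := by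
        refine (edist_triangle q x p).trans_lt ?_
        rw [edist_comm q x]
        refine (ENNReal.add_lt_add hx' hxp').trans_le ?_
        rw [← ENNReal.ofReal_add (by linarith) (by linarith)]
        exact ENNReal.ofReal_le_ofReal (by linarith)
      exact absurd h2 (by rw [hq]; exact lt_irrefl _)

end Annulus

/-! ### The truncation function and the pointwise inequality -/

/-- There is a bounded smooth function `Ψ` with `Ψ' = m ^ 4`, where `m` decays so slowly that
`Ψ = O(|σ| m ^ 3)`. Here `m = (1 + σ ^ 2) ^ (-1 / 6)`; the exponent is the borderline one for the
last bound, and `m ^ 4` is still integrable. -/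
theorem exists_truncation : ∃ (Ψ m : ℝ → ℝ) (C : ℝ), 0 ≤ C ∧ ContDiff ℝ ∞ Ψ ∧
    (∀ σ, 0 < m σ ∧ m σ ≤ 1) ∧ (∀ σ, deriv Ψ σ = m σ ^ 4) ∧
    (∀ σ, |deriv (deriv Ψ) σ| ≤ m σ ^ 4) ∧ (∀ σ, |Ψ σ| ≤ C) ∧
    (∀ σ, |Ψ σ| ≤ C * |σ| * m σ ^ 3) ∧ ∀ σ, |σ| < 1 → 1 / 2 ≤ m σ ^ 4 := by
  let m : ℝ → ℝ := fun σ => (1 + σ ^ 2) ^ (-1 / 6 : ℝ)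
  let F : ℝ → ℝ := fun σ => (1 + σ ^ 2) ^ (-2 / 3 : ℝ)
  have hpos : ∀ σ : ℝ, 0 < 1 + σ ^ 2 := fun σ => by positivity
  have hone : ∀ σ : ℝ, 1 ≤ 1 + σ ^ 2 := fun σ => by nlinarith [sq_nonneg σ]
  have hm4 : ∀ σ, m σ ^ 4 = F σ := by
    intro σ
    simp only [m, F]
    rw [← Real.rpow_natCast, ← Real.rpow_mul (hpos σ).le]
    norm_num
  have hm3 : ∀ σ, m σ ^ 3 = (√(1 + σ ^ 2))⁻¹ := by
    intro σ
    simp only [m]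
    rw [← Real.rpow_natCast, ← Real.rpow_mul (hpos σ).le, Real.sqrt_eq_rpow,
      ← Real.rpow_neg (hpos σ).le]
    norm_num
  have hF0 : ∀ σ, 0 < F σ := fun σ => Real.rpow_pos_of_pos (hpos σ) _
  have hF1 : ∀ σ, F σ ≤ 1 := fun σ => Real.rpow_le_one_of_one_le_of_nonpos (hone σ) (by norm_num)
  have hFs : ContDiff ℝ ∞ F := by
    refine ContDiff.rpow_const_of_ne (by fun_prop) fun σ => (hpos σ).ne'
  have hFi : Integrable F := by
    have := integrable_rpow_neg_one_add_norm_sq (E := ℝ) (μ := volume) (r := 4 / 3) (by simp; norm_num)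
    refine this.congr (Filter.Eventually.of_forall fun σ => ?_)
    simp only [F, Real.norm_eq_abs, sq_abs]
    norm_num
  let Ψ : ℝ → ℝ := fun σ => ∫ t in (0 : ℝ)..σ, F t
  have hd : ∀ σ, HasDerivAt Ψ (F σ) σ := fun σ =>
    intervalIntegral.integral_hasDerivAt_right (hFs.continuous.intervalIntegrable _ _)
      (hFs.continuous.stronglyMeasurableAtFilter _ _) hFs.continuous.continuousAt
  have hderiv : deriv Ψ = F := funext fun σ => (hd σ).deriv
  set C₀ := ∫ t, F t with hC₀
  have hC₀0 : 0 ≤ C₀ := integral_nonneg fun t => (hF0 t).le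
  have hb1 : ∀ σ, |Ψ σ| ≤ C₀ := by
    intro σ
    rw [← Real.norm_eq_abs]
    refine (intervalIntegral.norm_integral_le_integral_norm_uIoc).trans ?_
    have : ∀ t, ‖F t‖ = F t := fun t => Real.norm_of_nonneg (hF0 t).le
    simp only [this]
    exact setIntegral_le_integral hFi (Filter.Eventually.of_forall fun t => (hF0 t).le)
  have hb2 : ∀ σ, |Ψ σ| ≤ |σ| := by
    intro σ
    have := intervalIntegral.norm_integral_le_of_norm_le_const (f := F) (a := 0) (b := σ) (C := 1)
      (fun t _ => by rw [Real.norm_of_nonneg (hF0 t).le]; exact hF1 t)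
    simpa using this
  refine ⟨Ψ, m, 2 * (C₀ + 1), by positivity, ?_, fun σ => ⟨Real.rpow_pos_of_pos (hpos σ) _,
    Real.rpow_le_one_of_one_le_of_nonpos (hone σ) (by norm_num)⟩, fun σ => ?_, fun σ => ?_,
    fun σ => ?_, fun σ => ?_, fun σ hσ => ?_⟩
  · refine contDiff_infty_iff_deriv.2 ⟨fun σ => (hd σ).differentiableAt, ?_⟩
    rwa [hderiv]
  · rw [hderiv, hm4]
  · rw [hderiv, hm4]
    have h1 : HasDerivAt (fun σ : ℝ => 1 + σ ^ 2) (2 * σ) σ := by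
      simpa using (hasDerivAt_pow 2 σ).const_add 1
    have h2 := (h1.rpow_const (p := -2 / 3) (Or.inl (hpos σ).ne')).deriv
    have h3 : (1 + σ ^ 2) ^ (-2 / 3 - 1 : ℝ) = F σ / (1 + σ ^ 2) := by
      rw [Real.rpow_sub (hpos σ), Real.rpow_one]
    rw [h2, h3, show 2 * σ * (-2 / 3) * (F σ / (1 + σ ^ 2)) = F σ * (-(4 / 3) * (σ / (1 + σ ^ 2))) by
      ring, abs_mul, abs_of_pos (hF0 σ)]
    refine mul_le_of_le_one_right (hF0 σ).le ?_
    rw [abs_mul, abs_div, abs_of_pos (hpos σ), abs_neg, abs_of_pos (by norm_num : (0 : ℝ) < 4 / 3),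
      ← mul_div_assoc, div_le_one (hpos σ)]
    nlinarith [sq_nonneg (|σ| - 1), sq_abs σ]
  · exact (hb1 σ).trans (by linarith)
  · rw [hm3, ← div_eq_mul_inv, le_div_iff₀ (Real.sqrt_pos.2 (hpos σ))]
    by_cases hσ : |σ| ≤ 1
    · have : √(1 + σ ^ 2) ≤ 2 := Real.sqrt_le_iff.2 ⟨by norm_num, by nlinarith [sq_abs σ, abs_nonneg σ]⟩
      calc |Ψ σ| * √(1 + σ ^ 2) ≤ |σ| * 2 :=
            mul_le_mul (hb2 σ) this (Real.sqrt_nonneg _) (abs_nonneg _)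
        _ ≤ _ := by nlinarith [abs_nonneg σ]
    · have : √(1 + σ ^ 2) ≤ 2 * |σ| :=
        Real.sqrt_le_iff.2 ⟨by positivity, by nlinarith [sq_abs σ]⟩
      calc |Ψ σ| * √(1 + σ ^ 2) ≤ C₀ * (2 * |σ|) :=
            mul_le_mul (hb1 σ) this (Real.sqrt_nonneg _) hC₀0
        _ ≤ _ := by nlinarith [abs_nonneg σ]
  · rw [hm4]
    have h1 : 1 + σ ^ 2 ≤ 2 := by nlinarith [sq_abs σ, abs_nonneg σ]
    calc (1 / 2 : ℝ) = 2 ^ (-1 : ℝ) := by rw [Real.rpow_neg_one]; norm_num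
      _ ≤ 2 ^ (-2 / 3 : ℝ) := Real.rpow_le_rpow_of_exponent_le (by norm_num) (by norm_num)
      _ ≤ F σ := Real.rpow_le_rpow_of_nonpos (hpos σ) h1 (by norm_num)

theorem mul_cube_le_young {ε u n : ℝ} (hε : 0 < ε) (hu : 0 ≤ u) (hn : 0 ≤ n) :
    u * n ^ 3 ≤ ε * n ^ 4 + u ^ 4 / ε ^ 3 := by
  rcases le_total u (ε * n) with h | h
  · have h1 : u * n ^ 3 ≤ ε * n * n ^ 3 := by gcongr
    have h2 : 0 ≤ u ^ 4 / ε ^ 3 := by positivity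
    nlinarith
  · have h1 : n ≤ u / ε := by rwa [le_div_iff₀ hε, mul_comm]
    have h2 : u * n ^ 3 ≤ u * (u / ε) ^ 3 := by gcongr
    have h3 : u * (u / ε) ^ 3 = u ^ 4 / ε ^ 3 := by field_simp
    have h4 : 0 ≤ ε * n ^ 4 := by positivity
    linarith

theorem mul_sq_le_young {ε u n : ℝ} (hε : 0 < ε) : u * n ^ 2 ≤ ε * n ^ 4 + u ^ 2 / ε := by
  have h : 0 ≤ (ε * n ^ 2 - u / 2) ^ 2 + 3 / 4 * u ^ 2 := by positivity
  rw [← sub_nonneg]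
  have e : ε * n ^ 4 + u ^ 2 / ε - u * n ^ 2 = ((ε * n ^ 2 - u / 2) ^ 2 + 3 / 4 * u ^ 2) / ε := by
    field_simp
    ring
  rw [e]
  positivity

/-- The quadratic form of the leading part of the weak form is positive definite precisely when
`27 / 4 < a`. -/
theorem exists_coercive_quadratic {a : ℝ} (ha : 27 / 4 < a) : ∃ δ : ℝ, 0 < δ ∧
    ∀ x y : ℝ, δ * (x ^ 2 + y ^ 2) ≤ a * x ^ 2 + 18 * (x * y) + 12 * y ^ 2 := by
  set η := a - 27 / 4 with hη
  have hη0 : 0 < η := by linarith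
  refine ⟨12 * η / (19 + η), by positivity, fun x y => ?_⟩
  set δ := 12 * η / (19 + η) with hδ
  have hδ0 : 0 < δ := by positivity
  have h1 : δ * (19 + η) = 12 * η := by rw [hδ]; field_simp
  have h12 : 0 < 12 - δ := by nlinarith
  have h2 : 0 ≤ (12 - δ) * (a * x ^ 2 + 18 * (x * y) + 12 * y ^ 2 - δ * (x ^ 2 + y ^ 2)) := by
    have e : (12 - δ) * (a * x ^ 2 + 18 * (x * y) + 12 * y ^ 2 - δ * (x ^ 2 + y ^ 2))
        = ((12 - δ) * y + 9 * x) ^ 2 + ((12 - δ) * (a - δ) - 81) * x ^ 2 := by ring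
    have h3 : 0 ≤ (12 - δ) * (a - δ) - 81 := by
      have : a = 27 / 4 + η := by rw [hη]; ring
      rw [this]
      nlinarith
    rw [e]
    positivity
  nlinarith [nonneg_of_mul_nonneg_right h2 h12]

theorem four_mul_le_sq_add (n Y : ℝ) : 4 * (n * Y) ≤ 2 * n ^ 2 + 2 * (1 + Y ^ 4) := by
  nlinarith [sq_nonneg (n - Y), sq_nonneg (Y ^ 2 - 1), sq_nonneg (Y ^ 2)]

/-- The terms of the weak form, tested with `χ ^ 4 ψ(w)`, that contain a derivative of the cutoff
function or the second derivative of the truncation. In this and the following statements the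
variables stand for `A = Δw`, `b = |∇w|`, `g = ⟨∇χ, ∇w⟩`, `ξ = |∇χ|`, `E = Δχ`, `ψ = ψ(w)`,
`m ^ 4 = ψ'(w)`, `t = ψ''(w)`, and `l` for the first-order terms. The bounds are in terms of a number
`n` that dominates the weighted unknowns `√|χ ^ 2 m ^ 2 A|` and `χ m b`. -/
theorem abs_error_terms_le {a K C₀ κ χ m A b g ξ E ψ s t l n : ℝ} (ha0 : 0 < a) (hK : 0 ≤ K)
    (hC₀ : 0 ≤ C₀) (hκ0 : 0 ≤ κ) (hχ0 : 0 ≤ χ) (hχ1 : χ ≤ 1) (hm0 : 0 < m) (hm1 : m ≤ 1)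
    (hb : 0 ≤ b) (hξ : 0 ≤ ξ) (hg : |g| ≤ ξ * b) (hψ : |ψ| ≤ C₀ * |s| * m ^ 3)
    (ht : |t| ≤ κ * m ^ 4) (hl : |l| ≤ K * (χ ^ 4 * m ^ 4 * b ^ 2 + 4 * χ ^ 3 * |ψ| * (ξ * b)))
    (hαn : χ ^ 2 * m ^ 2 * |A| ≤ n ^ 2) (hβn : χ * m * b ≤ n) :
    |(a * A + 6 * b ^ 2) * (χ ^ 4 * (t * b ^ 2))
        + (a * A + 6 * b ^ 2) * (8 * χ ^ 3 * m ^ 4 * g)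
        + (a * A + 6 * b ^ 2) * (ψ * (4 * χ ^ 3 * E + 12 * χ ^ 2 * ξ ^ 2))
        + 12 * (A + b ^ 2) * (4 * χ ^ 3 * ψ * g) + l|
      ≤ κ * (a + 6) * n ^ 4 + 8 * (a + 6) * ξ * n ^ 3
        + (a + 6) * (C₀ * |s| * (4 * |E| + 12 * ξ ^ 2)) * n ^ 2
        + 96 * (C₀ * |s| * ξ) * n ^ 3 + (3 * K * n ^ 2 + 2 * K * (1 + (C₀ * |s| * ξ) ^ 4)) := by
  set L := a + 6 with hL
  have hL0 : 0 < L := by positivity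
  set β := χ * m * b with hβ
  have hβ0 : 0 ≤ β := by positivity
  have hn0 : 0 ≤ n := hβ0.trans hβn
  have hβ2n : β ^ 2 ≤ n ^ 2 := by gcongr
  set Y := C₀ * |s| * ξ with hY
  have hY0 : 0 ≤ Y := by positivity
  set Z := C₀ * |s| * (4 * |E| + 12 * ξ ^ 2) with hZ
  have hZ0 : 0 ≤ Z := by positivity
  set Q := a * |A| + 6 * b ^ 2 with hQ
  have hQ0 : 0 ≤ Q := by positivity
  have hAQ : |a * A + 6 * b ^ 2| ≤ Q := by
    refine (abs_add_le _ _).trans (le_of_eq ?_)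
    rw [abs_mul, abs_of_pos ha0, abs_of_nonneg (by positivity : 0 ≤ 6 * b ^ 2)]
  have hQn : χ ^ 2 * m ^ 2 * Q ≤ L * n ^ 2 := by
    calc χ ^ 2 * m ^ 2 * Q = a * (χ ^ 2 * m ^ 2 * |A|) + 6 * β ^ 2 := by
          rw [hQ, hβ]
          ring
      _ ≤ a * n ^ 2 + 6 * n ^ 2 := by gcongr
      _ = L * n ^ 2 := by rw [hL]; ring
  have e1 : |(a * A + 6 * b ^ 2) * (χ ^ 4 * (t * b ^ 2))| ≤ κ * L * n ^ 4 := by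
    calc |(a * A + 6 * b ^ 2) * (χ ^ 4 * (t * b ^ 2))|
        = |a * A + 6 * b ^ 2| * (χ ^ 4 * (|t| * b ^ 2)) := by
          rw [abs_mul, abs_mul, abs_mul, abs_of_nonneg (by positivity : 0 ≤ χ ^ 4),
            abs_of_nonneg (by positivity : 0 ≤ b ^ 2)]
      _ ≤ Q * (χ ^ 4 * (κ * m ^ 4 * b ^ 2)) := by gcongr
      _ = κ * (χ ^ 2 * m ^ 2 * Q) * β ^ 2 := by rw [hβ]; ring
      _ ≤ κ * (L * n ^ 2) * n ^ 2 := by gcongr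
      _ = κ * L * n ^ 4 := by ring
  have e2 : |(a * A + 6 * b ^ 2) * (8 * χ ^ 3 * m ^ 4 * g)| ≤ 8 * L * ξ * n ^ 3 := by
    calc |(a * A + 6 * b ^ 2) * (8 * χ ^ 3 * m ^ 4 * g)|
        = |a * A + 6 * b ^ 2| * (8 * χ ^ 3 * m ^ 4 * |g|) := by
          rw [abs_mul, abs_mul _ g, abs_of_nonneg (by positivity : 0 ≤ 8 * χ ^ 3 * m ^ 4)]
      _ ≤ Q * (8 * χ ^ 3 * m ^ 4 * (ξ * b)) := by gcongr
      _ = 8 * (χ ^ 2 * m ^ 2 * Q) * (m * ξ) * β := by rw [hβ]; ring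
      _ ≤ 8 * (L * n ^ 2) * (1 * ξ) * n := by gcongr
      _ = _ := by ring
  have e3 : |(a * A + 6 * b ^ 2) * (ψ * (4 * χ ^ 3 * E + 12 * χ ^ 2 * ξ ^ 2))|
      ≤ L * Z * n ^ 2 := by
    have h1 : |4 * χ ^ 3 * E + 12 * χ ^ 2 * ξ ^ 2| ≤ χ ^ 2 * (4 * |E| + 12 * ξ ^ 2) := by
      calc |4 * χ ^ 3 * E + 12 * χ ^ 2 * ξ ^ 2|
          ≤ |4 * χ ^ 3 * E| + |12 * χ ^ 2 * ξ ^ 2| := abs_add_le _ _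
        _ = χ ^ 2 * (4 * (χ * |E|) + 12 * ξ ^ 2) := by
            rw [abs_mul, abs_of_nonneg (by positivity : 0 ≤ 4 * χ ^ 3),
              abs_of_nonneg (by positivity : 0 ≤ 12 * χ ^ 2 * ξ ^ 2)]
            ring
        _ ≤ χ ^ 2 * (4 * (1 * |E|) + 12 * ξ ^ 2) := by gcongr
        _ = _ := by ring
    calc |(a * A + 6 * b ^ 2) * (ψ * (4 * χ ^ 3 * E + 12 * χ ^ 2 * ξ ^ 2))|
        = |a * A + 6 * b ^ 2| * (|ψ| * |4 * χ ^ 3 * E + 12 * χ ^ 2 * ξ ^ 2|) := by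
          rw [abs_mul, abs_mul]
      _ ≤ Q * (C₀ * |s| * m ^ 3 * (χ ^ 2 * (4 * |E| + 12 * ξ ^ 2))) := by gcongr
      _ = (χ ^ 2 * m ^ 2 * Q) * (m * Z) := by rw [hZ]; ring
      _ ≤ (L * n ^ 2) * (1 * Z) := by gcongr
      _ = _ := by ring
  have e4 : |12 * (A + b ^ 2) * (4 * χ ^ 3 * ψ * g)| ≤ 96 * Y * n ^ 3 := by
    calc |12 * (A + b ^ 2) * (4 * χ ^ 3 * ψ * g)|
        = 12 * |A + b ^ 2| * (4 * χ ^ 3 * |ψ| * |g|) := by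
          rw [abs_mul, abs_mul, abs_mul _ g, abs_mul _ ψ,
            abs_of_nonneg (by positivity : 0 ≤ 4 * χ ^ 3), abs_of_pos (by norm_num : (0 : ℝ) < 12)]
      _ ≤ 12 * (|A| + b ^ 2) * (4 * χ ^ 3 * (C₀ * |s| * m ^ 3) * (ξ * b)) := by
          gcongr
          refine (abs_add_le _ _).trans (le_of_eq ?_)
          rw [abs_of_nonneg (by positivity : 0 ≤ b ^ 2)]
      _ = 48 * (χ ^ 2 * m ^ 2 * |A| + β ^ 2) * Y * β := by rw [hβ, hY]; ring
      _ ≤ 48 * (n ^ 2 + n ^ 2) * Y * n := by gcongr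
      _ = _ := by ring
  have e5 : |l| ≤ 3 * K * n ^ 2 + 2 * K * (1 + Y ^ 4) := by
    have h1 : χ ^ 4 * m ^ 4 * b ^ 2 ≤ n ^ 2 := by
      calc χ ^ 4 * m ^ 4 * b ^ 2 = χ ^ 2 * m ^ 2 * β ^ 2 := by rw [hβ]; ring
        _ ≤ 1 ^ 2 * 1 ^ 2 * n ^ 2 := by gcongr
        _ = n ^ 2 := by ring
    have h2 : 4 * χ ^ 3 * |ψ| * (ξ * b) ≤ 4 * (n * Y) := by
      calc 4 * χ ^ 3 * |ψ| * (ξ * b) ≤ 4 * χ ^ 3 * (C₀ * |s| * m ^ 3) * (ξ * b) := by gcongr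
        _ = 4 * (χ ^ 2 * m ^ 2 * (β * Y)) := by rw [hβ, hY]; ring
        _ ≤ 4 * (1 ^ 2 * 1 ^ 2 * (n * Y)) := by gcongr
        _ = _ := by ring
    have h3 := four_mul_le_sq_add n Y
    calc |l| ≤ K * (n ^ 2 + (2 * n ^ 2 + 2 * (1 + Y ^ 4))) :=
          hl.trans (mul_le_mul_of_nonneg_left (add_le_add h1 (h2.trans h3)) hK)
      _ = _ := by ring
  refine (abs_add_le _ _).trans (add_le_add ((abs_add_le _ _).trans (add_le_add
    ((abs_add_le _ _).trans (add_le_add ((abs_add_le _ _).trans (add_le_add e1 e2)) e3)) e4)) e5)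

/-- Absorption of the error terms by Young's inequality. -/
theorem exists_young_absorption {L K C₀ ε : ℝ} (hL0 : 0 ≤ L) (hK : 0 ≤ K) (hC₀ : 0 ≤ C₀)
    (hε0 : 0 < ε) : ∃ C : ℝ, 0 ≤ C ∧ ∀ n ξ E s : ℝ, 0 ≤ n → 0 ≤ ξ →
      8 * L * ξ * n ^ 3 + L * (C₀ * |s| * (4 * |E| + 12 * ξ ^ 2)) * n ^ 2
        + 96 * (C₀ * |s| * ξ) * n ^ 3 + (3 * K * n ^ 2 + 2 * K * (1 + (C₀ * |s| * ξ) ^ 4))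
      ≤ 4 * ε * n ^ 4 + C * (1 + (ξ ^ 4 + E ^ 2) * (1 + s ^ 4)) := by
  refine ⟨(8 * L) ^ 4 / ε ^ 3 + L ^ 2 / ε * (288 * C₀ ^ 2)
    + 96 ^ 4 / ε ^ 3 * C₀ ^ 4 + (3 * K) ^ 2 / ε + 2 * K * (1 + C₀ ^ 4), by positivity,
    fun n ξ E s hn0 hξ => ?_⟩
  set Y := C₀ * |s| * ξ with hY
  have hY0 : 0 ≤ Y := by positivity
  set Z := C₀ * |s| * (4 * |E| + 12 * ξ ^ 2) with hZ
  have hZ0 : 0 ≤ Z := by positivity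
  set T := (ξ ^ 4 + E ^ 2) * (1 + s ^ 4) with hT
  have hξT : ξ ^ 4 ≤ T := by
    have : 0 ≤ E ^ 2 + (ξ ^ 4 + E ^ 2) * s ^ 4 := by positivity
    rw [hT]
    nlinarith
  have hYT : Y ^ 4 ≤ C₀ ^ 4 * T := by
    have e : Y ^ 4 = C₀ ^ 4 * (s ^ 4 * ξ ^ 4) := by
      rw [hY, mul_pow, mul_pow, show |s| ^ 4 = (|s| ^ 2) ^ 2 by ring, sq_abs]
      ring
    rw [e]
    have : 0 ≤ E ^ 2 * (1 + s ^ 4) + ξ ^ 4 := by positivity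
    gcongr
    rw [hT]
    nlinarith
  have hZT : Z ^ 2 ≤ 288 * C₀ ^ 2 * T := by
    have e : Z ^ 2 = C₀ ^ 2 * (s ^ 2 * (4 * |E| + 12 * ξ ^ 2) ^ 2) := by
      rw [hZ, mul_pow, mul_pow, sq_abs]
      ring
    have h1 : (4 * |E| + 12 * ξ ^ 2) ^ 2 ≤ 288 * (ξ ^ 4 + E ^ 2) := by
      nlinarith [sq_nonneg (4 * |E| - 12 * ξ ^ 2), sq_abs E, sq_nonneg E]
    have h2 : s ^ 2 ≤ 1 + s ^ 4 := by nlinarith [sq_nonneg (s ^ 2 - 1), sq_nonneg s]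
    calc Z ^ 2 = C₀ ^ 2 * (s ^ 2 * (4 * |E| + 12 * ξ ^ 2) ^ 2) := e
      _ ≤ C₀ ^ 2 * ((1 + s ^ 4) * (288 * (ξ ^ 4 + E ^ 2))) := by gcongr
      _ = _ := by rw [hT]; ring
  have hT0 : 0 ≤ T := by positivity
  have y2 : 8 * L * ξ * n ^ 3 ≤ ε * n ^ 4 + (8 * L) ^ 4 / ε ^ 3 * T := by
    refine (mul_cube_le_young hε0 (by positivity) hn0).trans ?_
    have : (8 * L * ξ) ^ 4 / ε ^ 3 = (8 * L) ^ 4 / ε ^ 3 * ξ ^ 4 := by ring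
    rw [this]
    gcongr
  have y3 : L * Z * n ^ 2 ≤ ε * n ^ 4 + L ^ 2 / ε * (288 * C₀ ^ 2) * T := by
    refine (mul_sq_le_young hε0).trans ?_
    have : (L * Z) ^ 2 / ε = L ^ 2 / ε * Z ^ 2 := by ring
    rw [this, mul_assoc (L ^ 2 / ε)]
    gcongr
  have y4 : 96 * Y * n ^ 3 ≤ ε * n ^ 4 + 96 ^ 4 / ε ^ 3 * C₀ ^ 4 * T := by
    refine (mul_cube_le_young hε0 (by positivity) hn0).trans ?_
    have : (96 * Y) ^ 4 / ε ^ 3 = 96 ^ 4 / ε ^ 3 * Y ^ 4 := by ring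
    rw [this, mul_assoc (96 ^ 4 / ε ^ 3)]
    gcongr
  have y5 : 3 * K * n ^ 2 ≤ ε * n ^ 4 + (3 * K) ^ 2 / ε := mul_sq_le_young hε0
  have y6 : 2 * K * (1 + Y ^ 4) ≤ 2 * K * (1 + C₀ ^ 4 * T) := by gcongr
  set c₁ := (8 * L) ^ 4 / ε ^ 3
  set c₂ := L ^ 2 / ε * (288 * C₀ ^ 2)
  set c₃ := 96 ^ 4 / ε ^ 3 * C₀ ^ 4
  set c₄ := (3 * K) ^ 2 / ε
  have hconst : c₁ * T + c₂ * T + c₃ * T + c₄ + 2 * K * (1 + C₀ ^ 4 * T)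
      ≤ (c₁ + c₂ + c₃ + c₄ + 2 * K * (1 + C₀ ^ 4)) * (1 + T) := by
    have : 0 ≤ c₁ + c₂ + c₃ + 2 * K * C₀ ^ 4 + (c₄ + 2 * K) * T := by positivity
    linarith
  linarith

/-- The pointwise coercivity of the weak form, tested with `χ ^ 4 ψ(w)`. -/
theorem exists_pointwise_coercivity {a K C₀ : ℝ} (ha : 27 / 4 < a) (hK : 0 ≤ K) (hC₀ : 0 ≤ C₀) :
    ∃ δ κ C : ℝ, 0 < δ ∧ 0 < κ ∧ 0 ≤ C ∧ ∀ χ m A b g ξ E ψ s t l : ℝ, 0 ≤ χ → χ ≤ 1 → 0 < m →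
      m ≤ 1 → 0 ≤ b → 0 ≤ ξ → |g| ≤ ξ * b → |ψ| ≤ C₀ * |s| * m ^ 3 → |t| ≤ κ * m ^ 4 →
      |l| ≤ K * (χ ^ 4 * m ^ 4 * b ^ 2 + 4 * χ ^ 3 * |ψ| * (ξ * b)) →
      δ * (χ ^ 4 * m ^ 4 * (A ^ 2 + b ^ 4)) ≤
        (a * A + 6 * b ^ 2) * (χ ^ 4 * (m ^ 4 * A + t * b ^ 2) + 8 * χ ^ 3 * m ^ 4 * g
          + ψ * (4 * χ ^ 3 * E + 12 * χ ^ 2 * ξ ^ 2))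
        + 12 * (A + b ^ 2) * (χ ^ 4 * m ^ 4 * b ^ 2 + 4 * χ ^ 3 * ψ * g) + l
        + C * (1 + (ξ ^ 4 + E ^ 2) * (1 + s ^ 4)) := by
  obtain ⟨δ, hδ, hquad⟩ := exists_coercive_quadratic ha
  have ha0 : 0 < a := by linarith
  have hε0 : 0 < δ / 16 := by positivity
  obtain ⟨C, hC, hyoung⟩ := exists_young_absorption (L := a + 6) (by positivity) hK hC₀ hε0
  refine ⟨δ / 2, δ / (16 * (a + 6)), C, by positivity, by positivity, hC, ?_⟩
  intro χ m A b g ξ E ψ s t l hχ0 hχ1 hm0 hm1 hb hξ hg hψ ht hl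
  set α := χ ^ 2 * m ^ 2 * A with hα
  set β := χ * m * b with hβ
  have hβ0 : 0 ≤ β := by positivity
  -- `n ^ 4 = α ^ 2 + β ^ 4` dominates both unknowns
  set n := √√(α ^ 2 + β ^ 4) with hn
  have hn0 : 0 ≤ n := Real.sqrt_nonneg _
  have hn2 : n ^ 2 = √(α ^ 2 + β ^ 4) := Real.sq_sqrt (Real.sqrt_nonneg _)
  have hn4 : n ^ 4 = α ^ 2 + β ^ 4 := by
    rw [show n ^ 4 = (n ^ 2) ^ 2 by ring, hn2, Real.sq_sqrt (by positivity)]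
  have hαn : χ ^ 2 * m ^ 2 * |A| ≤ n ^ 2 := by
    have e : χ ^ 2 * m ^ 2 * |A| = |α| := by
      rw [hα, abs_mul, abs_of_nonneg (by positivity : 0 ≤ χ ^ 2 * m ^ 2)]
    rw [e, hn2]
    exact Real.abs_le_sqrt (le_add_of_nonneg_right (by positivity))
  have hβn : β ≤ n := by
    refine (sq_le_sq₀ hβ0 hn0).1 ?_
    rw [hn2]
    refine Real.le_sqrt_of_sq_le ?_
    rw [← pow_mul]
    exact le_add_of_nonneg_left (sq_nonneg α)
  have herr := neg_le_of_abs_le (abs_error_terms_le (E := E) ha0 hK hC₀ (by positivity) hχ0 hχ1 hm0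
    hm1 hb hξ hg hψ ht hl hαn hβn)
  have hy := hyoung n ξ E s hn0 hξ
  have hmain := hquad α (β ^ 2)
  have hαβ : χ ^ 4 * m ^ 4 * (A ^ 2 + b ^ 4) = n ^ 4 := by
    rw [hn4, hα, hβ]
    ring
  have hn4' : α ^ 2 + (β ^ 2) ^ 2 = n ^ 4 := by rw [hn4]; ring
  have hκ : δ / (16 * (a + 6)) * (a + 6) * n ^ 4 = δ / 16 * n ^ 4 := by field_simp
  have hexp : (a * A + 6 * b ^ 2) * (χ ^ 4 * (m ^ 4 * A + t * b ^ 2) + 8 * χ ^ 3 * m ^ 4 * g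
          + ψ * (4 * χ ^ 3 * E + 12 * χ ^ 2 * ξ ^ 2))
        + 12 * (A + b ^ 2) * (χ ^ 4 * m ^ 4 * b ^ 2 + 4 * χ ^ 3 * ψ * g)
      = (a * α ^ 2 + 18 * (α * β ^ 2) + 12 * (β ^ 2) ^ 2)
        + ((a * A + 6 * b ^ 2) * (χ ^ 4 * (t * b ^ 2))
        + (a * A + 6 * b ^ 2) * (8 * χ ^ 3 * m ^ 4 * g)
        + (a * A + 6 * b ^ 2) * (ψ * (4 * χ ^ 3 * E + 12 * χ ^ 2 * ξ ^ 2))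
        + 12 * (A + b ^ 2) * (4 * χ ^ 3 * ψ * g)) := by
    rw [hα, hβ]
    ring
  have hn40 : 0 ≤ δ * n ^ 4 := by positivity
  rw [hn4'] at hmain
  rw [hexp, hαβ]
  rw [hκ] at herr
  linarith

/-! ### The Caccioppoli inequality -/

section TestFunctions

variable {M : Type*} [EMetricSpace M] [ChartedSpace E4 M] [IsManifold (𝓡 4) ∞ M]
  [RiemannianBundle (fun x : M => TangentSpace (𝓡 4) x)]
  [IsContMDiffRiemannianBundle (𝓡 4) ∞ E4 (fun x : M => TangentSpace (𝓡 4) x)]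

theorem inChart_self (x : M) (w : M → ℝ) : inChart x w (extChartAt (𝓡 4) x x) = w x := by
  unfold inChart
  rw [extChartAt_to_inv]

section TestFunction

variable {χ w : M → ℝ} {ψ : ℝ → ℝ}

theorem contMDiff_testFunction (hψ : ContDiff ℝ ∞ ψ) (hχ : ContMDiff (𝓡 4) 𝓘(ℝ, ℝ) ∞ χ)
    (hw : ContMDiff (𝓡 4) 𝓘(ℝ, ℝ) ∞ w) :
    ContMDiff (𝓡 4) 𝓘(ℝ, ℝ) ∞ fun x => χ x ^ 4 * ψ (w x) :=
  (hχ.pow 4).mul (hψ.contMDiff.comp hw)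

theorem laplacian_testFunction (hψ : ContDiff ℝ ∞ ψ) (hχ : ContMDiff (𝓡 4) 𝓘(ℝ, ℝ) ∞ χ)
    (hw : ContMDiff (𝓡 4) 𝓘(ℝ, ℝ) ∞ w) (x : M) :
    laplacian (fun z => χ z ^ 4 * ψ (w z)) x
      = χ x ^ 4 * (deriv ψ (w x) * laplacian w x + deriv (deriv ψ) (w x) * gradInner w w x)
        + 8 * χ x ^ 3 * deriv ψ (w x) * gradInner χ w x
        + ψ (w x) * (4 * χ x ^ 3 * laplacian χ x + 12 * χ x ^ 2 * gradInner χ χ x) := by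
  have h := (isMetricOn_metricMatrix x).lapC_testFunction hψ (contDiffOn_inChart x hχ)
    (contDiffOn_inChart x hw) (mem_extChartAt_target x)
  rw [inChart_self, inChart_self] at h
  exact h

theorem gradInner_testFunction (hψ : ContDiff ℝ ∞ ψ) (hχ : ContMDiff (𝓡 4) 𝓘(ℝ, ℝ) ∞ χ)
    (hw : ContMDiff (𝓡 4) 𝓘(ℝ, ℝ) ∞ w) (u : M → ℝ) (x : M) :
    gradInner u (fun z => χ z ^ 4 * ψ (w z)) x
      = χ x ^ 4 * deriv ψ (w x) * gradInner u w x
        + 4 * χ x ^ 3 * ψ (w x) * gradInner u χ x := by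
  have h := IsMetricOn.ipC_testFunction (G := metricMatrix x) (u := inChart x u)
    (isOpen_extChartAt_target x) hψ (contDiffOn_inChart x hχ) (contDiffOn_inChart x hw)
    (mem_extChartAt_target x)
  rw [inChart_self, inChart_self] at h
  exact h

theorem lowerForm_testFunction (hψ : ContDiff ℝ ∞ ψ) (hχ : ContMDiff (𝓡 4) 𝓘(ℝ, ℝ) ∞ χ)
    (hw : ContMDiff (𝓡 4) 𝓘(ℝ, ℝ) ∞ w) (γ₂ γ₃ : ℝ) (u : M → ℝ) (x : M) :
    lowerForm γ₂ γ₃ u (fun z => χ z ^ 4 * ψ (w z)) x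
      = χ x ^ 4 * deriv ψ (w x) * lowerForm γ₂ γ₃ u w x
        + 4 * χ x ^ 3 * ψ (w x) * lowerForm γ₂ γ₃ u χ x := by
  have h := IsMetricOn.lowerC_testFunction (G := metricMatrix x) (u := inChart x u)
    (isOpen_extChartAt_target x) hψ (contDiffOn_inChart x hχ) (contDiffOn_inChart x hw)
    (mem_extChartAt_target x) γ₂ γ₃
  rw [inChart_self, inChart_self] at h
  exact h

end TestFunction

end TestFunctions

/-- The coercivity of the weak form of `N`, tested with `χ ^ 4 ψ(w)`, where `ψ(s) = k Ψ((s - c) / k)`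
is a truncation of `s - c` at the level `k`. The second derivative of `ψ` is of size `1 / k`, so that
its contribution is absorbed once `k` is large. -/
theorem exists_weakForm_coercivity (M : Type*) [EMetricSpace M] [ChartedSpace E4 M]
    [IsManifold (𝓡 4) ∞ M] [RiemannianBundle (fun x : M => TangentSpace (𝓡 4) x)]
    [IsContMDiffRiemannianBundle (𝓡 4) ∞ E4 (fun x : M => TangentSpace (𝓡 4) x)] [CompactSpace M]
    {γ₂ γ₃ : ℝ} (hγ₃ : γ₃ ≠ 0) (hγ : 3 / 2 < γ₂ / γ₃) :
    ∃ δ C k₀ C₁ : ℝ, 0 < δ ∧ 0 ≤ C ∧ 0 < k₀ ∧ 0 ≤ C₁ ∧ ∀ c k : ℝ, k₀ ≤ k →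
      ∃ ψ : ℝ → ℝ, ContDiff ℝ ∞ ψ ∧ (∀ s, |ψ s| ≤ C₁ * k) ∧
      ∀ χ w : M → ℝ, ContMDiff (𝓡 4) 𝓘(ℝ, ℝ) ∞ χ → (∀ x, 0 ≤ χ x ∧ χ x ≤ 1) →
        ContMDiff (𝓡 4) 𝓘(ℝ, ℝ) ∞ w → ∀ x,
        0 ≤ weakForm γ₂ γ₃ w (fun z => χ z ^ 4 * ψ (w z)) x / γ₃
          + C * (1 + (gradInner χ χ x ^ 2 + laplacian χ x ^ 2) * (1 + (w x - c) ^ 4)) ∧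
        (χ x = 1 → |w x - c| < k →
          δ * (laplacian w x ^ 2 + gradSq w x ^ 2)
            ≤ weakForm γ₂ γ₃ w (fun z => χ z ^ 4 * ψ (w z)) x / γ₃
            + C * (1 + (gradInner χ χ x ^ 2 + laplacian χ x ^ 2) * (1 + (w x - c) ^ 4))) := by
  obtain ⟨Ψ, m, C₁, hC₁, hΨs, hm, hΨ1, hΨ2, hΨb, hΨm, hm2⟩ := exists_truncation
  obtain ⟨K, hK, hlow⟩ := exists_lowerForm_bound (M := M) γ₂ γ₃
  obtain ⟨δ, κ, C, hδ, hκ, hC, hcoer⟩ := exists_pointwise_coercivity (a := γ₂ / γ₃ / 2 + 6)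
    (K := K / |γ₃|) (by linarith) (by positivity) hC₁
  refine ⟨δ / 2, C, 1 / κ, C₁, by positivity, hC, by positivity, hC₁, fun c k hk => ?_⟩
  have hk0 : 0 < k := lt_of_lt_of_le (by positivity) hk
  let T : ℝ → ℝ := fun s => (s - c) / k
  have hT : ∀ s, HasDerivAt T (1 / k) s := fun s => ((hasDerivAt_id s).sub_const c).div_const k
  let ψ : ℝ → ℝ := fun s => k * Ψ (T s)
  have hψs : ContDiff ℝ ∞ ψ := by
    have : ContDiff ℝ ∞ T := (contDiff_id.sub contDiff_const).div_const k
    exact contDiff_const.mul (hΨs.comp this)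
  have hΨd := (contDiff_infty_iff_deriv.1 hΨs)
  have hψ1 : deriv ψ = fun s => deriv Ψ (T s) := by
    funext s
    have h := (((hΨd.1 (T s)).hasDerivAt.comp s (hT s)).const_mul k).deriv
    refine h.trans ?_
    field_simp
  have hψ2 : ∀ s, deriv (deriv ψ) s = deriv (deriv Ψ) (T s) / k := by
    intro s
    rw [hψ1]
    have h := ((((contDiff_infty_iff_deriv.1 hΨd.2).1 (T s)).hasDerivAt).comp s (hT s)).deriv
    refine h.trans ?_
    ring
  refine ⟨ψ, hψs, fun s => ?_, fun χ w hχ hχ01 hw x => ?_⟩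
  · rw [abs_mul, abs_of_pos hk0, mul_comm]
    gcongr
    exact hΨb _
  set A := laplacian w x with hA
  set b := √(gradInner w w x) with hb
  have hb2 : b ^ 2 = gradInner w w x := Real.sq_sqrt (gradInner_self_nonneg w x)
  set ξ := √(gradInner χ χ x) with hξ
  have hξ2 : ξ ^ 2 = gradInner χ χ x := Real.sq_sqrt (gradInner_self_nonneg χ x)
  set σ := T (w x) with hσ
  set l := lowerForm γ₂ γ₃ w (fun z => χ z ^ 4 * ψ (w z)) x / γ₃ with hl
  have hlb : |l| ≤ K / |γ₃| * (χ x ^ 4 * m σ ^ 4 * b ^ 2 + 4 * χ x ^ 3 * |ψ (w x)| * (ξ * b)) := by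
    have h1 := hlow x w w hw hw
    have h2 := hlow x w χ hw hχ
    rw [hl, abs_div, lowerForm_testFunction hψs hχ hw, hψ1, div_mul_eq_mul_div]
    refine div_le_div_of_nonneg_right ?_ (abs_nonneg _)
    have hx0 := (hχ01 x).1
    have hm0 := (hm σ).1.le
    simp only
    rw [hΨ1]
    calc |χ x ^ 4 * m σ ^ 4 * lowerForm γ₂ γ₃ w w x
          + 4 * χ x ^ 3 * ψ (w x) * lowerForm γ₂ γ₃ w χ x|
        ≤ χ x ^ 4 * m σ ^ 4 * |lowerForm γ₂ γ₃ w w x|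
          + 4 * χ x ^ 3 * |ψ (w x)| * |lowerForm γ₂ γ₃ w χ x| := by
          refine (abs_add_le _ _).trans (le_of_eq ?_)
          rw [abs_mul, abs_mul _ (lowerForm γ₂ γ₃ w χ x), abs_mul _ (ψ (w x)),
            abs_of_nonneg (by positivity : 0 ≤ χ x ^ 4 * m σ ^ 4),
            abs_of_nonneg (by positivity : 0 ≤ 4 * χ x ^ 3)]
      _ ≤ χ x ^ 4 * m σ ^ 4 * (K * b * b) + 4 * χ x ^ 3 * |ψ (w x)| * (K * b * ξ) := by gcongr
      _ = _ := by ring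
  have hψb : |ψ (w x)| ≤ C₁ * |w x - c| * m σ ^ 3 := by
    calc |ψ (w x)| = k * |Ψ σ| := by rw [abs_mul, abs_of_pos hk0]
      _ ≤ k * (C₁ * |σ| * m σ ^ 3) := by
          gcongr
          exact hΨm σ
      _ = C₁ * |w x - c| * m σ ^ 3 := by
          have : |σ| = |w x - c| / k := by rw [hσ, abs_div, abs_of_pos hk0]
          rw [this]
          field_simp
  have htb : |deriv (deriv ψ) (w x)| ≤ κ * m σ ^ 4 := by
    have h1 : 1 / k ≤ κ := by rwa [one_div_le hk0 hκ]
    calc |deriv (deriv ψ) (w x)| = 1 / k * |deriv (deriv Ψ) σ| := by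
          rw [hψ2, abs_div, abs_of_pos hk0]
          ring
      _ ≤ κ * m σ ^ 4 := mul_le_mul h1 (hΨ2 σ) (abs_nonneg _) hκ.le
  have hmain := hcoer (χ x) (m σ) A b (gradInner χ w x) ξ (laplacian χ x) (ψ (w x)) (w x - c)
    (deriv (deriv ψ) (w x)) l (hχ01 x).1 (hχ01 x).2 (hm σ).1 (hm σ).2 (Real.sqrt_nonneg _)
    (Real.sqrt_nonneg _) (abs_gradInner_le χ w x) hψb htb hlb
  have hd : deriv ψ (w x) = m σ ^ 4 := by rw [hψ1]; exact hΨ1 σ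
  have hweak : weakForm γ₂ γ₃ w (fun z => χ z ^ 4 * ψ (w z)) x / γ₃
      = ((γ₂ / γ₃ / 2 + 6) * A + 6 * b ^ 2) * (χ x ^ 4 * (m σ ^ 4 * A
          + deriv (deriv ψ) (w x) * b ^ 2) + 8 * χ x ^ 3 * m σ ^ 4 * gradInner χ w x
          + ψ (w x) * (4 * χ x ^ 3 * laplacian χ x + 12 * χ x ^ 2 * ξ ^ 2))
        + 12 * (A + b ^ 2) * (χ x ^ 4 * m σ ^ 4 * b ^ 2
          + 4 * χ x ^ 3 * ψ (w x) * gradInner χ w x) + l := by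
    have h1 : weakForm γ₂ γ₃ w (fun z => χ z ^ 4 * ψ (w z)) x
        = γ₂ / 2 * (A * laplacian (fun z => χ z ^ 4 * ψ (w z)) x)
          + 6 * γ₃ * ((A + gradInner w w x) * laplacian (fun z => χ z ^ 4 * ψ (w z)) x)
          + 12 * γ₃ * ((A + gradInner w w x) * gradInner w (fun z => χ z ^ 4 * ψ (w z)) x)
          + lowerForm γ₂ γ₃ w (fun z => χ z ^ 4 * ψ (w z)) x := rfl
    rw [h1, laplacian_testFunction hψs hχ hw, gradInner_testFunction hψs hχ hw, hd, ← hb2, ← hξ2,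
      gradInner_symm w χ, hl]
    field_simp
    ring
  rw [← hweak] at hmain
  have e : (ξ ^ 4 + laplacian χ x ^ 2) = gradInner χ χ x ^ 2 + laplacian χ x ^ 2 := by
    rw [← hξ2]
    ring
  rw [e] at hmain
  have hm0 := (hm σ).1
  have hx0 := (hχ01 x).1
  refine ⟨le_trans (by positivity) hmain, fun hχ1 hwk => le_trans ?_ hmain⟩
  have h2 : 1 / 2 ≤ m σ ^ 4 := by
    refine hm2 σ ?_
    rw [hσ, abs_div, abs_of_pos hk0, div_lt_one hk0]
    exact hwk
  rw [hχ1, gradSq_eq_gradInner, ← hb2]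
  have h3 : 0 ≤ A ^ 2 + b ^ 4 := by positivity
  calc δ / 2 * (A ^ 2 + (b ^ 2) ^ 2) = δ * (1 ^ 4 * (1 / 2) * (A ^ 2 + b ^ 4)) := by ring
    _ ≤ _ := by gcongr

end LogDet

end

open LogDet in
theorem theorem2p3 {M : Type*} [EMetricSpace M] [CompactSpace M] [ChartedSpace LogDet.E4 M]
    [IsManifold (𝓡 4) ∞ M] [RiemannianBundle (fun x : M => TangentSpace (𝓡 4) x)]
    [IsContMDiffRiemannianBundle (𝓡 4) ∞ LogDet.E4 (fun x : M => TangentSpace (𝓡 4) x)]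
    [IsRiemannianManifold (𝓡 4) M] [MeasurableSpace M] [BorelSpace M]
    (γ₂ γ₃ : ℝ) (hγ₃ : γ₃ ≠ 0) (hγ : 3 / 2 < γ₂ / γ₃) :
    ∃ C k₀ : ℝ, 0 < C ∧ 0 < k₀ ∧
      ∀ (p : M) (ρ r : ℝ), 0 < ρ → ρ < r → ENNReal.ofReal r < LogDet.injRadius M →
      ∀ (c k : ℝ), k₀ ≤ k →
      ∀ w f : M → ℝ, ContMDiff (𝓡 4) 𝓘(ℝ, ℝ) ∞ w → (∀ x, LogDet.opN γ₂ γ₃ w x = f x) →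
        ⨍ x, f x ∂(LogDet.riemVolume M) = 0 →
        ∫ x in {x | |w x - c| < k} ∩ Metric.eball p (ENNReal.ofReal ρ),
            ((LogDet.laplacian w x) ^ 2 + (LogDet.gradSq w x) ^ 2) ∂(LogDet.riemVolume M)
          ≤ C / (r - ρ) ^ 4 *
              ∫ x in Metric.eball p (ENNReal.ofReal r) \ Metric.eball p (ENNReal.ofReal ρ),
                (1 + (w x - c) ^ 4) ∂(LogDet.riemVolume M)
            + C * k * ∫ x in Metric.eball p (ENNReal.ofReal r), |f x| ∂(LogDet.riemVolume M) := by
  have hfin := isFiniteMeasure_riemVolume (M := M)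
  set μ := riemVolume M with hμ
  obtain ⟨δ, C, k₀, C₁, hδ, hC, hk₀, hC₁, hcoer⟩ := exists_weakForm_coercivity M hγ₃ hγ
  obtain ⟨Cχ, hCχ, hcut⟩ := exists_cutoff (M := M)
  obtain ⟨v, D, hv, hD, hann⟩ := exists_volume_annulus_lower_bound (M := M)
  have hγ0 : 0 < |γ₃| := abs_pos.2 hγ₃
  set N := C * (μ.real univ / v) + C * ((Cχ ^ 4 + Cχ ^ 2) * (1 + D) ^ 4) with hN
  have hN0 : 0 ≤ N := by positivity
  refine ⟨(N + C₁ / |γ₃|) / δ + 1, k₀, by positivity, hk₀, ?_⟩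
  intro p ρ r hρ hρr hr c k hk w f hw hf _
  have hk0 : 0 < k := hk₀.trans_le hk
  have hrρ : 0 < r - ρ := by linarith
  obtain ⟨hrD, hvol⟩ := hann p ρ r hρ hρr hr
  set Br := Metric.eball p (ENNReal.ofReal r) with hBr
  set Bρ := Metric.eball p (ENNReal.ofReal ρ) with hBρ
  have hBrm : MeasurableSet Br := Metric.isOpen_eball.measurableSet
  have hannm : MeasurableSet (Br \ Bρ) := hBrm.diff Metric.isOpen_eball.measurableSet
  have hint : ∀ F : M → ℝ, Continuous F → Integrable F μ := fun F hF =>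
    hF.integrable_of_hasCompactSupport (HasCompactSupport.of_compactSpace F)
  -- the cutoff function works at the scale `h ≤ 1`, comparable with `r - ρ`
  set h := min (r - ρ) 1 with hh
  have hh0 : 0 < h := lt_min hrρ one_pos
  have hhr : r - ρ ≤ h * (1 + D) := by
    rcases min_cases (r - ρ) 1 with ⟨e, -⟩ | ⟨e, -⟩
    · rw [hh, e]
      nlinarith
    · rw [hh, e]
      linarith
  obtain ⟨χ, hχ, hχ01, hχin, hχout, hχb⟩ := hcut p ρ r h hρ hh0 (min_le_right _ _)
    (by linarith [min_le_left (r - ρ) 1])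
  obtain ⟨ψ, hψ, hψb, hψc⟩ := hcoer c k hk
  have hw' := hψc χ w hχ hχ01 hw
  set φ : M → ℝ := fun z => χ z ^ 4 * ψ (w z) with hφ
  have hφs : ContMDiff (𝓡 4) 𝓘(ℝ, ℝ) ∞ φ := contMDiff_testFunction hψ hχ hw
  have hfe : f = opN γ₂ γ₃ w := funext fun x => (hf x).symm
  have hfc : Continuous f := hfe ▸ continuous_opN γ₂ γ₃ hw
  set g : M → ℝ := fun x => 1 + (w x - c) ^ 4 with hg
  have hgc : Continuous g := by
    have := hw.continuous
    fun_prop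
  have hg0 : ∀ x, 0 ≤ g x := fun x => by positivity
  set e : M → ℝ := fun x => (gradInner χ χ x ^ 2 + laplacian χ x ^ 2) * g x with he
  have hec : Continuous e :=
    (((continuous_gradInner hχ hχ).pow 2).add ((continuous_laplacian hχ).pow 2)).mul hgc
  set W : M → ℝ := fun x => weakForm γ₂ γ₃ w φ x / γ₃ with hW
  have hWc : Continuous W := (continuous_weakForm γ₂ γ₃ hw hφs).div_const _
  set S := {x | |w x - c| < k} ∩ Bρ with hS
  have hSm : MeasurableSet S :=
    ((isOpen_lt (hw.continuous.sub continuous_const).abs continuous_const).inter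
      Metric.isOpen_eball).measurableSet
  set F : M → ℝ := fun x => laplacian w x ^ 2 + gradSq w x ^ 2 with hF
  have hFc : Continuous F := ((continuous_laplacian hw).pow 2).add ((continuous_gradSq hw).pow 2)
  set I := ∫ x in Br \ Bρ, g x ∂μ with hI
  set J := ∫ x in Br, |f x| ∂μ with hJ
  have hJ0 : 0 ≤ J := integral_nonneg fun x => abs_nonneg _
  have hI0 : 0 ≤ I := integral_nonneg hg0
  -- integrate the pointwise inequality
  have h1 : δ * ∫ x in S, F x ∂μ ≤ ∫ x, (W x + C * (1 + e x)) ∂μ := by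
    rw [← integral_const_mul, ← integral_indicator hSm]
    refine integral_mono ((hint _ (hFc.const_mul δ)).indicator hSm)
      (hint _ (hWc.add ((hec.const_add 1).const_mul C))) fun x => ?_
    by_cases hx : x ∈ S
    · rw [indicator_of_mem hx]
      exact (hw' x).2 (hχin x hx.2).1 hx.1
    · rw [indicator_of_notMem hx]
      exact (hw' x).1
  have h2 : ∫ x, (W x + C * (1 + e x)) ∂μ
      = (∫ x, f x * φ x ∂μ) / γ₃ + (C * μ.real univ + C * ∫ x, e x ∂μ) := by
    rw [integral_add (hint _ hWc) (hint _ ((hec.const_add 1).const_mul C)), integral_const_mul,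
      integral_add (integrable_const 1) (hint _ hec), integral_const, integral_div,
      ← integral_opN_mul γ₂ γ₃ hw hφs, hfe]
    simp only [smul_eq_mul, mul_one]
    ring
  -- the right-hand side of the equation
  have h3 : (∫ x, f x * φ x ∂μ) / γ₃ ≤ C₁ / |γ₃| * k * J := by
    have h4 : |∫ x, f x * φ x ∂μ| ≤ C₁ * k * J := by
      rw [hJ, ← integral_const_mul, ← integral_indicator hBrm, ← Real.norm_eq_abs]
      refine norm_integral_le_of_norm_le ((hint _ (hfc.abs.const_mul _)).indicator hBrm)
        (Filter.Eventually.of_forall fun x => ?_)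
      by_cases hx : x ∈ Br
      · rw [indicator_of_mem hx, norm_mul, Real.norm_eq_abs, Real.norm_eq_abs, mul_comm]
        have h5 : |φ x| ≤ C₁ * k := by
          rw [hφ, abs_mul, abs_of_nonneg (pow_nonneg (hχ01 x).1 4)]
          calc χ x ^ 4 * |ψ (w x)| ≤ 1 * (C₁ * k) :=
                mul_le_mul (pow_le_one₀ (hχ01 x).1 (hχ01 x).2) (hψb _) (abs_nonneg _) zero_le_one
            _ = C₁ * k := one_mul _
        gcongr
      · rw [indicator_of_notMem hx, hφ]
        simp [(hχout x hx).1]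
    calc (∫ x, f x * φ x ∂μ) / γ₃ ≤ |(∫ x, f x * φ x ∂μ) / γ₃| := le_abs_self _
      _ = |∫ x, f x * φ x ∂μ| / |γ₃| := abs_div _ _
      _ ≤ C₁ * k * J / |γ₃| := by gcongr
      _ = _ := by ring
  -- the derivatives of the cutoff function live in the annulus
  have h4 : ∫ x, e x ∂μ ≤ (Cχ ^ 4 + Cχ ^ 2) * (1 + D) ^ 4 / (r - ρ) ^ 4 * I := by
    have h5 : ∫ x, e x ∂μ ≤ (Cχ ^ 4 + Cχ ^ 2) / h ^ 4 * I := by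
      rw [hI, ← integral_const_mul, ← integral_indicator hannm]
      refine integral_mono (hint _ hec) ((hint _ (hgc.const_mul _)).indicator hannm) fun x => ?_
      by_cases hx : x ∈ Br \ Bρ
      · rw [indicator_of_mem hx]
        obtain ⟨b1, b2⟩ := hχb x
        have b3 : gradInner χ χ x ^ 2 ≤ (Cχ / h) ^ 4 := by
          have : gradInner χ χ x ^ 2 = √(gradInner χ χ x) ^ 4 := by
            rw [show √(gradInner χ χ x) ^ 4 = (√(gradInner χ χ x) ^ 2) ^ 2 by ring,
              Real.sq_sqrt (gradInner_self_nonneg χ x)]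
          rw [this]
          gcongr
        have b4 : laplacian χ x ^ 2 ≤ (Cχ / h ^ 2) ^ 2 := by
          rw [← sq_abs]
          gcongr
        have b5 : (Cχ / h) ^ 4 + (Cχ / h ^ 2) ^ 2 = (Cχ ^ 4 + Cχ ^ 2) / h ^ 4 := by
          field_simp
        rw [← b5]
        exact mul_le_mul_of_nonneg_right (add_le_add b3 b4) (hg0 x)
      · rw [indicator_of_notMem hx]
        have : gradInner χ χ x = 0 ∧ laplacian χ x = 0 := by
          by_cases hx' : x ∈ Br
          · have := hχin x (by_contra fun h => hx ⟨hx', h⟩)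
            exact ⟨this.2.2, this.2.1⟩
          · have := hχout x hx'
            exact ⟨this.2.2, this.2.1⟩
        simp [he, this.1, this.2]
    refine h5.trans (mul_le_mul_of_nonneg_right ?_ hI0)
    rw [div_le_div_iff₀ (by positivity) (by positivity), mul_assoc, ← mul_pow, mul_comm (1 + D)]
    gcongr
  -- the total volume is absorbed by the volume of the annulus
  have h5 : μ.real univ ≤ μ.real univ / v / (r - ρ) ^ 4 * I := by
    have h6 : v * (r - ρ) ^ 4 ≤ I := by
      have h7 : v * (r - ρ) ^ 4 ≤ μ.real (Br \ Bρ) := by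
        rw [← ENNReal.ofReal_le_ofReal_iff measureReal_nonneg, ofReal_measureReal]
        exact hvol
      refine h7.trans ?_
      have h8 : μ.real (Br \ Bρ) = ∫ x in Br \ Bρ, (1 : ℝ) ∂μ := by simp
      rw [h8, hI]
      refine integral_mono (integrable_const 1) (hint g hgc).integrableOn fun x => ?_
      have : 0 ≤ (w x - c) ^ 4 := by positivity
      simp only [hg]
      linarith
    calc μ.real univ = μ.real univ / v / (r - ρ) ^ 4 * (v * (r - ρ) ^ 4) := by field_simp
      _ ≤ _ := by gcongr
  have h6 : δ * ∫ x in S, F x ∂μ ≤ N / (r - ρ) ^ 4 * I + C₁ / |γ₃| * k * J := by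
    calc δ * ∫ x in S, F x ∂μ
        ≤ C₁ / |γ₃| * k * J + (C * (μ.real univ / v / (r - ρ) ^ 4 * I)
          + C * ((Cχ ^ 4 + Cχ ^ 2) * (1 + D) ^ 4 / (r - ρ) ^ 4 * I)) := by
          rw [h2] at h1
          refine h1.trans (add_le_add h3 (add_le_add ?_ ?_))
          · exact mul_le_mul_of_nonneg_left h5 hC
          · exact mul_le_mul_of_nonneg_left h4 hC
      _ = _ := by rw [hN]; ring
  set C' := (N + C₁ / |γ₃|) / δ + 1 with hC'
  have hadd : C' = N / δ + C₁ / |γ₃| / δ + 1 := by rw [hC', add_div N]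
  have hC1 : N / δ ≤ C' := by
    have : 0 ≤ C₁ / |γ₃| / δ := by positivity
    rw [hadd]
    linarith
  have hC2 : C₁ / |γ₃| / δ ≤ C' := by
    have : 0 ≤ N / δ := by positivity
    rw [hadd]
    linarith
  calc ∫ x in S, F x ∂μ ≤ (N / (r - ρ) ^ 4 * I + C₁ / |γ₃| * k * J) / δ := by
        rwa [le_div_iff₀ hδ, mul_comm]
    _ = N / δ / (r - ρ) ^ 4 * I + C₁ / |γ₃| / δ * k * J := by ring
    _ ≤ C' / (r - ρ) ^ 4 * I + C' * k * J := by gcongr
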